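/- \textbf{Definitions.} Let $G$ be a simple graph. A \emph{matching pair} of $G$ is a pair $(M_1,M_2)$ of edge-disjoint matchings of $G$; its \emph{size} is $|M_1|+|M_2|$. It is \emph{maximal} if for every edge $e$ of $G$ with $e\notin M_1\cup M_2$, neither $M_1\cup\{e\}$ nor $M_2\cup\{e\}$ is a matching. A \emph{pair-query algorithm} is a randomized random-access program that can access a graph on the vertices $0,\dots,n-1$ only by asking, for a pair of vertices, whether there is an edge between them, and that can draw uniformly random elements of ranges $\{0,\dots,m\}$. Its running time is measured in the logarithmic-cost model: each elementary operation (arithmetic, comparison, memory access, pair query, random draw, test) costs at least $1$, plus the bit lengths of the numbers and addresses involved (for multiplication and division: the product of the bit lengths). Thus pair queries are included in the running time. \textbf{Theorem.} There are a pair-query algorithm $\mathcal A$ and constants $C>0$, $d\in\mathbb N$ such that the following holds for every $n$, every real $\varepsilon>0$ and every graph $G$ on $n$ vertices. Given $n$ and the integer $\lceil 1/\varepsilon\rceil$ as input, and pair-query access to $G$, the algorithm $\mathcal A$ always halts within time $$C\left(1+\frac{n^{1.5}}{\varepsilon^{2}}\right)(1+\log n)^{d}$$ (with $\log 0$ read as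 $0$; this is $\tilde O(n^{1.5}/\varepsilon^2)$ for $n\ge1$, $\varepsilon\le 1$), and with probability at least $2/3$ it outputs a natural number $\bar X$ such that $G$ has a maximal matching pair of size $X$ with $|X-\bar X|\le\varepsilon n$. -/

import Mathlib

/-! ## Maximal matching pairs -/

/-- `(M₁, M₂)` is a matching pair of `G`: two edge-disjoint matchings of `G`. -/
def IsMatchingPair {V : Type*} (G : SimpleGraph V) (M₁ M₂ : G.Subgraph) : Prop :=
  M₁.IsMatching ∧ M₂.IsMatching ∧ Disjoint M₁.edgeSet M₂.edgeSet

/-- A matching pair `(M₁, M₂)` is maximal if for every edge `e` of `G` outside `M₁ ∪ M₂`,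
neither `M₁ ∪ {e}` nor `M₂ ∪ {e}` is a matching. -/
def IsMaximalMatchingPair {V : Type*} (G : SimpleGraph V) (M₁ M₂ : G.Subgraph) : Prop :=
  IsMatchingPair G M₁ M₂ ∧
    ∀ (u v : V) (h : G.Adj u v), s(u, v) ∉ M₁.edgeSet ∪ M₂.edgeSet →
      ¬ (M₁ ⊔ G.subgraphOfAdj h).IsMatching ∧ ¬ (M₂ ⊔ G.subgraphOfAdj h).IsMatching

/-- The size of a matching pair: the number of edges of `M₁` plus that of `M₂`. -/
noncomputable def matchingPairSize {V : Type*} {G : SimpleGraph V} (M₁ M₂ : G.Subgraph) : ℕ :=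
  M₁.edgeSet.ncard + M₂.edgeSet.ncard

/-! ## Randomized random access machines with pair queries

Programs are finite `while`-programs over natural-number registers and arrays with random access.
Time is logarithmic-cost time: every elementary operation is charged at least `1`, plus the
bit lengths (`Nat.size`) of the numbers and addresses it handles; multiplication and division are
charged the product of the bit lengths. The input graph can be accessed only by pair queries. -/

namespace PairRAM

/-- Elementary operations on natural numbers. -/
inductive BinOp
  | add | sub | mul | div | mod | lt | eq

/-- Subtraction is truncated at `0`, division by `0` gives `0`, `x mod 0 = x`,
and comparisons return `1` (true) or `0` (false). -/
def BinOp.eval : BinOp → ℕ → ℕ → ℕ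
  | add, x, y => x + y
  | sub, x, y => x - y
  | mul, x, y => x * y
  | div, x, y => x / y
  | mod, x, y => x % y
  | lt, x, y => if x < y then 1 else 0
  | eq, x, y => if x = y then 1 else 0

/-- Time charged for an elementary operation. -/
def BinOp.cost : BinOp → ℕ → ℕ → ℕ
  | mul, x, y | div, x, y | mod, x, y => (1 + x.size) * (1 + y.size)
  | _, x, y => 1 + x.size + y.size

/-- Expressions: constants, registers, array cells, elementary operations. The name of a register
or an array is a fixed part of the program; the index into an array is computed. -/
inductive Expr
  | lit (c : ℕ)
  | reg (x : ℕ)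
  | get (a : ℕ) (i : Expr)
  | bin (op : BinOp) (e₁ e₂ : Expr)

/-- Programs. -/
inductive Cmd
  | skip
  /-- register `x` := `e` -/
  | assign (x : ℕ) (e : Expr)
  /-- cell `i` of array `a` := `e` -/
  | put (a : ℕ) (i e : Expr)
  /-- register `x` := `1` if there is an edge between the vertices `u` and `v`, else `0` -/
  | query (x : ℕ) (u v : Expr)
  /-- register `x` := a fresh uniformly random element of `{0, 1, …, e}` -/
  | rand (x : ℕ) (e : Expr)
  | seq (c₁ c₂ : Cmd)
  /-- conditional; a condition is true if its value is nonzero -/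
  | ite (e : Expr) (c₁ c₂ : Cmd)
  /-- while `e` is nonzero, do `c` -/
  | loop (e : Expr) (c : Cmd)

/-- Memory contents, together with the time used so far. -/
@[ext] structure State where
  reg : ℕ → ℕ
  arr : ℕ → ℕ → ℕ
  time : ℕ

namespace State

def tick (s : State) (t : ℕ) : State := { s with time := s.time + t }

def setReg (s : State) (x v : ℕ) : State := { s with reg := Function.update s.reg x v }

def setArr (s : State) (a i v : ℕ) : State :=
  { s with arr := Function.update s.arr a (Function.update (s.arr a) i v) }

/-- Initially register `0` holds `n`, register `1` holds `k`, and all else is zero. -/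
def init (n k : ℕ) : State where
  reg x := if x = 0 then n else if x = 1 then k else 0
  arr _ _ := 0
  time := 0

end State

/-- Value of an expression. -/
def Expr.eval (s : State) : Expr → ℕ
  | lit c => c
  | reg x => s.reg x
  | get a i => s.arr a (i.eval s)
  | bin op e₁ e₂ => op.eval (e₁.eval s) (e₂.eval s)

/-- Time charged for evaluating an expression. -/
def Expr.cost (s : State) : Expr → ℕ
  | lit c => 1 + c.size
  | reg x => 1 + (s.reg x).size
  | get a i => i.cost s + (1 + (i.eval s).size + (s.arr a (i.eval s)).size)
  | bin op e₁ e₂ => e₁.cost s + e₂.cost s + op.cost (e₁.eval s) (e₂.eval s)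

/-- Sequential composition of randomized computations; `none` is absorbing. -/
noncomputable def andThen (p : PMF (Option State)) (f : State → PMF (Option State)) :
    PMF (Option State) :=
  p.bind fun o => o.elim (PMF.pure none) f

/-- `iterate e body N` runs the loop `while e do body`, and gives up with `none` if the
condition has been tested `N` times without the loop having ended. -/
noncomputable def iterate (e : Expr) (body : State → PMF (Option State)) :
    ℕ → State → PMF (Option State)
  | 0, _ => PMF.pure none
  | N + 1, s =>
    if e.eval s = 0 then PMF.pure (some (s.tick (1 + e.cost s)))
    else andThen (body (s.tick (1 + e.cost s))) (iterate e body N)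

/-- `exec O N c s` is the distribution of the final state of the program `c`, started in state `s`
with the answers to the pair queries given by `O`, where the outcome is `none` if some loop tests
its condition `N` times without ending. In particular, if the outcome `none` has
probability `0`, this is the true distribution of the final state. -/
noncomputable def exec (O : ℕ → ℕ → ℕ) (N : ℕ) : Cmd → State → PMF (Option State)
  | .skip, s => PMF.pure (some (s.tick 1))
  | .assign x e, s =>
    PMF.pure (some ((s.setReg x (e.eval s)).tick (e.cost s + (1 + (e.eval s).size))))
  | .put a i e, s =>
    PMF.pure (some ((s.setArr a (i.eval s) (e.eval s)).tick
      (i.cost s + e.cost s + (1 + (i.eval s).size + (e.eval s).size))))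
  | .query x u v, s =>
    PMF.pure (some ((s.setReg x (O (u.eval s) (v.eval s))).tick
      (u.cost s + v.cost s + (1 + (u.eval s).size + (v.eval s).size))))
  | .rand x e, s =>
    (PMF.uniformOfFintype (Fin (e.eval s + 1))).map fun r =>
      some ((s.setReg x r).tick (e.cost s + (1 + (e.eval s).size)))
  | .seq c₁ c₂, s => andThen (exec O N c₁ s) (exec O N c₂)
  | .ite e c₁ c₂, s =>
    if e.eval s = 0 then exec O N c₂ (s.tick (1 + e.cost s))
    else exec O N c₁ (s.tick (1 + e.cost s))
  | .loop e c, s => iterate e (exec O N c) N s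

open Classical in
/-- Answers to the pair queries for a graph on the vertices `0, …, n - 1`: `1` if the two vertices
are joined by an edge, `0` otherwise. -/
noncomputable def pairOracle {n : ℕ} (G : SimpleGraph (Fin n)) (u v : ℕ) : ℕ :=
  if ∃ (hu : u < n) (hv : v < n), G.Adj ⟨u, hu⟩ ⟨v, hv⟩ then 1 else 0

/-- Run on the graph `G` with parameter `k`, the program `P` halts in every run after
time at most `T`, and with probability at least `p` the number that it leaves in
register `0` satisfies `good`. -/
def Computes {n : ℕ} (P : Cmd) (G : SimpleGraph (Fin n)) (k : ℕ) (T : ℝ) (p : ENNReal)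
    (good : ℕ → Prop) : Prop :=
  ∃ N : ℕ,
    (∀ o ∈ (exec (pairOracle G) N P (State.init n k)).support,
      ∃ s : State, o = some s ∧ (s.time : ℝ) ≤ T) ∧
    p ≤ (exec (pairOracle G) N P (State.init n k)).toOuterMeasure
      {o | ∃ s : State, o = some s ∧ good (s.reg 0)}

end PairRAM

/-! Identify the vertices with ℤ/n and give the pair `ab` the colour `a + b`, so that each colour
class consists of disjoint pairs. Draw two independent uniform sequences σ, τ of R = n(|n| + 8)
colours, where |n| is the bit length. Running through the rounds of σ and adding every edge of the
current colour whose ends are both free gives a matching M₁ of G; τ does the same in G \ M₁ and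
gives M₂. Unless a colour is missing, which is rare (`card_not_surjective_le`), (M₁, M₂) is a
maximal matching pair (`exists_maximal_pair`). Twice its size is the sum over v of the number of
matchings that cover v. With k = ⌈1/ε⌉, Chebyshev's inequality (`card_deviation_le`) estimates it
from 64k² sampled vertices; if 2k ≥ n, all vertices are examined instead.

Whether v is covered is decided by recursion: scan the rounds, and whenever the partner of v is a
neighbour, ask whether that partner was matched earlier. The core of the proof,
`sum_sum_callCost_le`, says that in the mean over σ, and summed over all starting vertices, the
recursive calls cost no more than one full scan from every vertex. A chain of calls that ends with
an examination of x in round i passes through rounds i < j₁ < … < jₘ. Rotating the colours of these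
rounds cyclically makes x matched exactly in round i, and the chain can be recovered from the
rotated sequence, x and jₘ (`path_unique`). Hence chains inject into triples (sequence, vertex,
round).

For M₂, each examined edge of G must be tested for membership in M₁, by scanning both ends until one
is matched. Before round i, free vertices most likely have only Õ(n/(i + 1)) free neighbours
(`card_not_spread_le`). Since the injection respects weights per round, testing all edges costs
Õ(n²) in the mean (`sum_edgeCost_le`). As τ is independent of σ, a random vertex costs Õ(n) in the
mean (`sum_vertexCost_le`), and by Markov's inequality a fixed budget of Õ(nk²) steps suffices.

The recursion is then turned into a machine with an explicit stack, `step`, whose number of steps is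
bounded by the above cost (`leads_done`), and this machine is simulated by a while-program
(`wp_stepCmd_frame`). Probabilities appear as counts over finite sets of sequences, with
denominators cleared. -/

namespace PairGreedy

open Finset

/-! ### Greedy rounds and the mean cost of recursive calls -/

section Rounds

/-- The vertices left unmatched by the first `j` rounds of the greedy process on `H`: in round `i`
every vertex `v` is paired with `σ i - v`, and the pairs that are edges of `H` with both ends
unmatched are added to the matching. -/
noncomputable def free {V : Type*} [AddCommGroup V] [Fintype V] (H : SimpleGraph V) (σ : ℕ → V) :
    ℕ → Finset V
  | 0 => univ
  | j + 1 => @Finset.filter V (fun v => ¬ (H.Adj v (σ j - v) ∧ σ j - v ∈ free H σ j))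
      (Classical.decPred _) (free H σ j)

variable {V : Type*} [AddCommGroup V] [Fintype V] (H : SimpleGraph V)

theorem mem_free_succ {σ : ℕ → V} {j : ℕ} {v : V} :
    v ∈ free H σ (j + 1) ↔ v ∈ free H σ j ∧ ¬ (H.Adj v (σ j - v) ∧ σ j - v ∈ free H σ j) := by
  rw [free]
  exact @Finset.mem_filter _ _ (Classical.decPred _) _ _

theorem free_anti {σ : ℕ → V} {i j : ℕ} (h : i ≤ j) : free H σ j ⊆ free H σ i := by
  induction j, h using Nat.le_induction with
  | base => exact Subset.rfl
  | succ j _ ih => exact fun v hv => ih ((mem_free_succ H).1 hv).1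

theorem free_congr {σ τ : ℕ → V} {j : ℕ} (h : ∀ i < j, σ i = τ i) : free H σ j = free H τ j := by
  induction j with
  | zero => rfl
  | succ j ih =>
    have h1 := ih fun i hi => h i (by omega)
    ext v
    rw [mem_free_succ, mem_free_succ, h1, h j (by omega)]

theorem notMem_free_of_matched {σ : ℕ → V} {i j : ℕ} {v : V} (hij : i < j)
    (ha : H.Adj v (σ i - v)) (hy : σ i - v ∈ free H σ i) : v ∉ free H σ j := fun hv =>
  ((mem_free_succ H).1 (free_anti H hij hv)).2 ⟨ha, hy⟩

/-- The increasing list of rounds `l` describes a chain of recursive calls that ends at `x` and is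
still running in round `i`. -/
def Valid (σ : ℕ → V) : V → ℕ → List ℕ → Prop
  | _, _, [] => True
  | x, i, j :: l => i < j ∧ H.Adj x (σ j - x) ∧ σ j - x ∈ free H σ j ∧ Valid σ (σ j - x) j l

theorem Valid.lt {σ : ℕ → V} {x : V} {i : ℕ} {l : List ℕ} (h : Valid H σ x i l) :
    ∀ t ∈ l, i < t := by
  induction l generalizing x i with
  | nil => simp
  | cons j l ih =>
    intro t ht
    rcases List.mem_cons.1 ht with rfl | ht
    · exact h.1
    · exact h.1.trans (ih h.2.2.2 t ht)

theorem Valid.le_getLastD {σ : ℕ → V} {x : V} {i : ℕ} {l : List ℕ} (h : Valid H σ x i l) :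
    i ≤ l.getLastD i := by
  induction l generalizing x i with
  | nil => simp
  | cons j l ih =>
    rw [List.getLastD_cons]
    exact h.1.le.trans (ih h.2.2.2)

/-- The contents of the rounds `i` and `l` moved down by one place, with `c` put on top. -/
def shift (c : V) (σ : ℕ → V) : ℕ → List ℕ → ℕ → V
  | i, [] => Function.update σ i c
  | i, j :: l => Function.update (shift c σ j l) i (σ j)

omit [AddCommGroup V] [Fintype V] in
theorem shift_of_notMem (c : V) (σ : ℕ → V) {i : ℕ} {l : List ℕ} {t : ℕ} (hi : t ≠ i)
    (hl : t ∉ l) : shift c σ i l t = σ t := by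
  induction l generalizing i with
  | nil => simp [shift, hi]
  | cons j l ih =>
    simp only [List.mem_cons, not_or] at hl
    simp [shift, hi, ih hl.1 hl.2]

theorem shift_getLastD (c : V) {σ : ℕ → V} {x : V} {i : ℕ} {l : List ℕ} (h : Valid H σ x i l) :
    shift c σ i l (l.getLastD i) = c := by
  induction l generalizing x i with
  | nil => rw [List.getLastD_nil, shift, Function.update_self]
  | cons j l ih =>
    have h1 := h.2.2.2.le_getLastD
    have h2 := h.1
    rw [List.getLastD_cons, shift, Function.update_of_ne (by omega), ih h.2.2.2]

/-- Every colour in the rounds of the chain except `σ i` reappears one place lower in the shifted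
sequence; `σ i` is overwritten, and `hi` supplies it. -/
theorem shift_inj {c : V} {σ τ : ℕ → V} {x : V} {i : ℕ} {l : List ℕ} (h : Valid H σ x i l)
    (hi : σ i = τ i) (hs : shift c σ i l = shift c τ i l) : σ = τ := by
  induction l generalizing x i with
  | nil =>
    ext1 t
    by_cases ht : t = i
    · rw [ht, hi]
    · simpa [shift, ht] using congrFun hs t
  | cons j l ih =>
    have hne : i ≠ j := h.1.ne
    have hnot : i ∉ l := fun hm => absurd (h.2.2.2.lt _ _ hm) (by have := h.1; omega)
    have hj : σ j = τ j := by simpa [shift] using congrFun hs i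
    refine ih h.2.2.2 hj (funext fun t => ?_)
    by_cases ht : t = i
    · subst ht
      rw [shift_of_notMem _ _ hne hnot, shift_of_notMem _ _ hne hnot, hi]
    · simpa [shift, ht] using congrFun hs t

/-- If `j < j'`, then round `j` of `τ` carries the colour that the shift moved down, namely that of
the second round of the first chain. So in `τ` the vertex `σ j - x` is already matched by round `j`,
with the next vertex of that chain; but it should still be free in round `j'`. -/
theorem path_head_le {c : V} {σ τ : ℕ → V} {x : V} {i j j' : ℕ} {l l' : List ℕ}
    (h : Valid H σ x i (j :: l)) (h' : Valid H τ x i (j' :: l'))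
    (hle : ∀ t ≤ i, σ t = τ t) (hs : shift c σ i (j :: l) = shift c τ i (j' :: l'))
    (hlast : l.getLastD j = l'.getLastD j') : j' ≤ j := by
  by_contra hlt
  push Not at hlt
  have hcol : σ j = τ j' := by simpa [shift] using congrFun hs i
  obtain ⟨hij, -, hy, hv⟩ := h
  obtain ⟨hij', -, hy', hv'⟩ := h'
  have hge := hv'.le_getLastD
  cases l with
  | nil => rw [List.getLastD_nil] at hlast; omega
  | cons j₂ l₂ =>
    have hvj := hv
    obtain ⟨hj, ha, hz, -⟩ := hv
    have hτ : ∀ t, i < t → t < j' → τ t = shift c σ i (j :: j₂ :: l₂) t := by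
      intro t h1 h2
      rw [hs, shift_of_notMem _ _ (by omega)]
      intro hm
      rcases List.mem_cons.1 hm with rfl | hm
      · omega
      · have := hv'.lt _ _ hm
        omega
    have hagree : ∀ t < j, σ t = τ t := by
      intro t ht
      rcases le_or_gt t i with h1 | h1
      · exact hle t h1
      · rw [hτ t h1 (by omega), shift_of_notMem _ _ (by omega)]
        intro hm
        rcases List.mem_cons.1 hm with rfl | hm
        · omega
        · have := hvj.lt _ _ hm
          omega
    have hτj : τ j = σ j₂ := by
      rw [hτ j hij hlt]
      simp [shift, hij.ne']
    have hfree := free_congr H hagree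
    rw [← hcol] at hy'
    refine notMem_free_of_matched H (σ := τ) (v := σ j - x) hlt ?_ ?_ hy'
    · rwa [hτj]
    · rw [hτj, ← hfree]
      exact free_anti H hj.le hz

/-- The chains are peeled off from the lowest round: their heads agree by `path_head_le` used both
ways, the colour moved to round `i` is common, so the sequences agree up to the head and the tails
satisfy the same hypotheses. -/
theorem path_unique {c : V} {σ τ : ℕ → V} {x : V} {i : ℕ} {l l' : List ℕ}
    (h : Valid H σ x i l) (h' : Valid H τ x i l') (hle : ∀ t ≤ i, σ t = τ t)
    (hs : shift c σ i l = shift c τ i l') (hlast : l.getLastD i = l'.getLastD i) : l = l' := by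
  induction l generalizing x i l' with
  | nil =>
    cases l' with
    | nil => rfl
    | cons j' l' =>
      have h1 := h'.2.2.2.le_getLastD
      have h2 := h'.1
      rw [List.getLastD_cons, List.getLastD_nil] at hlast
      omega
  | cons j l ih =>
    cases l' with
    | nil =>
      have h1 := h.2.2.2.le_getLastD
      have h2 := h.1
      rw [List.getLastD_cons, List.getLastD_nil] at hlast
      omega
    | cons j' l' =>
      rw [List.getLastD_cons, List.getLastD_cons] at hlast
      obtain rfl : j = j' := le_antisymm
        (path_head_le H h' h (fun t ht => (hle t ht).symm) hs.symm hlast.symm)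
        (path_head_le H h h' hle hs hlast)
      have hcol : σ j = τ j := by simpa [shift] using congrFun hs i
      have hn : ∀ t, i ≤ t → t < j → t ∉ l ∧ t ∉ l' := fun t _ h2 =>
        ⟨fun hm => by have := h.2.2.2.lt _ _ hm; omega,
          fun hm => by have := h'.2.2.2.lt _ _ hm; omega⟩
      have hsub : shift c σ j l = shift c τ j l' := by
        funext t
        by_cases ht : t = i
        · subst ht
          obtain ⟨h1, h2⟩ := hn t le_rfl h.1
          rw [shift_of_notMem _ _ h.1.ne h1, shift_of_notMem _ _ h.1.ne h2, hle t le_rfl]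
        · simpa [shift, ht] using congrFun hs t
      have hv' := h'.2.2.2
      rw [← hcol] at hv'
      rw [ih h.2.2.2 hv' ?_ hsub hlast]
      intro t ht
      rcases le_or_gt t i with h1 | h1
      · exact hle t h1
      rcases ht.lt_or_eq with h2 | rfl
      · obtain ⟨h3, h4⟩ := hn t h1.le h2
        rw [← shift_of_notMem c σ h2.ne h3, hsub, shift_of_notMem _ _ h2.ne h4]
      · exact hcol

/-- The cost of finding out by recursive calls whether `v` is matched before round `j`, if the
examination of `v` in a round with colour `c` costs `w v c`. -/
noncomputable def cost (σ : ℕ → V) (w : V → V → ℕ) : ℕ → V → ℕ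
  | 0, _ => 0
  | j + 1, v => cost σ w j v + open Classical in if v ∈ free H σ j then
      w v (σ j) + if H.Adj v (σ j - v) then cost σ w j (σ j - v) else 0 else 0

/-- The cost of the calls made by `v` in round `i`. -/
noncomputable def callCost (σ : ℕ → V) (w : V → V → ℕ) (i : ℕ) (v : V) : ℕ :=
  open Classical in
  if v ∈ free H σ i ∧ H.Adj v (σ i - v) then cost H σ w i (σ i - v) else 0

theorem cost_eq_sum (σ : ℕ → V) (w : V → V → ℕ) (j : ℕ) (v : V) : cost H σ w j v =
    ∑ i ∈ range j, ((open Classical in if v ∈ free H σ i then w v (σ i) else 0) +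
      callCost H σ w i v) := by
  induction j with
  | zero => rfl
  | succ j ih =>
    rw [cost, sum_range_succ, ← ih, callCost]
    congr 1
    by_cases h : v ∈ free H σ j <;> by_cases h1 : H.Adj v (σ j - v) <;> simp [h, h1]

open Classical in
/-- The valid lists of rounds among the `d` rounds from `J` on. -/
noncomputable def paths (σ : ℕ → V) : ℕ → ℕ → V → Finset (List ℕ)
  | 0, _, _ => {[]}
  | d + 1, J, x => paths σ d (J + 1) x ∪
      if H.Adj x (σ J - x) ∧ σ J - x ∈ free H σ J then
        (paths σ d (J + 1) (σ J - x)).image (List.cons J) else ∅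

theorem valid_of_mem_paths {σ : ℕ → V} {d J : ℕ} {x : V} {l : List ℕ} (h : l ∈ paths H σ d J x) :
    (∀ i < J, Valid H σ x i l) ∧ ∀ t ∈ l, J ≤ t ∧ t < J + d := by
  induction d generalizing J x l with
  | zero =>
    rw [paths, mem_singleton] at h
    subst h
    exact ⟨fun _ _ => trivial, by simp⟩
  | succ d ih =>
    rw [paths, mem_union] at h
    rcases h with h | h
    · obtain ⟨h1, h2⟩ := ih h
      exact ⟨fun i hi => h1 i (by omega), fun t ht => by have := h2 t ht; omega⟩
    · split_ifs at h with hc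
      · obtain ⟨l', hl', rfl⟩ := mem_image.1 h
        obtain ⟨h1, h2⟩ := ih hl'
        refine ⟨fun i hi => ⟨hi, hc.1, hc.2, h1 J (by omega)⟩, fun t ht => ?_⟩
        rcases List.mem_cons.1 ht with rfl | ht
        · omega
        · have := h2 t ht
          omega
      · simp at h

theorem nil_mem_paths (σ : ℕ → V) (d J : ℕ) (x : V) : [] ∈ paths H σ d J x := by
  induction d generalizing J with
  | zero => simp [paths]
  | succ d ih => exact mem_union_left _ (ih _)

/-- The weight of a chain of calls, given by the round of its first call. -/
def topWeight (β : ℕ → ℕ) (l : List ℕ) : ℕ := if l = [] then 0 else β (l.getLastD 0)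

/-- Putting `J` before a nonempty chain keeps its last entry, and so its weight; only the chain
`[J]` contributes a new `β J`. -/
theorem sum_paths_succ (σ : ℕ → V) (β : ℕ → ℕ) (d J : ℕ) (x : V) :
    ∑ l ∈ paths H σ (d + 1) J x, topWeight β l = ∑ l ∈ paths H σ d (J + 1) x, topWeight β l +
      open Classical in if H.Adj x (σ J - x) ∧ σ J - x ∈ free H σ J then
        β J + ∑ l ∈ paths H σ d (J + 1) (σ J - x), topWeight β l else 0 := by
  classical
  rw [paths, sum_union]
  · congr 1
    split_ifs with h
    · rw [sum_image (by simp [Set.InjOn])]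
      have : ∀ l ∈ paths H σ d (J + 1) (σ J - x), topWeight β (J :: l) =
          (if [] = l then β J else 0) + topWeight β l := by
        intro l _
        cases l <;> simp [topWeight]
      rw [sum_congr rfl this, sum_add_distrib, sum_ite_eq, if_pos (nil_mem_paths H σ d (J + 1) _)]
    · simp
  · rw [disjoint_left]
    intro l h1 h2
    split_ifs at h2 with hc
    · obtain ⟨l', -, rfl⟩ := mem_image.1 h2
      have := (valid_of_mem_paths H h1).2 J (by simp)
      omega
    · simp at h2

theorem sum_partner (c : V) (f : V → ℕ) : ∑ x, f (c - x) = ∑ x, f x :=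
  (Equiv.subLeft c).sum_comp f

/-- The recursion is unrolled from the last round down to `J`. The calls made from round `J` on
amount to costs `cost J x` still to be unrolled, one for each chain that reaches `x` through rounds
`≥ J`, and to examinations already made. A chain is weighted by the round of its outermost call. For
`J = 0` only examinations remain. -/
theorem sum_callCost (σ : ℕ → V) (w : V → V → ℕ) (β : ℕ → ℕ) (d J : ℕ) :
    ∑ i ∈ range (J + d), ∑ v, β i * callCost H σ w i v =
      ∑ i ∈ range J, ∑ v, β i * callCost H σ w i v +
      ∑ x, (∑ l ∈ paths H σ d J x, topWeight β l) * cost H σ w J x +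
      ∑ t ∈ range d, ∑ x, open Classical in if x ∈ free H σ (J + t) then
        w x (σ (J + t)) * ∑ l ∈ paths H σ (d - 1 - t) (J + t + 1) x, topWeight β l else 0 := by
  classical
  induction d generalizing J with
  | zero => simp [paths, topWeight]
  | succ d ih =>
    rw [show J + (d + 1) = J + 1 + d by ring, ih, sum_range_succ, sum_range_succ']
    have e1 : ∀ t ∈ range d, (∑ x, if x ∈ free H σ (J + (t + 1)) then w x (σ (J + (t + 1))) *
        ∑ l ∈ paths H σ (d + 1 - 1 - (t + 1)) (J + (t + 1) + 1) x, topWeight β l else 0) =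
        ∑ x, if x ∈ free H σ (J + 1 + t) then w x (σ (J + 1 + t)) *
        ∑ l ∈ paths H σ (d - 1 - t) (J + 1 + t + 1) x, topWeight β l else 0 := by
      intro t _
      rw [show J + (t + 1) = J + 1 + t by ring, show d + 1 - 1 - (t + 1) = d - 1 - t by omega]
    rw [sum_congr rfl e1]
    simp only [add_zero, Nat.add_sub_cancel, Nat.sub_zero]
    set B := fun x => ∑ l ∈ paths H σ d (J + 1) x, topWeight β l with hB
    -- One more round is unrolled; the involution `x ↦ σ J - x` turns the calls made in round `J`
    -- into chains prolonged by `J`.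
    have key : ∑ v, β J * callCost H σ w J v + ∑ x, B x * cost H σ w (J + 1) x =
        ∑ x, (∑ l ∈ paths H σ (d + 1) J x, topWeight β l) * cost H σ w J x +
        ∑ x, if x ∈ free H σ J then w x (σ J) * B x else 0 := by
      rw [← sum_partner (σ J) fun v => β J * callCost H σ w J v]
      have e2 : ∑ x, B x * cost H σ w (J + 1) x = ∑ x, B x * cost H σ w J x +
          ∑ x, (if x ∈ free H σ J then w x (σ J) * B x else 0) +
          ∑ x, B x * callCost H σ w J x := by
        rw [← sum_add_distrib, ← sum_add_distrib]
        refine sum_congr rfl fun x _ => ?_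
        rw [cost, callCost]
        by_cases h1 : x ∈ free H σ J <;> by_cases h2 : H.Adj x (σ J - x) <;>
          (simp [h1, h2]; try ring)
      rw [e2, ← sum_partner (σ J) fun v => B v * callCost H σ w J v]
      have e3 : ∀ x, (∑ l ∈ paths H σ (d + 1) J x, topWeight β l) * cost H σ w J x =
          B x * cost H σ w J x + (β J * callCost H σ w J (σ J - x) +
            B (σ J - x) * callCost H σ w J (σ J - x)) := by
        intro x
        rw [sum_paths_succ, callCost, sub_sub_cancel, H.adj_comm]
        by_cases h1 : H.Adj (σ J - x) x <;> by_cases h2 : σ J - x ∈ free H σ J <;>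
          (simp [h1, h2, hB]; try ring)
      simp only [e3, sum_add_distrib]
      ring
    simp only [hB] at key
    linarith [key]

/-- A finite sequence of colours, continued by `0`. -/
def extend {R : ℕ} (f : Fin R → V) (i : ℕ) : V := if h : i < R then f ⟨i, h⟩ else 0

omit [Fintype V] in
theorem extend_injective {R : ℕ} : Function.Injective (extend : (Fin R → V) → ℕ → V) := by
  intro f g h
  ext1 i
  simpa [extend] using congrFun h i

omit [Fintype V] in
theorem extend_restrict {R : ℕ} {σ : ℕ → V} (h : ∀ i, R ≤ i → σ i = 0) :
    extend (fun i : Fin R => σ i) = σ := by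
  funext i
  by_cases hi : i < R
  · simp [extend, hi]
  · simp [extend, hi, h i (by omega)]

omit [Fintype V] in
theorem shift_extend {R : ℕ} {f : Fin R → V} {c : V} {i : ℕ} {l : List ℕ} (hi : i < R)
    (hl : ∀ t ∈ l, t < R) :
    extend (fun t : Fin R => shift c (extend f) i l t) = shift c (extend f) i l := by
  apply extend_restrict
  intro t ht
  rw [shift_of_notMem _ _ (by omega) (fun hm => by have := hl t hm; omega)]
  simp [extend, show ¬ t < R by omega]

/-- In the mean over the colours, chains of calls are no more expensive than first examinations. -/
theorem sum_sum_callCost_le (w : V → V → ℕ) (β : ℕ → ℕ) (R : ℕ) :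
    ∑ f : Fin R → V, ∑ i ∈ range R, ∑ v, β i * callCost H (extend f) w i v ≤
      ∑ f : Fin R → V, ∑ x, ∑ j ∈ range R, β j * w x (extend f j) := by
  classical
  have e1 : ∀ f : Fin R → V, ∑ i ∈ range R, ∑ v, β i * callCost H (extend f) w i v =
      ∑ i ∈ range R, ∑ x ∈ free H (extend f) i,
        ∑ l ∈ (paths H (extend f) (R - 1 - i) (i + 1) x).filter (· ≠ []),
          w x (extend f i) * β (l.getLastD 0) := by
    intro f
    have := sum_callCost H (extend f) w β R 0
    simp only [zero_add, range_zero, sum_empty, cost, mul_zero, sum_const_zero] at this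
    rw [this]
    refine sum_congr rfl fun i _ => ?_
    rw [← sum_filter, filter_mem_eq_inter, univ_inter]
    refine sum_congr rfl fun x _ => ?_
    rw [← mul_sum, sum_filter]
    congr 1
    refine sum_congr rfl fun l _ => ?_
    by_cases h : l = [] <;> simp [topWeight, h]
  simp only [e1]
  simp only [sum_sigma']
  -- The rotation moves `σ i` to the round of the outermost call. The sequence, `i` and the inner
  -- rounds of the chain are forgotten and have to be recovered.
  let φ : (Σ _ : Fin R → V, Σ _ : ℕ, Σ _ : V, List ℕ) → (Σ _ : Fin R → V, Σ _ : V, ℕ) :=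
    fun p => ⟨fun t => shift (extend p.1 p.2.1) (extend p.1) p.2.1 p.2.2.2 t, p.2.2.1,
      p.2.2.2.getLastD 0⟩
  set D := univ.sigma fun f : Fin R → V => (range R).sigma fun i =>
    (free H (extend f) i).sigma fun x =>
      (paths H (extend f) (R - 1 - i) (i + 1) x).filter (· ≠ []) with hD
  have hmem : ∀ p ∈ D, p.2.1 < R ∧ p.2.2.1 ∈ free H (extend p.1) p.2.1 ∧
      Valid H (extend p.1) p.2.2.1 p.2.1 p.2.2.2 ∧ (∀ t ∈ p.2.2.2, t < R) ∧ p.2.2.2 ≠ [] := by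
    rintro ⟨f, i, x, l⟩ hp
    simp only [hD, mem_sigma, mem_univ, mem_range, true_and, mem_filter] at hp
    obtain ⟨h1, h2, h3, h4⟩ := hp
    obtain ⟨h5, h6⟩ := valid_of_mem_paths H h3
    exact ⟨h1, h2, h5 i (by omega), fun t ht => by have := h6 t ht; omega, h4⟩
  have hext : ∀ p ∈ D, extend (φ p).1 =
      shift (extend p.1 p.2.1) (extend p.1) p.2.1 p.2.2.2 := fun p hp => by
    obtain ⟨h1, h2, h3, h4, h5⟩ := hmem p hp
    exact shift_extend h1 h4
  have hlastD : ∀ l : List ℕ, l ≠ [] → ∀ i, l.getLastD i = l.getLastD 0 := by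
    intro l hl i
    cases l with
    | nil => simp at hl
    | cons j l => rw [List.getLastD_cons, List.getLastD_cons]
  -- After the rotation, round `i` carries the colour of the innermost call, so `x` is matched
  -- exactly then; this makes `i` readable from the image.
  have hmatch : ∀ p ∈ D, p.2.2.1 ∈ free H (extend (φ p).1) p.2.1 ∧
      p.2.2.1 ∉ free H (extend (φ p).1) (p.2.1 + 1) := by
    intro p hp
    rw [hext p hp]
    obtain ⟨f, i, x, l⟩ := p
    obtain ⟨h1, h2, h3, h4, h5⟩ := hmem _ hp
    dsimp only at h1 h2 h3 h4 h5 ⊢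
    cases l with
    | nil => simp at h5
    | cons j l =>
      have hag : ∀ t < i, shift (extend f i) (extend f) i (j :: l) t = extend f t := fun t ht =>
        shift_of_notMem _ _ (by omega) fun hm => by have := h3.lt _ _ hm; omega
      have hsi : shift (extend f i) (extend f) i (j :: l) i = extend f j := by simp [shift]
      refine ⟨by rwa [free_congr H hag], notMem_free_of_matched H (i := i) (by omega) ?_ ?_⟩
      · rw [hsi]; exact h3.2.1
      · rw [hsi, free_congr H hag]; exact free_anti H h3.1.le h3.2.2.1
  have hinj : Set.InjOn φ D := by
    intro p hp q hq hpq
    have hm1 := hmatch p hp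
    have hm2 := hmatch q hq
    have he1 := hext p hp
    have he2 := hext q hq
    have hp' := hmem p hp
    have hq' := hmem q hq
    rw [hpq] at hm1 he1
    obtain ⟨f, i, x, l⟩ := p
    obtain ⟨g, i', x', l'⟩ := q
    have hφ : x = x' ∧ l.getLastD 0 = l'.getLastD 0 := by
      simp only [φ, Sigma.mk.injEq, heq_eq_eq] at hpq
      exact hpq.2
    obtain ⟨rfl, hl⟩ := hφ
    dsimp only at *
    obtain ⟨h1, h2, h3, h4, h5⟩ := hp'
    obtain ⟨h1', h2', h3', h4', h5'⟩ := hq'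
    obtain rfl : i = i' := by
      by_contra hne
      rcases Nat.lt_or_gt_of_ne hne with h | h
      · exact hm1.2 (free_anti H h hm2.1)
      · exact hm2.2 (free_anti H h hm1.1)
    have hl' : l.getLastD i = l'.getLastD i := by rw [hlastD l h5, hlastD l' h5', hl]
    -- The last round of the chain holds the displaced colour of round `i`.
    have hc : extend f i = extend g i := by
      rw [← shift_getLastD H (extend f i) h3, ← he1, hl', he2, shift_getLastD H _ h3']
    have hs : shift (extend f i) (extend f) i l = shift (extend f i) (extend g) i l' := by
      rw [← he1, he2, hc]
    have hle : ∀ t ≤ i, extend f t = extend g t := by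
      intro t ht
      rcases ht.lt_or_eq with h | rfl
      · have := congrFun hs t
        rwa [shift_of_notMem _ _ h.ne (fun hm => by have := h3.lt _ _ hm; omega),
          shift_of_notMem _ _ h.ne (fun hm => by have := h3'.lt _ _ hm; omega)] at this
      · exact hc
    obtain rfl := path_unique H h3 h3' hle hs hl'
    have := extend_injective (shift_inj H h3 hc hs)
    subst this
    rfl
  -- The examination of `x` with colour `σ i` becomes one with the colour that the rotated sequence
  -- has in the outermost round, so weights are preserved.
  calc _ = ∑ p ∈ D, β (φ p).2.2 * w (φ p).2.1 (extend (φ p).1 (φ p).2.2) := by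
        refine sum_congr rfl fun p hp => ?_
        rw [hext p hp]
        obtain ⟨h1, h2, h3, h4, h5⟩ := hmem p hp
        have : (φ p).2.2 = p.2.2.2.getLastD p.2.1 := (hlastD _ h5 _).symm
        rw [this, shift_getLastD H _ h3, hlastD _ h5 p.2.1]
        exact Nat.mul_comm _ _
    _ = ∑ q ∈ D.image φ, β q.2.2 * w q.2.1 (extend q.1 q.2.2) := (sum_image
          (f := fun q : (Σ _ : Fin R → V, Σ _ : V, ℕ) => β q.2.2 * w q.2.1 (extend q.1 q.2.2)) hinj).symm
    _ ≤ _ := by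
        refine sum_le_sum_of_subset fun q hq => ?_
        obtain ⟨p, hp, rfl⟩ := mem_image.1 hq
        obtain ⟨h1, h2, h3, h4, h5⟩ := hmem p hp
        have hlt : (φ p).2.2 < R := by
          apply h4
          change p.2.2.2.getLastD 0 ∈ p.2.2.2
          rw [List.getLastD_eq_getLast?, List.getLast?_eq_some_getLast h5]
          exact List.getLast_mem h5
        simp [hlt]

end Rounds

/-! ### The maximal matching pair produced by two greedy processes -/

section Matching

variable {V : Type*} [AddCommGroup V] [Fintype V] (H : SimpleGraph V)

/-- The matching found in the first `R` rounds of the greedy process. -/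
def greedy (σ : ℕ → V) (R : ℕ) : SimpleGraph V where
  Adj a b := H.Adj a b ∧ ∃ j < R, a ∈ free H σ j ∧ b ∈ free H σ j ∧ σ j = a + b
  symm := ⟨fun a b ⟨h, j, hj, ha, hb, hs⟩ => ⟨h.symm, j, hj, hb, ha, by rw [hs, add_comm]⟩⟩
  loopless := ⟨fun a h => H.irrefl h.1⟩

theorem greedy_le (σ : ℕ → V) (R : ℕ) : greedy H σ R ≤ H := fun _ _ h => h.1

/-- Once matched, a vertex is no longer free in later rounds, and within a round the colour
determines its partner. -/
theorem greedy_adj_unique {σ : ℕ → V} {R : ℕ} {a b c : V} (h : (greedy H σ R).Adj a b)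
    (h' : (greedy H σ R).Adj a c) : b = c := by
  obtain ⟨h1, i, -, ha, hb, hs⟩ := h
  obtain ⟨h2, j, -, ha', hc, hs'⟩ := h'
  have hb' : σ i - a = b := by rw [hs, add_sub_cancel_left]
  have hc' : σ j - a = c := by rw [hs', add_sub_cancel_left]
  rcases lt_trichotomy i j with h | rfl | h
  · exact absurd ha' (notMem_free_of_matched H h (by rwa [hb']) (by rwa [hb']))
  · rw [← hb', hc']
  · exact absurd ha (notMem_free_of_matched H h (by rwa [hc']) (by rwa [hc']))

theorem notMem_free_iff {σ : ℕ → V} {R : ℕ} {v : V} :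
    v ∉ free H σ R ↔ ∃ b, (greedy H σ R).Adj v b := by
  constructor
  · intro h
    induction R with
    | zero => simp [free] at h
    | succ R ih =>
      by_cases hv : v ∈ free H σ R
      · rw [mem_free_succ] at h
        push Not at h
        obtain ⟨h1, h2⟩ := h hv
        exact ⟨σ R - v, h1, R, by omega, hv, h2, by abel⟩
      · obtain ⟨b, h1, j, hj, h2⟩ := ih hv
        exact ⟨b, h1, j, by omega, h2⟩
  · rintro ⟨b, h1, j, hj, hv, hb, hs⟩
    have : σ j - v = b := by rw [hs, add_sub_cancel_left]
    exact notMem_free_of_matched H hj (by rwa [this]) (by rwa [this])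

/-- A round of colour `a + b` adds the edge if both ends are still free. -/
theorem not_adj_free {σ : ℕ → V} {R : ℕ} (hσ : ∀ c, ∃ j < R, σ j = c) {a b : V} (h : H.Adj a b) :
    a ∉ free H σ R ∨ b ∉ free H σ R := by
  by_contra hcon
  push Not at hcon
  obtain ⟨j, hj, hs⟩ := hσ (a + b)
  refine (notMem_free_iff H).2 ⟨b, h, j, hj, ?_, ?_, hs⟩ hcon.1
  · exact free_anti H hj.le hcon.1
  · exact free_anti H hj.le hcon.2

/-- A graph in which every vertex has at most one neighbour, as a subgraph. -/
def toMatching {G M : SimpleGraph V} (hM : M ≤ G) : G.Subgraph where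
  verts := {v | ∃ b, M.Adj v b}
  Adj := M.Adj
  adj_sub h := hM h
  edge_vert h := ⟨_, h⟩
  symm := ⟨fun _ _ h => M.adj_symm h⟩

omit [AddCommGroup V] [Fintype V] in
theorem toMatching_isMatching {G M : SimpleGraph V} (hM : M ≤ G)
    (hu : ∀ a b c, M.Adj a b → M.Adj a c → b = c) : (toMatching hM).IsMatching := by
  rintro v ⟨b, hb⟩
  exact ⟨b, hb, fun c hc => hu v c b hc hb⟩

omit [AddCommGroup V] in
-- Handshake lemma: the degrees are `1` on `s` and `0` elsewhere.
theorem two_mul_ncard_toMatching {G M : SimpleGraph V} (hM : M ≤ G)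
    (hu : ∀ a b c, M.Adj a b → M.Adj a c → b = c) (s : Finset V)
    (hs : ∀ v, v ∈ s ↔ ∃ b, M.Adj v b) : 2 * (toMatching hM).edgeSet.ncard = s.card := by
  classical
  have h1 : (toMatching hM).edgeSet = M.edgeSet := by
    ext e
    induction e using Sym2.ind with
    | _ a b => rfl
  rw [h1, ← SimpleGraph.coe_edgeFinset, Set.ncard_coe_finset,
    ← M.sum_degrees_eq_twice_card_edges, card_eq_sum_ones, ← sum_filter_add_sum_filter_not univ
      (· ∈ s), filter_mem_eq_inter, univ_inter]
  have h2 : ∀ v ∈ s, M.degree v = 1 := by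
    intro v hv
    obtain ⟨b, hb⟩ := (hs v).1 hv
    rw [← M.card_neighborFinset_eq_degree, card_eq_one]
    refine ⟨b, ?_⟩
    ext c
    rw [M.mem_neighborFinset, mem_singleton]
    exact ⟨fun hc => hu v c b hc hb, fun hc => hc ▸ hb⟩
  have h3 : ∀ v ∈ univ.filter (· ∉ s), M.degree v = 0 := by
    intro v hv
    rw [← M.card_neighborFinset_eq_degree, card_eq_zero]
    ext c
    rw [M.mem_neighborFinset]
    simp only [mem_filter, mem_univ, true_and, hs, not_exists] at hv
    simp [hv c]
  rw [sum_congr rfl h2, sum_congr rfl h3]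
  simp

omit [AddCommGroup V] [Fintype V] in
theorem not_isMatching_sup {G M : SimpleGraph V} (hM : M ≤ G) {u v w : V} (h : G.Adj u v)
    (hw : M.Adj u w ∨ M.Adj v w) (huv : ¬ M.Adj u v) :
    ¬ (toMatching hM ⊔ G.subgraphOfAdj h).IsMatching := by
  intro hm
  rcases hw with hw | hw
  · have : v = w := hm.eq_of_adj_left (u := u) (Or.inr (by simp)) (Or.inl hw)
    exact huv (this ▸ hw)
  · have : u = w := hm.eq_of_adj_left (u := v) (Or.inr (by simp)) (Or.inl hw)
    exact huv (this ▸ hw.symm)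

/-- An edge in neither matching is an edge of both `G` and `G \ M₁`, so each process, having used
all colours, has covered one of its ends by another edge, and this blocks the addition. In the last
clause the sets of covered vertices may be presented by any finsets with the right members. -/
theorem exists_maximal_pair (G : SimpleGraph V) {σ τ : ℕ → V} {R : ℕ}
    (hσ : ∀ c, ∃ j < R, σ j = c) (hτ : ∀ c, ∃ j < R, τ j = c) :
    ∃ M₁ M₂ : G.Subgraph, IsMaximalMatchingPair G M₁ M₂ ∧
      ∀ s t : Finset V, (∀ v, v ∈ s ↔ v ∉ free G σ R) →
        (∀ v, v ∈ t ↔ v ∉ free (G \ greedy G σ R) τ R) →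
        2 * matchingPairSize M₁ M₂ = s.card + t.card := by
  set K := G \ greedy G σ R with hK
  have hKG : K ≤ G := sdiff_le
  have h1 := greedy_le G σ R
  have h2 : greedy K τ R ≤ G := (greedy_le K τ R).trans hKG
  refine ⟨toMatching h1, toMatching h2, ⟨⟨toMatching_isMatching h1 fun a b c => greedy_adj_unique G,
    toMatching_isMatching h2 fun a b c => greedy_adj_unique K, ?_⟩, ?_⟩, ?_⟩
  · rw [Set.disjoint_left]
    intro e
    induction e using Sym2.ind with
    | _ a b =>
      intro ha hb
      have hb' : (greedy K τ R).Adj a b := hb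
      have hb'' : K.Adj a b := hb'.1
      rw [hK, SimpleGraph.sdiff_adj] at hb''
      exact hb''.2 ha
  · intro u v h hn
    have hn1 : ¬ (greedy G σ R).Adj u v := fun hc => hn (Or.inl hc)
    have hn2 : ¬ (greedy K τ R).Adj u v := fun hc => hn (Or.inr hc)
    have hKuv : K.Adj u v := by
      rw [hK, SimpleGraph.sdiff_adj]
      exact ⟨h, hn1⟩
    constructor
    · rcases not_adj_free G hσ h with hf | hf <;> obtain ⟨w, hw⟩ := (notMem_free_iff G).1 hf
      · exact not_isMatching_sup h1 h (Or.inl hw) hn1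
      · exact not_isMatching_sup h1 h (Or.inr hw) hn1
    · rcases not_adj_free K hτ hKuv with hf | hf <;> obtain ⟨w, hw⟩ := (notMem_free_iff K).1 hf
      · exact not_isMatching_sup h2 h (Or.inl hw) hn2
      · exact not_isMatching_sup h2 h (Or.inr hw) hn2
  · intro s t hs ht
    rw [matchingPairSize, mul_add,
      two_mul_ncard_toMatching h1 (fun a b c => greedy_adj_unique G) s fun v => by
        rw [hs, notMem_free_iff],
      two_mul_ncard_toMatching h2 (fun a b c => greedy_adj_unique K) t fun v => by
        rw [ht, notMem_free_iff]]

end Matching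

/-! ### Resampling one colour; decay of the number of free neighbours -/

section Resampling

variable {V : Type*} [Fintype V]

/-- The map `(f, c) ↦ (update f j c, f j)` is an involution: resampling one coordinate preserves the
uniform distribution. -/
theorem sum_update {R : ℕ} [DecidableEq (Fin R)] {M : Type*} [CommSemiring M] (j : Fin R)
    (F : (Fin R → V) → M) :
    ∑ f : Fin R → V, ∑ c, F (Function.update f j c) = Fintype.card V * ∑ f, F f := by
  rw [← Fintype.sum_prod_type' (f := fun f c => F (Function.update f j c))]
  have h := Fintype.sum_equiv
    (⟨fun p => (Function.update p.1 j p.2, p.1 j), fun p => (Function.update p.1 j p.2, p.1 j),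
      fun p => by simp, fun p => by simp⟩ : ((Fin R → V) × V) ≃ ((Fin R → V) × V))
    (fun p => F (Function.update p.1 j p.2)) (fun p => F p.1) (fun p => rfl)
  rw [h, Fintype.sum_prod_type]
  simp [mul_sum]

theorem sum_coord {R : ℕ} (j : Fin R) (g : V → ℕ) :
    Fintype.card V * ∑ f : Fin R → V, g (f j) = Fintype.card V ^ R * ∑ c, g c := by
  have h := sum_update j fun f : Fin R → V => g (f j)
  simp only [Function.update_self, sum_const, card_univ, Fintype.card_fun, Fintype.card_fin,
    smul_eq_mul] at h
  exact_mod_cast h.symm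

theorem card_missing (R : ℕ) (c : V) [DecidableEq V] :
    (univ.filter fun f : Fin R → V => ∀ i, f i ≠ c).card = (Fintype.card V - 1) ^ R := by
  have : (univ.filter fun f : Fin R → V => ∀ i, f i ≠ c) =
      Fintype.piFinset fun _ : Fin R => univ.erase c := by
    ext f
    simp
  rw [this, Fintype.card_piFinset]
  simp [card_erase_of_mem]

open Classical in
/-- The number of unmatched neighbours before round `j`. -/
noncomputable def freeDegree [AddCommGroup V] (H : SimpleGraph V) (σ : ℕ → V) (j : ℕ) (v : V) : ℕ :=
  ((free H σ j).filter fun b => H.Adj v b).card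

variable [AddCommGroup V] (H : SimpleGraph V)

theorem freeDegree_anti {σ : ℕ → V} {i j : ℕ} (h : i ≤ j) (v : V) :
    freeDegree H σ j v ≤ freeDegree H σ i v := by
  classical
  unfold freeDegree
  gcongr
  exact free_anti H h

omit [Fintype V] in
theorem extend_update_of_lt {R : ℕ} (f : Fin R → V) (j : Fin R) (c : V) :
    ∀ i < (j : ℕ), extend (Function.update f j c) i = extend f i := by
  intro i hi
  have hR : i < R := hi.trans j.2
  have hne : (⟨i, hR⟩ : Fin R) ≠ j := fun h => by rw [← h] at hi; simp at hi
  simp [extend, hR, Function.update_of_ne hne]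

open Classical in
-- While `v` is free with at least `d` free neighbours, at least `d` colours would match it in the
-- next round. So each round, seen by resampling its colour with the earlier ones fixed, multiplies
-- the count by at most `(n - d) / n`.
theorem card_freeDegree_ge (R d : ℕ) (v : V) (j : ℕ) (hj : j ≤ R) :
    Fintype.card V ^ j * (univ.filter fun f : Fin R → V =>
      v ∈ free H (extend f) j ∧ d ≤ freeDegree H (extend f) j v).card ≤
      (Fintype.card V - d) ^ j * Fintype.card V ^ R := by
  induction j with
  | zero =>
    simp only [pow_zero, one_mul]
    exact (card_le_univ _).trans (by simp)
  | succ j ih =>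
    set P : ℕ → (Fin R → V) → Prop := fun j f =>
      v ∈ free H (extend f) j ∧ d ≤ freeDegree H (extend f) j v with hP
    have key : Fintype.card V * (univ.filter (P (j + 1))).card ≤
        (Fintype.card V - d) * (univ.filter (P j)).card := by
      have h1 := sum_update (⟨j, hj⟩ : Fin R) fun f : Fin R → V => if P (j + 1) f then 1 else 0
      rw [card_filter, ← Nat.cast_id (Fintype.card V), ← h1, card_filter, mul_sum]
      refine sum_le_sum fun f _ => ?_
      have hag : ∀ c, ∀ i < j, extend (Function.update f ⟨j, hj⟩ c) i = extend f i := fun c =>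
        extend_update_of_lt f ⟨j, hj⟩ c
      have hPj : ∀ c, P (j + 1) (Function.update f ⟨j, hj⟩ c) → P j f ∧
          c - v ∉ (free H (extend f) j).filter fun b => H.Adj v b := by
        rintro c ⟨h2, h3⟩
        have h4 := free_congr H (hag c)
        have h5 : extend (Function.update f ⟨j, hj⟩ c) j = c := by
          simp [extend, show j < R from hj]
        have h6 := (mem_free_succ H).1 h2
        refine ⟨⟨h4 ▸ h6.1, ?_⟩, fun hc => ?_⟩
        · have := freeDegree_anti H (σ := extend (Function.update f ⟨j, hj⟩ c)) j.le_succ v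
          rw [freeDegree, freeDegree, h4] at this
          exact h3.trans this
        · rw [mem_filter] at hc
          refine h6.2 ?_
          rw [h5, h4]
          exact ⟨hc.2, hc.1⟩
      by_cases hc : P j f
      · rw [if_pos hc, Nat.cast_id, mul_one]
        calc _ ≤ ∑ c : V, if c - v ∈ (free H (extend f) j).filter fun b => H.Adj v b
              then 0 else 1 := by
              refine sum_le_sum fun c _ => ?_
              split_ifs with h7 h8 <;> simp
              exact (hPj c h7).2 h8
          _ = ∑ b : V, if b ∈ (free H (extend f) j).filter fun b => H.Adj v b then 0 else 1 :=
              (Equiv.subRight v).sum_comp fun b =>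
                if b ∈ (free H (extend f) j).filter fun b => H.Adj v b then 0 else 1
          _ = ((free H (extend f) j).filter fun b => H.Adj v b)ᶜ.card := by
              rw [compl_eq_univ_sdiff, ← filter_notMem_eq_sdiff, card_filter]
              exact sum_congr rfl fun b _ => by split_ifs <;> simp_all
          _ ≤ _ := by
              rw [card_compl]
              exact Nat.sub_le_sub_left hc.2 _
      · rw [if_neg hc, mul_zero]
        refine (sum_eq_zero fun c _ => if_neg fun h7 => hc (hPj c h7).1).le
    calc _ = Fintype.card V ^ j * (Fintype.card V * (univ.filter (P (j + 1))).card) := by ring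
      _ ≤ Fintype.card V ^ j * ((Fintype.card V - d) * (univ.filter (P j)).card) := by gcongr
      _ = (Fintype.card V - d) * (Fintype.card V ^ j * (univ.filter (P j)).card) := by ring
      _ ≤ (Fintype.card V - d) * ((Fintype.card V - d) ^ j * Fintype.card V ^ R) := by
        exact Nat.mul_le_mul_left _ (ih (by omega))
      _ = _ := by ring

end Resampling

/-! ### Mean cost of examining a vertex -/

section Cost

variable {V : Type*} [AddCommGroup V] [Fintype V] (H : SimpleGraph V)

/-- The cost of finding out whether the edge `ab` is in the greedy matching, by scanning both ends
until one of them is matched. -/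
noncomputable def edgeCost (σ : ℕ → V) (R : ℕ) (a b : V) : ℕ :=
  open Classical in
  ∑ i ∈ range R, if a ∈ free H σ i ∧ b ∈ free H σ i then
    6 + callCost H σ (fun _ _ => 3) i a + callCost H σ (fun _ _ => 3) i b else 0

/-- Before round `i`, unmatched vertices have at most `β i` unmatched neighbours. -/
def Spread (σ : ℕ → V) (R : ℕ) (β : ℕ → ℕ) : Prop :=
  ∀ i < R, ∀ a ∈ free H σ i, freeDegree H σ i a ≤ β i

open Classical in
-- Round `i` is charged to an edge only while both ends are free, hence to at most `β i` edges at a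
-- given `a`. The two ends contribute equally, which gives the factor `2`.
theorem sum_edgeCost_le {σ : ℕ → V} {R : ℕ} {β : ℕ → ℕ} (hD : Spread H σ R β) :
    ∑ a, ∑ b, (if H.Adj a b then edgeCost H σ R a b else 0) ≤
      6 * Fintype.card V * ∑ i ∈ range R, β i +
        2 * ∑ i ∈ range R, ∑ v, β i * callCost H σ (fun _ _ => 3) i v := by
  set C := callCost H σ (fun _ _ => 3) with hC
  have e1 : ∑ a, ∑ b, (if H.Adj a b then edgeCost H σ R a b else 0) =
      ∑ i ∈ range R, ∑ a, ∑ b,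
        ((if H.Adj a b ∧ a ∈ free H σ i ∧ b ∈ free H σ i then 3 + C i a else 0) +
          (if H.Adj a b ∧ a ∈ free H σ i ∧ b ∈ free H σ i then 3 + C i b else 0)) := by
    rw [sum_comm]
    conv_rhs => rw [sum_comm]
    rw [sum_comm]
    refine sum_congr rfl fun a _ => ?_
    rw [sum_comm]
    refine sum_congr rfl fun b _ => ?_
    by_cases h : H.Adj a b
    · rw [if_pos h, edgeCost]
      refine sum_congr rfl fun i _ => ?_
      by_cases h1 : a ∈ free H σ i ∧ b ∈ free H σ i
      · simp only [h, h1, and_self, if_true, hC]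
        omega
      · simp [h1]
    · simp [h]
  rw [e1, mul_sum, mul_sum, ← sum_add_distrib]
  refine sum_le_sum fun i hi => ?_
  simp only [sum_add_distrib]
  have e2 : ∑ a, ∑ b, (if H.Adj a b ∧ a ∈ free H σ i ∧ b ∈ free H σ i then 3 + C i b else 0) =
      ∑ a, ∑ b, (if H.Adj a b ∧ a ∈ free H σ i ∧ b ∈ free H σ i then 3 + C i a else 0) := by
    rw [sum_comm]
    refine sum_congr rfl fun b _ => sum_congr rfl fun a _ => ?_
    refine if_congr ?_ rfl rfl
    rw [H.adj_comm, and_comm (a := a ∈ _)]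
  have e3 : ∑ a, ∑ b, (if H.Adj a b ∧ a ∈ free H σ i ∧ b ∈ free H σ i then 3 + C i a else 0) ≤
      ∑ a, β i * (3 + C i a) := by
    refine sum_le_sum fun a _ => ?_
    by_cases ha : a ∈ free H σ i
    · have : (∑ b, if H.Adj a b ∧ a ∈ free H σ i ∧ b ∈ free H σ i then 3 + C i a else 0) =
          freeDegree H σ i a * (3 + C i a) := by
        rw [← sum_filter, sum_const, smul_eq_mul, freeDegree]
        congr 2
        ext b
        simp [ha, and_comm]
      rw [this]
      exact Nat.mul_le_mul_right _ (hD i (mem_range.1 hi) a ha)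
    · simp [ha]
  have e4 : ∑ a, β i * (3 + C i a) = 3 * Fintype.card V * β i + ∑ v, β i * C i v := by
    simp only [mul_add, sum_add_distrib, sum_const, card_univ, smul_eq_mul]
    ring
  rw [e2]
  rw [e4] at e3
  linarith

/-- The colour of a single round is uniform. -/
theorem card_mul_sum_first (w : V → V → ℕ) (β : ℕ → ℕ) (R : ℕ) :
    Fintype.card V * ∑ f : Fin R → V, ∑ x, ∑ j ∈ range R, β j * w x (extend f j) =
      Fintype.card V ^ R * (∑ j ∈ range R, β j) * ∑ x, ∑ c, w x c := by
  have e : ∀ x, ∀ j ∈ range R, Fintype.card V * ∑ f : Fin R → V, β j * w x (extend f j) =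
      β j * (Fintype.card V ^ R * ∑ c, w x c) := by
    intro x j hj
    have := sum_coord (⟨j, mem_range.1 hj⟩ : Fin R) fun c => w x c
    rw [← this, ← mul_sum]
    have h : ∀ f : Fin R → V, extend f j = f ⟨j, mem_range.1 hj⟩ := fun f => by
      simp [extend, mem_range.1 hj]
    simp only [h]
    ring
  calc _ = ∑ x, ∑ j ∈ range R, Fintype.card V * ∑ f : Fin R → V, β j * w x (extend f j) := by
        rw [sum_comm, mul_sum]
        refine sum_congr rfl fun x _ => ?_
        rw [sum_comm, mul_sum]
    _ = ∑ x, ∑ j ∈ range R, β j * (Fintype.card V ^ R * ∑ c, w x c) :=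
        sum_congr rfl fun x _ => sum_congr rfl (e x)
    _ = _ := by
        simp only [← sum_mul, ← mul_sum]
        ring

/-- The cost consists of own examinations and of calls; by `sum_sum_callCost_le` with `β = 1` the
calls at most double it. -/
theorem card_mul_sum_cost_le (w : V → V → ℕ) (R : ℕ) :
    Fintype.card V * ∑ f : Fin R → V, ∑ v, cost H (extend f) w R v ≤
      2 * Fintype.card V ^ R * R * ∑ x, ∑ c, w x c := by
  have h1 := sum_sum_callCost_le H w (fun _ => 1) R
  have h2 := card_mul_sum_first w (fun _ => 1) R
  simp only [one_mul, sum_const, card_range, smul_eq_mul, mul_one] at h1 h2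
  have h3 : ∑ f : Fin R → V, ∑ v, cost H (extend f) w R v ≤
      ∑ f : Fin R → V, ∑ x, ∑ j ∈ range R, w x (extend f j) +
      ∑ f : Fin R → V, ∑ i ∈ range R, ∑ v, callCost H (extend f) w i v := by
    rw [← sum_add_distrib]
    refine sum_le_sum fun f _ => ?_
    rw [sum_comm (s := range R), ← sum_add_distrib]
    refine sum_le_sum fun v _ => ?_
    rw [cost_eq_sum, ← sum_add_distrib]
    refine sum_le_sum fun i _ => ?_
    gcongr
    split_ifs <;> simp
  calc _ ≤ Fintype.card V * (2 * ∑ f : Fin R → V, ∑ x, ∑ j ∈ range R, w x (extend f j)) := by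
        gcongr
        linarith
    _ = _ := by linarith

open Classical in
/-- The cost of an examination in the construction of the second matching. -/
noncomputable def secondWeight (σ : ℕ → V) (R : ℕ) (x c : V) : ℕ :=
  4 + if H.Adj x (c - x) then edgeCost H σ R x (c - x) else 0

/-- The cost of finding out whether `v` is matched in the first and in the second matching. -/
noncomputable def vertexCost (σ τ : ℕ → V) (R : ℕ) (v : V) : ℕ :=
  6 + cost H σ (fun _ _ => 3) R v +
    cost (H \ greedy H σ R) τ (secondWeight H σ R) R v

open Classical in
-- The mean over the second sequence is taken first: with the first one fixed, `secondWeight` is a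
-- fixed function of vertex and colour. In `14 * R`, the scan for the first matching gives `6` and
-- the constant part of `secondWeight` gives `8`; `24 * R * B` pays for the edge tests.
theorem sum_vertexCost_le (R B : ℕ) (β : ℕ → ℕ) (hβ : ∑ i ∈ range R, β i ≤ Fintype.card V * B) :
    Fintype.card V * ∑ f : Fin R → V, ∑ g : Fin R → V, ∑ v,
      (if Spread H (extend f) R β then vertexCost H (extend f) (extend g) R v else 0) ≤
      (Fintype.card V ^ R) ^ 2 * Fintype.card V ^ 2 * (6 + 14 * R + 24 * R * B) := by
  set n := Fintype.card V with hn
  set X : (Fin R → V) → ℕ := fun f =>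
    ∑ a, ∑ b, (if H.Adj a b then edgeCost H (extend f) R a b else 0) with hX
  have hA : n * ∑ f : Fin R → V, ∑ v, cost H (extend f) (fun _ _ => 3) R v ≤
      6 * n ^ R * R * n ^ 2 := by
    refine (card_mul_sum_cost_le H _ R).trans (le_of_eq ?_)
    simp only [sum_const, card_univ, smul_eq_mul, ← hn]
    ring
  have hB : ∀ f : Fin R → V, n * ∑ g : Fin R → V, ∑ v, cost (H \ greedy H (extend f) R) (extend g)
      (secondWeight H (extend f) R) R v ≤ 2 * n ^ R * R * (4 * n ^ 2 + X f) := by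
    intro f
    refine (card_mul_sum_cost_le _ _ R).trans (le_of_eq ?_)
    congr 1
    simp only [secondWeight, sum_add_distrib, sum_const, card_univ, smul_eq_mul, ← hn, hX]
    congr 1
    · ring
    · refine sum_congr rfl fun a _ => ?_
      exact (Equiv.subRight a).sum_comp fun b =>
        if H.Adj a b then edgeCost H (extend f) R a b else 0
  have hC : ∑ f : Fin R → V, (if Spread H (extend f) R β then X f else 0) ≤
      12 * n ^ R * n * (n * B) := by
    have h1 : ∑ f : Fin R → V, (if Spread H (extend f) R β then X f else 0) ≤
        ∑ f : Fin R → V, (6 * n * ∑ i ∈ range R, β i +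
        2 * ∑ i ∈ range R, ∑ v, β i * callCost H (extend f) (fun _ _ => 3) i v) := by
      refine sum_le_sum fun f _ => ?_
      split_ifs with h
      · exact sum_edgeCost_le H h
      · exact Nat.zero_le _
    rw [sum_add_distrib] at h1
    have h2 := sum_sum_callCost_le H (fun _ _ => 3) β R
    simp only [← mul_sum] at h1 h2
    simp only [sum_const, card_univ, smul_eq_mul, Fintype.card_fun, Fintype.card_fin, ← hn,
      ← sum_mul] at h1 h2
    calc _ ≤ 12 * n ^ R * n * ∑ i ∈ range R, β i := by linarith
      _ ≤ _ := by gcongr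
  have hf : ∀ f : Fin R → V, n * ∑ g : Fin R → V, ∑ v,
      (if Spread H (extend f) R β then vertexCost H (extend f) (extend g) R v else 0) ≤
      6 * n ^ R * n ^ 2 + n ^ R * (n * ∑ v, cost H (extend f) (fun _ _ => 3) R v) +
        (8 * n ^ R * R * n ^ 2 + 2 * n ^ R * R * if Spread H (extend f) R β then X f else 0) := by
    intro f
    split_ifs with h
    · have := hB f
      simp only [vertexCost, sum_add_distrib, sum_const, card_univ, smul_eq_mul, Fintype.card_fun,
        Fintype.card_fin, ← hn] at this ⊢
      linarith
    · simp
  rw [mul_sum]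
  refine (sum_le_sum fun f _ => hf f).trans ?_
  simp only [sum_add_distrib, ← mul_sum, sum_const, card_univ, smul_eq_mul, Fintype.card_fun,
    Fintype.card_fin, ← hn]
  have h1 := Nat.mul_le_mul_left (n ^ R) hA
  have h2 := Nat.mul_le_mul_left (2 * n ^ R * R) hC
  linarith

end Cost

/-! ### Variance of the sampled sum -/

section Sampling

variable {V : Type*} [Fintype V]

theorem sum_fin_succ_fun {s : ℕ} {M : Type*} [AddCommMonoid M] (F : (Fin (s + 1) → V) → M) :
    ∑ f, F f = ∑ a, ∑ f : Fin s → V, F (Fin.cons a f) := by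
  rw [← Fintype.sum_prod_type' (f := fun a (f : Fin s → V) => F (Fin.cons a f))]
  exact (Fintype.sum_equiv (Fin.consEquiv fun _ : Fin (s + 1) => V) _ _ fun p => rfl).symm

theorem sum_samples (g : V → ℕ) (s : ℕ) :
    Fintype.card V * ∑ S : Fin s → V, ∑ t, g (S t) = s * Fintype.card V ^ s * ∑ v, g v := by
  rw [sum_comm, mul_sum]
  simp only [sum_coord, sum_const, card_univ, Fintype.card_fin, smul_eq_mul]
  ring

/-- Independence and mean zero make the cross terms vanish; the first sample is split off. -/
theorem sum_sq_samples (g : V → ℝ) (hg : ∑ v, g v = 0) (s : ℕ) :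
    (Fintype.card V : ℝ) * ∑ S : Fin s → V, (∑ t, g (S t)) ^ 2 =
      s * Fintype.card V ^ s * ∑ v, g v ^ 2 := by
  induction s with
  | zero => simp
  | succ s ih =>
    rw [sum_fin_succ_fun]
    simp only [Fin.sum_univ_succ, Fin.cons_zero, Fin.cons_succ, add_sq, sum_add_distrib, mul_assoc,
      ← mul_sum, ← sum_mul, sum_const, card_univ, nsmul_eq_mul, hg, Fintype.card_fun,
      Fintype.card_fin, zero_mul, mul_zero, add_zero, mul_add]
    rw [mul_left_comm, ih]
    push_cast
    ring

theorem card_filter_mul_le {ι : Type*} [Fintype ι] (p : ι → Prop) [DecidablePred p] (F : ι → ℝ)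
    (hF : ∀ i, 0 ≤ F i) {c : ℝ} (h : ∀ i, p i → c ≤ F i) :
    ((univ.filter p).card : ℝ) * c ≤ ∑ i, F i := by
  calc ((univ.filter p).card : ℝ) * c = ∑ i ∈ univ.filter p, c := by simp
    _ ≤ ∑ i ∈ univ.filter p, F i := sum_le_sum fun i hi => h i (mem_filter.1 hi).2
    _ ≤ _ := sum_le_sum_of_subset_of_nonneg (subset_univ _) fun i _ _ => hF i

open Classical in
-- Chebyshev: each centred term is at most `2 * n` in absolute value, so the second moment is at
-- most `4 * n ^ 2 * s`, and `4 * k ^ 2 / s ≤ 1 / 16`.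
theorem card_deviation_le (q : V → ℕ) (hq : ∀ v, q v ≤ 2) (s k : ℕ) (hk : 0 < k)
    (hs : 64 * k ^ 2 ≤ s) (hV : 0 < Fintype.card V) :
    16 * ((univ.filter fun S : Fin s → V => (Fintype.card V * s : ℝ) <
      k * |(Fintype.card V : ℝ) * (∑ t, q (S t) : ℕ) - s * (∑ v, q v : ℕ)|).card : ℝ) ≤
      (Fintype.card V : ℝ) ^ s := by
  set n := Fintype.card V with hn
  have hn0 : (0 : ℝ) < n := by exact_mod_cast hV
  have hk0 : (0 : ℝ) < k := by exact_mod_cast hk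
  set Q := ∑ v, q v with hQ
  set g : V → ℝ := fun v => n * q v - Q with hgdef
  have hg : ∑ v, g v = 0 := by
    simp only [hgdef, sum_sub_distrib, ← mul_sum, sum_const, card_univ, nsmul_eq_mul, ← hn, hQ]
    push_cast
    ring
  have hsum : ∀ S : Fin s → V, ∑ t, g (S t) = n * (∑ t, q (S t) : ℕ) - s * Q := by
    intro S
    simp only [hgdef, sum_sub_distrib, ← mul_sum, sum_const, card_univ, nsmul_eq_mul,
      Fintype.card_fin]
    push_cast
    ring
  have hg2 : ∀ v, g v ^ 2 ≤ 4 * (n : ℝ) ^ 2 := by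
    intro v
    have h1 : (q v : ℝ) ≤ 2 := by exact_mod_cast hq v
    have h2 : (Q : ℝ) ≤ 2 * n := by
      have : Q ≤ ∑ v : V, 2 := sum_le_sum fun v _ => hq v
      simp only [sum_const, card_univ, smul_eq_mul, ← hn] at this
      exact_mod_cast (by linarith : Q ≤ 2 * n)
    have h3 : (0 : ℝ) ≤ q v := by positivity
    have h4 : (0 : ℝ) ≤ Q := by positivity
    have h5 : |g v| ≤ 2 * n := by
      rw [abs_le]
      constructor <;> simp only [hgdef] <;> nlinarith
    calc g v ^ 2 = |g v| ^ 2 := (sq_abs _).symm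
      _ ≤ (2 * n) ^ 2 := by gcongr
      _ = _ := by ring
  have hvar := sum_sq_samples g hg s
  rw [← hn] at hvar
  have hvar' : ∑ S : Fin s → V, (∑ t, g (S t)) ^ 2 ≤ s * (n : ℝ) ^ s * (4 * n ^ 2) := by
    have h1 : ∑ v, g v ^ 2 ≤ n * (4 * (n : ℝ) ^ 2) := by
      refine (sum_le_sum fun v _ => hg2 v).trans (le_of_eq ?_)
      simp [← hn]
    have h2 : (n : ℝ) * ∑ S : Fin s → V, (∑ t, g (S t)) ^ 2 ≤
        n * (s * (n : ℝ) ^ s * (4 * n ^ 2)) := by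
      rw [hvar]
      calc _ ≤ s * (n : ℝ) ^ s * (n * (4 * (n : ℝ) ^ 2)) := by gcongr
        _ = _ := by ring
    exact le_of_mul_le_mul_left h2 hn0
  set A := univ.filter fun S : Fin s → V => (n * s : ℝ) <
    k * |(n : ℝ) * (∑ t, q (S t) : ℕ) - s * Q| with hA
  have hmark : (A.card : ℝ) * (n * s) ^ 2 ≤ k ^ 2 * (s * (n : ℝ) ^ s * (4 * n ^ 2)) := by
    refine (card_filter_mul_le _ (fun S : Fin s → V => (k : ℝ) ^ 2 * (∑ t, g (S t)) ^ 2)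
      (fun S => mul_nonneg (sq_nonneg _) (sq_nonneg _)) fun S h => ?_).trans ?_
    · rw [← sq_abs (∑ t, g (S t)), ← mul_pow, hsum]
      exact pow_le_pow_left₀ (by positivity) h.le 2
    · rw [← mul_sum]
      exact mul_le_mul_of_nonneg_left hvar' (sq_nonneg _)
  have hs' : (64 : ℝ) * k ^ 2 ≤ s := by exact_mod_cast hs
  have hs0 : (0 : ℝ) < s := lt_of_lt_of_le (by positivity) hs'
  have h7 : (A.card : ℝ) * s ≤ 4 * k ^ 2 * (n : ℝ) ^ s := by
    have : ((n : ℝ) ^ 2 * s) * (A.card * s) ≤ (n ^ 2 * s) * (4 * k ^ 2 * (n : ℝ) ^ s) := by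
      calc _ = (A.card : ℝ) * (n * s) ^ 2 := by ring
        _ ≤ _ := hmark
        _ = _ := by ring
    exact le_of_mul_le_mul_left this (by positivity)
  have h8 : (A.card : ℝ) * (64 * k ^ 2) ≤ A.card * s := by gcongr
  have h9 : (4 * (k : ℝ) ^ 2) * (16 * A.card) ≤ (4 * k ^ 2) * (n : ℝ) ^ s := by linarith
  exact le_of_mul_le_mul_left h9 (by positivity)

end Sampling

/-! ### Choice of parameters and union bound over the bad events -/

section Union

variable {V : Type*} [AddCommGroup V] [Fintype V] (H : SimpleGraph V)

theorem lt_two_pow_mul_exp {n : ℕ} : (n : ℝ) ≤ Real.exp n.size := by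
  have h1 : (n : ℝ) ≤ (2 : ℝ) ^ n.size := by exact_mod_cast (Nat.lt_size_self n).le
  have h2 : (2 : ℝ) ≤ Real.exp 1 := by have := Real.exp_one_gt_d9; linarith
  calc (n : ℝ) ≤ 2 ^ n.size := h1
    _ ≤ Real.exp 1 ^ n.size := by gcongr
    _ = _ := by rw [← Real.exp_nat_mul, mul_one]

theorem sub_pow_le {n d j : ℕ} (hn : 0 < n) (hd : d ≤ n) {x : ℝ} (hx : n * x ≤ d * j) :
    ((n - d : ℕ) : ℝ) ^ j ≤ (n : ℝ) ^ j * Real.exp (-x) := by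
  have hn' : (0 : ℝ) < n := by exact_mod_cast hn
  have h1 : ((n - d : ℕ) : ℝ) ≤ n * Real.exp (-(d / n)) := by
    rw [Nat.cast_sub hd]
    have := Real.add_one_le_exp (-((d : ℝ) / n))
    calc (n : ℝ) - d = n * (-(d / n) + 1) := by field_simp; ring
      _ ≤ _ := by gcongr
  calc _ ≤ (n * Real.exp (-(d / n))) ^ j := by gcongr
    _ = (n : ℝ) ^ j * Real.exp (-(d * j / n)) := by
        rw [mul_pow, ← Real.exp_nat_mul]
        congr 2
        ring
    _ ≤ _ := by
        gcongr
        rw [le_div_iff₀ hn']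
        linarith

/-- The number of rounds. -/
def rounds (n : ℕ) : ℕ := n * (n.size + 8)

/-- The bound for the number of unmatched neighbours before round `j`. -/
def spread (n j : ℕ) : ℕ := n * (3 * n.size + 7) / (j + 1)

theorem rounds_le (n : ℕ) : rounds n ≤ 2 ^ (2 * n.size + 3) := by
  have h1 := (Nat.lt_size_self n).le
  have h2 : n.size + 8 ≤ 2 ^ (n.size + 3) := by
    have h3 := (Nat.lt_two_pow_self (n := n.size))
    rw [pow_add]
    omega
  calc rounds n ≤ 2 ^ n.size * 2 ^ (n.size + 3) := Nat.mul_le_mul h1 h2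
    _ = _ := by rw [← pow_add]; congr 1; ring

/-- Harmonic sum, with `log R ≤ 2 * n.size + 3` from `rounds_le`. -/
theorem sum_spread_le (n : ℕ) :
    ∑ j ∈ range (rounds n), spread n j ≤ n * ((3 * n.size + 7) * (2 * n.size + 4)) := by
  rcases Nat.eq_zero_or_pos n with rfl | hn
  · simp [rounds]
  have h1 : (∑ j ∈ range (rounds n), (spread n j : ℝ)) ≤
      n * (3 * n.size + 7) * (harmonic (rounds n) : ℚ) := by
    rw [harmonic]
    push_cast
    rw [mul_sum]
    refine sum_le_sum fun j _ => ?_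
    rw [spread]
    refine Nat.cast_div_le.trans (le_of_eq ?_)
    push_cast
    rw [div_eq_mul_inv]
  have h2 : ((harmonic (rounds n) : ℚ) : ℝ) ≤ 2 * n.size + 4 := by
    refine (harmonic_le_one_add_log _).trans ?_
    have h0 : (0 : ℝ) < rounds n := by
      have : 0 < rounds n := Nat.mul_pos hn (by omega)
      exact_mod_cast this
    have h3 : Real.log (rounds n) ≤ Real.log ((2 : ℝ) ^ (2 * n.size + 3)) :=
      Real.log_le_log h0 (by exact_mod_cast rounds_le n)
    rw [Real.log_pow] at h3
    have h4 := Real.log_two_lt_d9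
    push_cast at h3
    have h5 : (2 * (n.size : ℝ) + 3) * Real.log 2 ≤ (2 * n.size + 3) * 1 := by
      gcongr
      linarith
    linarith
  have h6 : (∑ j ∈ range (rounds n), (spread n j : ℝ)) ≤
      n * ((3 * n.size + 7) * (2 * n.size + 4)) := by
    refine h1.trans ?_
    rw [mul_assoc]
    gcongr
  exact_mod_cast h6

open Classical in
-- Union bound over `R * n` pairs of a round and a vertex. Each fails with probability at most `exp
-- (-(3 * n.size + 6))` by `card_freeDegree_ge`, while `R * n ≤ 8 * exp (3 * n.size)` and `50 * 8 ≤
-- exp 6`.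
theorem card_not_spread_le (hV : 0 < Fintype.card V) :
    50 * ((univ.filter fun f : Fin (rounds (Fintype.card V)) → V =>
      ¬ Spread H (extend f) (rounds (Fintype.card V)) (spread (Fintype.card V))).card : ℝ) ≤
      (Fintype.card V : ℝ) ^ rounds (Fintype.card V) := by
  set n := Fintype.card V with hn
  set R := rounds n with hR
  have hn0 : (0 : ℝ) < n := by exact_mod_cast hV
  set A : ℕ → V → Finset (Fin R → V) := fun j v => univ.filter fun f : Fin R → V =>
    v ∈ free H (extend f) j ∧ spread n j + 1 ≤ freeDegree H (extend f) j v with hA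
  have hsub : (univ.filter fun f : Fin R → V => ¬ Spread H (extend f) R (spread n)) ⊆
      (range R).biUnion fun j => univ.biUnion fun v => A j v := by
    intro f hf
    simp only [mem_filter, mem_univ, true_and, Spread, not_forall, not_le] at hf
    obtain ⟨j, hj, v, hv, hlt⟩ := hf
    simp only [mem_biUnion, mem_range, mem_univ, true_and, hA, mem_filter]
    exact ⟨j, hj, v, hv, hlt⟩
  have hcard : ∀ j ∈ range R, ∀ v, ((A j v).card : ℝ) ≤
      (n : ℝ) ^ R * Real.exp (-(3 * n.size + 6)) := by
    intro j hj v
    by_cases hd : spread n j + 1 ≤ n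
    · have h1 := card_freeDegree_ge H R (spread n j + 1) v j (mem_range.1 hj).le
      have h2 : (n : ℝ) ^ j * (A j v).card ≤ ((n - (spread n j + 1) : ℕ) : ℝ) ^ j * (n : ℝ) ^ R := by
        exact_mod_cast h1
      have h3 : n * (3 * n.size + 7) < (spread n j + 1) * (j + 1) :=
        Nat.lt_mul_of_div_lt (Nat.lt_succ_self _) (by omega)
      -- Passing from `j + 1` to `j` gives up one term `spread n j + 1 ≤ n`, so `7` becomes `6`.
      have h4 : n * (3 * n.size + 6) ≤ (spread n j + 1) * j := by nlinarith
      have h5 := sub_pow_le (x := 3 * n.size + 6) hV hd (by exact_mod_cast h4)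
      have h6 : (n : ℝ) ^ j * (A j v).card ≤
          n ^ j * ((n : ℝ) ^ R * Real.exp (-(3 * n.size + 6))) := by
        calc _ ≤ _ := h2
          _ ≤ (n : ℝ) ^ j * Real.exp (-(3 * n.size + 6)) * (n : ℝ) ^ R := by gcongr
          _ = _ := by ring
      exact le_of_mul_le_mul_left h6 (by positivity)
    · have : A j v = ∅ := by
        ext f
        simp only [hA, mem_filter, mem_univ, true_and, notMem_empty, iff_false, not_and, not_le]
        intro _
        have : freeDegree H (extend f) j v ≤ n := card_le_univ _
        omega
      rw [this]
      simp only [card_empty, Nat.cast_zero]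
      positivity
  have h1 : ((univ.filter fun f : Fin R → V => ¬ Spread H (extend f) R (spread n)).card : ℝ) ≤
      R * (n * ((n : ℝ) ^ R * Real.exp (-(3 * n.size + 6)))) := by
    calc _ ≤ (((range R).biUnion fun j => univ.biUnion fun v => A j v).card : ℝ) := by
          exact_mod_cast card_le_card hsub
      _ ≤ ∑ j ∈ range R, ∑ v, ((A j v).card : ℝ) := by
          refine (Nat.cast_le.2 card_biUnion_le).trans ?_
          rw [Nat.cast_sum]
          refine sum_le_sum fun j _ => (Nat.cast_le.2 card_biUnion_le).trans ?_
          rw [Nat.cast_sum]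
      _ ≤ ∑ j ∈ range R, ∑ v : V, (n : ℝ) ^ R * Real.exp (-(3 * n.size + 6)) :=
          sum_le_sum fun j hj => sum_le_sum fun v _ => hcard j hj v
      _ = _ := by simp [← hn]
  have h2 : (R : ℝ) * n ≤ 8 * Real.exp (3 * n.size) := by
    have h3 := lt_two_pow_mul_exp (n := n)
    have h4 : (n.size : ℝ) + 8 ≤ 8 * Real.exp n.size := by
      have := Real.add_one_le_exp (n.size : ℝ)
      have h0 : (0 : ℝ) ≤ n.size := by positivity
      linarith
    have h5 : Real.exp (3 * n.size) = Real.exp n.size * Real.exp n.size * Real.exp n.size := by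
      rw [← Real.exp_add, ← Real.exp_add]; ring_nf
    rw [hR, rounds, h5]
    push_cast
    calc (n : ℝ) * (n.size + 8) * n ≤ Real.exp n.size * (8 * Real.exp n.size) * Real.exp n.size := by
          gcongr
      _ = _ := by ring
  have h3 : Real.exp (3 * n.size) * Real.exp (-(3 * n.size + 6)) * 400 ≤ 1 := by
    rw [← Real.exp_add, show 3 * (n.size : ℝ) + -(3 * n.size + 6) = -6 by ring, Real.exp_neg]
    have h4 : (400 : ℝ) ≤ Real.exp 6 := by
      have h5 := Real.exp_one_gt_d9
      have h6 : Real.exp 6 = Real.exp 1 ^ 6 := by rw [← Real.exp_nat_mul]; norm_num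
      rw [h6]
      calc (400 : ℝ) ≤ 2.718 ^ 6 := by norm_num
        _ ≤ _ := by gcongr; linarith
    rw [inv_mul_le_iff₀ (Real.exp_pos 6)]
    linarith
  calc _ ≤ 50 * (R * (n * ((n : ℝ) ^ R * Real.exp (-(3 * n.size + 6))))) := by gcongr
    _ = 50 * (R * n * Real.exp (-(3 * n.size + 6))) * (n : ℝ) ^ R := by ring
    _ ≤ 50 * (8 * Real.exp (3 * n.size) * Real.exp (-(3 * n.size + 6))) * (n : ℝ) ^ R := by gcongr
    _ = Real.exp (3 * n.size) * Real.exp (-(3 * n.size + 6)) * 400 * (n : ℝ) ^ R := by ring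
    _ ≤ 1 * (n : ℝ) ^ R := by gcongr
    _ = _ := one_mul _

open Classical in
-- A given colour is missed with probability at most `(1 - 1/n) ^ R ≤ exp (-(n.size + 8))`, and
-- there are `n ≤ exp n.size` colours.
theorem card_not_surjective_le (hV : 0 < Fintype.card V) :
    100 * ((univ.filter fun f : Fin (rounds (Fintype.card V)) → V =>
      ¬ ∀ c, ∃ j < rounds (Fintype.card V), extend f j = c).card : ℝ) ≤
      (Fintype.card V : ℝ) ^ rounds (Fintype.card V) := by
  set n := Fintype.card V with hn
  set R := rounds n with hR
  have hsub : (univ.filter fun f : Fin R → V => ¬ ∀ c, ∃ j < R, extend f j = c) ⊆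
      univ.biUnion fun c => univ.filter fun f : Fin R → V => ∀ i, f i ≠ c := by
    intro f hf
    simp only [mem_filter, mem_univ, true_and, not_forall, not_exists, not_and] at hf
    obtain ⟨c, hc⟩ := hf
    simp only [mem_biUnion, mem_univ, true_and, mem_filter]
    exact ⟨c, fun i => by simpa [extend] using hc i i.2⟩
  have h1 : ((univ.filter fun f : Fin R → V => ¬ ∀ c, ∃ j < R, extend f j = c).card : ℝ) ≤
      n * ((n - 1 : ℕ) : ℝ) ^ R := by
    have h2 := (card_le_card hsub).trans card_biUnion_le
    simp only [card_missing, sum_const, card_univ, smul_eq_mul, ← hn] at h2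
    exact_mod_cast h2
  have h2 := sub_pow_le (n := n) (d := 1) (j := R) (x := n.size + 8) hV hV (by
    rw [hR, rounds]; push_cast; linarith)
  have h3 : Real.exp n.size * Real.exp (-(n.size + 8)) * 100 ≤ 1 := by
    rw [← Real.exp_add, show (n.size : ℝ) + -(n.size + 8) = -8 by ring, Real.exp_neg]
    have h4 : (100 : ℝ) ≤ Real.exp 8 := by
      have h5 := Real.exp_one_gt_d9
      have h6 : Real.exp 8 = Real.exp 1 ^ 8 := by rw [← Real.exp_nat_mul]; norm_num
      rw [h6]
      calc (100 : ℝ) ≤ 2 ^ 8 := by norm_num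
        _ ≤ _ := by gcongr; linarith
    rw [inv_mul_le_iff₀ (Real.exp_pos 8)]
    linarith
  calc _ ≤ 100 * (n * ((n : ℝ) ^ R * Real.exp (-(n.size + 8)))) := by
        gcongr
        exact h1.trans (by gcongr)
    _ ≤ 100 * (Real.exp n.size * ((n : ℝ) ^ R * Real.exp (-(n.size + 8)))) := by
        gcongr
        exact lt_two_pow_mul_exp
    _ = Real.exp n.size * Real.exp (-(n.size + 8)) * 100 * (n : ℝ) ^ R := by ring
    _ ≤ 1 * (n : ℝ) ^ R := by gcongr
    _ = _ := one_mul _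

/-- The number of steps granted to the computation with `s` sampled vertices. -/
def budget (n s : ℕ) : ℕ :=
  16 * (s * rounds n * (21 + 24 * ((3 * n.size + 7) * (2 * n.size + 4))))

/-- The number of the two matchings that cover `v`. -/
noncomputable def coverCount (σ τ : ℕ → V) (R : ℕ) (v : V) : ℕ :=
  open Classical in
  (if v ∈ free H σ R then 0 else 1) + if v ∈ free (H \ greedy H σ R) τ R then 0 else 1

/-- The colours and samples for which the algorithm finds a good estimate in time. -/
def Good (k s : ℕ) (σ τ : ℕ → V) (S : Fin s → V) : Prop :=
  (∀ c, ∃ j < rounds (Fintype.card V), σ j = c) ∧ (∀ c, ∃ j < rounds (Fintype.card V), τ j = c) ∧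
  1 + ∑ t, vertexCost H σ τ (rounds (Fintype.card V)) (S t) ≤ budget (Fintype.card V) s ∧
  k * |(Fintype.card V : ℝ) * (∑ t, coverCount H σ τ (rounds (Fintype.card V)) (S t) : ℕ) -
    s * (∑ v, coverCount H σ τ (rounds (Fintype.card V)) v : ℕ)| ≤ Fintype.card V * s

open Classical in
-- The failure probabilities are `1/100` twice for missing colours, `1/50` for `Spread`, `1/16` for
-- the budget and `1/16` for the sampling error, in total less than `1/3`. The map `smp` covers both
-- random samples and the examination of all vertices; `h1` and `h2` are what the argument needs of
-- it.
theorem sum_not_good_le (hV : 0 < Fintype.card V) (k s : ℕ) (hs : 0 < s)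
    (smp : (Fin s → V) → Fin s → V)
    (h1 : ∀ g : V → ℕ, Fintype.card V * ∑ S, ∑ t, g (smp S t) =
      s * Fintype.card V ^ s * ∑ v, g v)
    (h2 : ∀ q : V → ℕ, (∀ v, q v ≤ 2) → 16 * ((univ.filter fun S => (Fintype.card V * s : ℝ) <
      k * |(Fintype.card V : ℝ) * (∑ t, q (smp S t) : ℕ) - s * (∑ v, q v : ℕ)|).card : ℝ) ≤
      (Fintype.card V : ℝ) ^ s) :
    3 * ∑ f : Fin (rounds (Fintype.card V)) → V, ∑ g : Fin (rounds (Fintype.card V)) → V,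
      ∑ S : Fin s → V, (if Good H k s (extend f) (extend g) (smp S) then (0 : ℝ) else 1) ≤
      (Fintype.card V : ℝ) ^ rounds (Fintype.card V) *
        ((Fintype.card V : ℝ) ^ rounds (Fintype.card V) * (Fintype.card V : ℝ) ^ s) := by
  set n := Fintype.card V with hn
  set R := rounds n with hR
  set B := (3 * n.size + 7) * (2 * n.size + 4) with hB
  have hn0 : (0 : ℝ) < n := by exact_mod_cast hV
  have hRpos : 0 < R := Nat.mul_pos hV (by omega)
  set C : (Fin R → V) → (Fin R → V) → (Fin s → V) → ℕ := fun f g S =>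
    1 + ∑ t, vertexCost H (extend f) (extend g) R (smp S t) with hC
  set D : (Fin R → V) → (Fin R → V) → (Fin s → V) → Prop := fun f g S => (n * s : ℝ) <
      k * |(n : ℝ) * (∑ t, coverCount H (extend f) (extend g) R (smp S t) : ℕ) -
        s * (∑ v, coverCount H (extend f) (extend g) R v : ℕ)| with hD
  set b1 : (Fin R → V) → ℝ := fun f => if ¬ ∀ c, ∃ j < R, extend f j = c then 1 else 0 with hb1
  set b3 : (Fin R → V) → ℝ := fun f => if ¬ Spread H (extend f) R (spread n) then 1 else 0
    with hb3
  set b4 : (Fin R → V) → (Fin R → V) → (Fin s → V) → ℝ := fun f g S =>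
    if Spread H (extend f) R (spread n) ∧ budget n s < C f g S then 1 else 0 with hb4
  set b5 : (Fin R → V) → (Fin R → V) → (Fin s → V) → ℝ := fun f g S =>
    if D f g S then 1 else 0 with hb5
  have hunion : ∀ f g S, (if Good H k s (extend f) (extend g) (smp S) then (0 : ℝ) else 1) ≤
      b1 f + b1 g + b3 f + b4 f g S + b5 f g S := by
    intro f g S
    have p1 : ∀ f, 0 ≤ b1 f := fun f => by simp only [hb1]; split_ifs <;> norm_num
    have p3 : 0 ≤ b3 f := by simp only [hb3]; split_ifs <;> norm_num
    have p4 : 0 ≤ b4 f g S := by simp only [hb4]; split_ifs <;> norm_num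
    have p5 : 0 ≤ b5 f g S := by simp only [hb5]; split_ifs <;> norm_num
    have q1 := p1 f
    have q2 := p1 g
    by_cases c1 : ∀ c, ∃ j < R, extend f j = c
    swap
    · have : b1 f = 1 := if_pos c1
      split_ifs <;> linarith
    by_cases c2 : ∀ c, ∃ j < R, extend g j = c
    swap
    · have : b1 g = 1 := if_pos c2
      split_ifs <;> linarith
    by_cases c3 : Spread H (extend f) R (spread n)
    swap
    · have : b3 f = 1 := if_pos c3
      split_ifs <;> linarith
    by_cases c4 : budget n s < C f g S
    · have : b4 f g S = 1 := if_pos ⟨c3, c4⟩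
      split_ifs <;> linarith
    by_cases c5 : D f g S
    · have : b5 f g S = 1 := if_pos c5
      split_ifs <;> linarith
    rw [if_pos ⟨c1, c2, not_lt.1 c4, not_lt.1 c5⟩]
    linarith
  have k1 : 100 * ∑ f, b1 f ≤ (n : ℝ) ^ R := by
    simp only [hb1, sum_boole]
    exact card_not_surjective_le hV
  have k3 : 50 * ∑ f, b3 f ≤ (n : ℝ) ^ R := by
    simp only [hb3, sum_boole]
    exact card_not_spread_le H hV
  have k5 : ∀ f g, 16 * ∑ S, b5 f g S ≤ (n : ℝ) ^ s := by
    intro f g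
    simp only [hb5, sum_boole]
    refine h2 (coverCount H (extend f) (extend g) R) fun v => ?_
    rw [coverCount]
    split_ifs <;> simp
  -- Markov's inequality on the event `Spread`: the budget is `16` times a bound for the mean, in
  -- which `21 = 1 + 6 + 14`.
  have k4 : 16 * ∑ f, ∑ g, ∑ S, b4 f g S ≤ (n : ℝ) ^ R * ((n : ℝ) ^ R * (n : ℝ) ^ s) := by
    have e1 : n ^ 2 * ∑ f, ∑ g, ∑ S, (if Spread H (extend f) R (spread n) then C f g S else 0) ≤
        n ^ 2 * (n ^ R * (n ^ R * n ^ s) * (s * R * (21 + 24 * B))) := by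
      have e2 : ∀ f g, n * ∑ S, (if Spread H (extend f) R (spread n) then C f g S else 0) ≤
          n * n ^ s + s * n ^ s * ∑ v, (if Spread H (extend f) R (spread n) then
            vertexCost H (extend f) (extend g) R v else 0) := by
        intro f g
        split_ifs with h
        · simp only [hC, sum_add_distrib, mul_add, h1, sum_const, card_univ, Fintype.card_fun,
            Fintype.card_fin, smul_eq_mul, ← hn, mul_one]
          exact le_rfl
        · simp
      have e3 := sum_vertexCost_le H R B (spread n) (sum_spread_le n)
      rw [← hn] at e3
      calc _ = n * ∑ f, ∑ g, n * ∑ S,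
            (if Spread H (extend f) R (spread n) then C f g S else 0) := by
            simp only [← mul_sum]
            ring
        _ ≤ n * ∑ f : Fin R → V, ∑ g : Fin R → V, (n * n ^ s + s * n ^ s * ∑ v,
            (if Spread H (extend f) R (spread n) then
              vertexCost H (extend f) (extend g) R v else 0)) :=
            Nat.mul_le_mul_left _ (sum_le_sum fun f _ => sum_le_sum fun g _ => e2 f g)
        _ = n ^ 2 * (n ^ R * (n ^ R * n ^ s)) + s * n ^ s * (n * ∑ f : Fin R → V,
            ∑ g : Fin R → V, ∑ v, (if Spread H (extend f) R (spread n) then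
              vertexCost H (extend f) (extend g) R v else 0)) := by
            simp only [sum_add_distrib, ← mul_sum, sum_const, card_univ, Fintype.card_fun,
              Fintype.card_fin, smul_eq_mul, ← hn]
            ring
        _ ≤ n ^ 2 * (n ^ R * (n ^ R * n ^ s)) + s * n ^ s * ((n ^ R) ^ 2 * n ^ 2 *
            (6 + 14 * R + 24 * R * B)) := Nat.add_le_add_left (Nat.mul_le_mul_left _ e3) _
        _ = n ^ 2 * (n ^ R * (n ^ R * n ^ s) * (1 + s * (6 + 14 * R + 24 * R * B))) := by ring
        _ ≤ _ := by
            refine Nat.mul_le_mul_left _ (Nat.mul_le_mul_left _ ?_)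
            have : 1 * 1 ≤ s * R := Nat.mul_le_mul hs hRpos
            nlinarith
    have e4 := Nat.le_of_mul_le_mul_left e1 (by positivity)
    have e5 : (budget n s : ℝ) * ∑ f, ∑ g, ∑ S, b4 f g S ≤
        (n : ℝ) ^ R * ((n : ℝ) ^ R * (n : ℝ) ^ s) * (s * R * (21 + 24 * B)) := by
      refine le_trans ?_ (by exact_mod_cast e4 : ((∑ f, ∑ g, ∑ S,
        (if Spread H (extend f) R (spread n) then C f g S else 0) : ℕ) : ℝ) ≤ _)
      simp only [mul_sum, Nat.cast_sum]
      refine sum_le_sum fun f _ => sum_le_sum fun g _ => sum_le_sum fun S _ => ?_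
      simp only [hb4]
      split_ifs with c1 c2
      · rw [mul_one]; exact_mod_cast c1.2.le
      · exact absurd c1.1 c2
      · simp
      · simp
    have e6 : (budget n s : ℝ) = 16 * (s * R * (21 + 24 * B)) := by
      rw [budget, ← hB, ← hR]; push_cast; ring
    rw [e6] at e5
    have e7 : (0 : ℝ) < s * R * (21 + 24 * B) := by positivity
    refine le_of_mul_le_mul_left (a := (s : ℝ) * R * (21 + 24 * B)) ?_ e7
    linarith
  have hΩ : (0 : ℝ) ≤ (n : ℝ) ^ R * ((n : ℝ) ^ R * (n : ℝ) ^ s) := by positivity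
  have hsum : ∑ f : Fin R → V, ∑ g : Fin R → V, ∑ S : Fin s → V,
      (if Good H k s (extend f) (extend g) (smp S) then (0 : ℝ) else 1) ≤
      ((n : ℝ) ^ R * (n : ℝ) ^ s) * ∑ f, b1 f + ((n : ℝ) ^ R * (n : ℝ) ^ s) * ∑ g, b1 g +
        ((n : ℝ) ^ R * (n : ℝ) ^ s) * ∑ f, b3 f + ∑ f, ∑ g, ∑ S, b4 f g S +
        ∑ f, ∑ g, ∑ S, b5 f g S := by
    refine (sum_le_sum fun f _ => sum_le_sum fun g _ => sum_le_sum fun S _ =>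
      hunion f g S).trans (le_of_eq ?_)
    simp only [sum_add_distrib, sum_const, card_univ, Fintype.card_fun, Fintype.card_fin,
      nsmul_eq_mul, ← hn, ← mul_sum]
    push_cast
    ring
  have k5' : 16 * ∑ f, ∑ g, ∑ S, b5 f g S ≤ (n : ℝ) ^ R * ((n : ℝ) ^ R * (n : ℝ) ^ s) := by
    rw [mul_sum]
    refine (sum_le_sum fun f _ => ?_ : _ ≤ ∑ f : Fin R → V, (n : ℝ) ^ R * (n : ℝ) ^ s).trans
      (le_of_eq ?_)
    · rw [mul_sum]
      refine (sum_le_sum fun g _ => k5 f g).trans (le_of_eq ?_)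
      simp [← hn]
    · simp [← hn]
  have m1 := mul_le_mul_of_nonneg_left k1 (by positivity : (0 : ℝ) ≤ (n : ℝ) ^ R * (n : ℝ) ^ s)
  have m3 := mul_le_mul_of_nonneg_left k3 (by positivity : (0 : ℝ) ≤ (n : ℝ) ^ R * (n : ℝ) ^ s)
  linarith

end Union

/-! ### The recursive search as a stack machine -/

/-- An activation record of the recursive search. Kinds `0` and `1` find out whether `v` is
matched before round `lim` in the first or second matching; kind `2` finds out whether the edge
`vo` is in the first matching, and if not continues as kind `1`. -/
structure Frame where
  kind : ℕ
  v : ℕ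
  o : ℕ
  i : ℕ
  lim : ℕ

/-- The state of the search: `ret` is `0` during a call, `1` if a call has just returned that the
vertex is matched, and `2` if it has returned that the vertex is unmatched. -/
structure Config where
  stk : List Frame
  ret : ℕ
  p : ℕ
  cnt : ℕ
  done : Prop

/-- One step of the search. -/
noncomputable def step (n R s flag : ℕ) (ω : ℕ → ℕ) (O : ℕ → ℕ → ℕ) (c : Config) : Config :=
  match c.stk with
  | [] =>
    if c.ret = 0 then
      if c.p = 2 * s then { c with done := True }
      else { c with stk := [⟨c.p % 2, if flag = 0 then ω (2 * R + c.p / 2) else c.p / 2, 0, 0, R⟩] }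
    else { c with cnt := c.cnt + if c.ret = 1 then 1 else 0, p := c.p + 1, ret := 0 }
  | f :: st =>
    if c.ret = 0 then
      if f.kind = 2 then
        if f.i = 2 * R then { c with stk := ⟨1, f.v, f.o, 0, f.lim⟩ :: st }
        else
          -- In kind `2`, position `i` stands for round `i / 2`, with the end `v` for even and `o`
          -- for odd `i`.
          let x := if f.i % 2 = 0 then f.v else f.o
          let y := (ω (f.i / 2) + n - x) % n
          -- The right side is the other end of the edge, computed in ℕ without reduction.
          if y = f.v + f.o - x then { c with stk := st, ret := 1 }
          else if O x y = 0 then { c with stk := ⟨f.kind, f.v, f.o, f.i + 1, f.lim⟩ :: st }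
          else { c with stk := ⟨0, y, x, 0, f.i / 2⟩ :: f :: st }
      else
        if f.i = f.lim then { c with stk := st, ret := 2 }
        else
          let y := (ω (f.kind * R + f.i) + n - f.v) % n
          if O f.v y = 0 then { c with stk := ⟨f.kind, f.v, f.o, f.i + 1, f.lim⟩ :: st }
          -- Doubling the kind makes a call of kind `1` begin with an edge test, and leaves kind `0`
          -- as it is.
          else { c with stk := ⟨2 * f.kind, y, f.v, 0, f.i⟩ :: f :: st }
    else
      if c.ret = 2 then
        -- The partner is free, so this end is matched with it and not along the edge: the edge is
        -- outside the first matching.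
        if f.kind = 2 then { c with stk := ⟨1, f.v, f.o, 0, f.lim⟩ :: st, ret := 0 }
        else { c with stk := st, ret := 1 }
      else { c with stk := ⟨f.kind, f.v, f.o, f.i + 1, f.lim⟩ :: st, ret := 0 }

/-! ### Correctness and step count of the search -/

section Run

theorem partner_val {n : ℕ} (c x : Fin n) : ((c : ℕ) + n - x) % n = ((c - x : Fin n) : ℕ) := by
  rw [Fin.sub_def]
  congr 1
  have := x.2
  omega

theorem pairOracle_eq_zero {n : ℕ} (G : SimpleGraph (Fin n)) {a b : Fin n} :
    PairRAM.pairOracle G a b = 0 ↔ ¬ G.Adj a b := by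
  simp [PairRAM.pairOracle]

/-- `c` leads to `c'` in at most `m` steps. -/
def Leads {n : ℕ} (G : SimpleGraph (Fin n)) (R s flag : ℕ) (ω : ℕ → ℕ) (m : ℕ) (c c' : Config) :
    Prop :=
  ∃ l ≤ m, (step n R s flag ω (PairRAM.pairOracle G))^[l] c = c'

variable {n : ℕ} {G : SimpleGraph (Fin n)} {R s flag : ℕ} {ω : ℕ → ℕ}

theorem Leads.refl (c : Config) : Leads G R s flag ω 0 c c := ⟨0, le_rfl, rfl⟩

theorem Leads.mono {m m' : ℕ} {c c' : Config} (h : Leads G R s flag ω m c c') (hm : m ≤ m') :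
    Leads G R s flag ω m' c c' := by
  obtain ⟨l, hl, h⟩ := h
  exact ⟨l, hl.trans hm, h⟩

theorem Leads.trans {m m' : ℕ} {c c' c'' : Config} (h : Leads G R s flag ω m c c')
    (h' : Leads G R s flag ω m' c' c'') : Leads G R s flag ω (m + m') c c'' := by
  obtain ⟨l, hl, h⟩ := h
  obtain ⟨l', hl', h'⟩ := h'
  exact ⟨l' + l, by omega, by rw [Function.iterate_add_apply, h, h']⟩

theorem Leads.head {m : ℕ} {c c' c'' : Config}
    (hc : step n R s flag ω (PairRAM.pairOracle G) c = c')
    (h : Leads G R s flag ω m c' c'') : Leads G R s flag ω (m + 1) c c'' := by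
  obtain ⟨l, hl, h⟩ := h
  exact ⟨l + 1, by omega, by rw [Function.iterate_succ_apply, hc, h]⟩

theorem leads_finish {k v o i lim p cnt : ℕ} {st : List Frame} (hk : k ≠ 2) (hi : i = lim) :
    Leads G R s flag ω 1 ⟨⟨k, v, o, i, lim⟩ :: st, 0, p, cnt, False⟩
      ⟨st, 2, p, cnt, False⟩ :=
  Leads.head (by simp [step, hk, hi]) (Leads.refl _)

theorem leads_skip {k i lim o p cnt : ℕ} {v c : Fin n} {st : List Frame} (hk : k ≠ 2) (hi : i < lim)
    (hc : ω (k * R + i) = c) (h : ¬ G.Adj v (c - v)) :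
    Leads G R s flag ω 1 ⟨⟨k, v, o, i, lim⟩ :: st, 0, p, cnt, False⟩
      ⟨⟨k, v, o, i + 1, lim⟩ :: st, 0, p, cnt, False⟩ := by
  refine Leads.head ?_ (Leads.refl _)
  have hy := partner_val c v
  simp [step, hk, hi.ne, hc, hy, (pairOracle_eq_zero G).2 h]

theorem leads_push {k i lim o p cnt : ℕ} {v c : Fin n} {st : List Frame} (hk : k ≠ 2) (hi : i < lim)
    (hc : ω (k * R + i) = c) (h : G.Adj v (c - v)) :
    Leads G R s flag ω 1 ⟨⟨k, v, o, i, lim⟩ :: st, 0, p, cnt, False⟩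
      ⟨⟨2 * k, (c - v : Fin n), v, 0, i⟩ :: ⟨k, v, o, i, lim⟩ :: st, 0, p, cnt, False⟩ := by
  refine Leads.head ?_ (Leads.refl _)
  have hy := partner_val c v
  have hO : PairRAM.pairOracle G v (c - v : Fin n) ≠ 0 := by
    rw [Ne, pairOracle_eq_zero, not_not]; exact h
  simp only [step, hk, hi.ne, hc, hy, hO, if_true, if_false]

theorem leads_matched {k v o i lim p cnt : ℕ} {st : List Frame} (hk : k ≠ 2) :
    Leads G R s flag ω 1 ⟨⟨k, v, o, i, lim⟩ :: st, 2, p, cnt, False⟩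
      ⟨st, 1, p, cnt, False⟩ :=
  Leads.head (by simp [step, hk]) (Leads.refl _)

theorem leads_next {k v o i lim p cnt : ℕ} {st : List Frame} :
    Leads G R s flag ω 1 ⟨⟨k, v, o, i, lim⟩ :: st, 1, p, cnt, False⟩
      ⟨⟨k, v, o, i + 1, lim⟩ :: st, 0, p, cnt, False⟩ :=
  Leads.head (by simp [step]) (Leads.refl _)

variable [NeZero n] {σ τ : ℕ → Fin n}

/-- The common part of the analysis of the two matchings: `hsub` says what the examination of an
edge of `G` does. -/
theorem leads_scan {K : SimpleGraph (Fin n)} (hKG : K ≤ G) {k lim : ℕ} (hk : k ≠ 2)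
    {ρ : ℕ → Fin n} {w : Fin n → Fin n → ℕ} (hw : ∀ v c, 3 ≤ w v c)
    (hρ : ∀ i < lim, ω (k * R + i) = ρ i) (v : Fin n) (o : ℕ) (st : List Frame) (p cnt : ℕ)
    (hsub : ∀ i < lim, v ∈ free K ρ i → G.Adj v (ρ i - v) → ∀ st,
      Leads G R s flag ω (w v (ρ i) - 2 + callCost K ρ w i v)
        ⟨⟨2 * k, (ρ i - v : Fin n), v, 0, i⟩ :: st, 0, p, cnt, False⟩
        ⟨st, open Classical in if K.Adj v (ρ i - v) ∧ ρ i - v ∈ free K ρ i then 2 else 1,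
          p, cnt, False⟩) :
    Leads G R s flag ω (1 + cost K ρ w lim v) ⟨⟨k, v, o, 0, lim⟩ :: st, 0, p, cnt, False⟩
      ⟨st, if v ∈ free K ρ lim then 2 else 1, p, cnt, False⟩ := by
  have key : ∀ d i, i + d = lim → v ∈ free K ρ i →
      Leads G R s flag ω (1 + ∑ l ∈ Ico i lim,
        ((if v ∈ free K ρ l then w v (ρ l) else 0) + callCost K ρ w l v))
        ⟨⟨k, v, o, i, lim⟩ :: st, 0, p, cnt, False⟩
        ⟨st, if v ∈ free K ρ lim then 2 else 1, p, cnt, False⟩ := by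
    intro d
    induction d with
    | zero =>
      intro i hi hv
      obtain rfl : i = lim := by omega
      rw [if_pos hv]
      exact (leads_finish hk rfl).mono (by omega)
    | succ d ihd =>
      intro i hi hv
      have hlt : i < lim := by omega
      -- Pushing the call and handling its answer take two steps; `hw` makes the subtraction in `w -
      -- 2` exact.
      have h3 := hw v (ρ i)
      rw [sum_eq_sum_Ico_succ_bot hlt, if_pos hv]
      by_cases ha : G.Adj v (ρ i - v)
      · have h1 := hsub i hlt hv ha (⟨k, v, o, i, lim⟩ :: st)
        have h2 := (leads_push (o := o) (p := p) (cnt := cnt) (st := st) (s := s) (flag := flag)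
          hk hlt (hρ i hlt) ha).trans h1
        by_cases hf : K.Adj v (ρ i - v) ∧ ρ i - v ∈ free K ρ i
        · rw [if_neg (notMem_free_of_matched K hlt hf.1 hf.2)]
          rw [if_pos hf] at h2
          exact (h2.trans (leads_matched hk)).mono (by omega)
        · rw [if_neg hf] at h2
          exact ((h2.trans leads_next).trans
            (ihd (i + 1) (by omega) ((mem_free_succ K).2 ⟨hv, hf⟩))).mono (by omega)
      · refine ((leads_skip hk hlt (hρ i hlt) ha).trans
          (ihd (i + 1) (by omega) ((mem_free_succ K).2 ⟨hv, fun h => ha (hKG h.1)⟩))).mono ?_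
        omega
  have := key lim 0 (by omega) (by simp [free])
  rw [cost_eq_sum, range_eq_Ico]
  convert this

/-- Calls have strictly smaller limits. The weight `3` pays for the push, the extra step of the
callee and the handling of its answer. -/
theorem leads_first (hσ : ∀ i < R, ω i = σ i) (lim : ℕ) (hlim : lim ≤ R) (v : Fin n) (o : ℕ)
    (st : List Frame) (p cnt : ℕ) :
    Leads G R s flag ω (1 + cost G σ (fun _ _ => 3) lim v)
      ⟨⟨0, v, o, 0, lim⟩ :: st, 0, p, cnt, False⟩
      ⟨st, if v ∈ free G σ lim then 2 else 1, p, cnt, False⟩ := by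
  induction lim using Nat.strong_induction_on generalizing v o st with
  | _ lim ih =>
    refine leads_scan le_rfl (by norm_num) (fun _ _ => le_rfl)
      (fun i hi => by simpa using hσ i (by omega)) v o st p cnt fun i hi hv ha st => ?_
    have h := ih i hi (by omega) (σ i - v) v st
    rw [callCost, if_pos ⟨hv, ha⟩]
    simpa [ha] using h

/-- If the partner of an end is the other end, the edge is added in this round; if it is another
free neighbour, that end is matched elsewhere. Both settle the question. Otherwise both ends stay
free for the next round. -/
theorem leads_edge (hσ : ∀ i < R, ω i = σ i) {a b : Fin n} (hab : G.Adj a b) (lim : ℕ)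
    (st : List Frame) (p cnt : ℕ) :
    Leads G R s flag ω (1 + edgeCost G σ R a b) ⟨⟨2, a, b, 0, lim⟩ :: st, 0, p, cnt, False⟩
      (open Classical in if (greedy G σ R).Adj a b then ⟨st, 1, p, cnt, False⟩
        else ⟨⟨1, a, b, 0, lim⟩ :: st, 0, p, cnt, False⟩) := by
  classical
  set res : Config := if (greedy G σ R).Adj a b then ⟨st, 1, p, cnt, False⟩
    else ⟨⟨1, a, b, 0, lim⟩ :: st, 0, p, cnt, False⟩ with hres
  -- Treats one position `j` of the scan, with `x` the scanned and `z` the other end, so that both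
  -- ends are covered by one argument; `hm` is the continuation.
  have hother : ∀ i < R, a ∈ free G σ i → b ∈ free G σ i → ∀ x z : Fin n,
      (x = a ∧ z = b ∨ x = b ∧ z = a) → ∀ j, ⟨x, z, j⟩ = (⟨if j % 2 = 0 then a else b,
        if j % 2 = 0 then b else a, j⟩ : Fin n × Fin n × ℕ) → j / 2 = i → j < 2 * R →
      ∀ m, (x ∈ free G σ i → (G.Adj x (σ i - x) → σ i - x ∉ free G σ i) →
        Leads G R s flag ω m ⟨⟨2, a, b, j + 1, lim⟩ :: st, 0, p, cnt, False⟩ res) →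
      Leads G R s flag ω (3 + callCost G σ (fun _ _ => 3) i x + m)
        ⟨⟨2, a, b, j, lim⟩ :: st, 0, p, cnt, False⟩ res := by
    intro i hi hfa hfb x z hxz j hj hji hjR m hm
    simp only [Prod.mk.injEq, and_true] at hj
    have hz : (a : ℕ) + b - x = z := by rcases hxz with ⟨rfl, rfl⟩ | ⟨rfl, rfl⟩ <;> omega
    have hx : (if j % 2 = 0 then (a : ℕ) else b) = x := by rw [hj.1]; split_ifs <;> rfl
    have hy := partner_val (σ i) x
    have hfx : x ∈ free G σ i := by rcases hxz with ⟨rfl, rfl⟩ | ⟨rfl, rfl⟩ <;> assumption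
    have hxzadj : G.Adj x z := by
      rcases hxz with ⟨rfl, rfl⟩ | ⟨rfl, rfl⟩
      exacts [hab, hab.symm]
    have hgadj : (greedy G σ R).Adj a b ↔ (greedy G σ R).Adj x z := by
      rcases hxz with ⟨rfl, rfl⟩ | ⟨rfl, rfl⟩
      exacts [Iff.rfl, (greedy G σ R).adj_comm _ _]
    by_cases hyz : σ i - x = z
    · have hfz : z ∈ free G σ i := by rcases hxz with ⟨rfl, rfl⟩ | ⟨rfl, rfl⟩ <;> assumption
      have hin : (greedy G σ R).Adj a b :=
        hgadj.2 ⟨hxzadj, i, hi, hfx, hfz, by rw [← hyz]; abel⟩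
      rw [hres, if_pos hin]
      refine (Leads.head (m := 0) ?_ (Leads.refl _)).mono (by omega)
      simp only [step, hjR.ne, hji, hx, hσ i hi, hy, hz, hyz, if_true, if_false]
    have hyz' : ((σ i - x : Fin n) : ℕ) ≠ z := fun h => hyz (Fin.ext h)
    by_cases ha : G.Adj x (σ i - x)
    · rw [callCost, if_pos ⟨hfx, ha⟩]
      have hO : PairRAM.pairOracle G x (σ i - x : Fin n) ≠ 0 := by
        rw [Ne, pairOracle_eq_zero, not_not]; exact ha
      have h1 := leads_first (s := s) (flag := flag) (G := G) hσ i hi.le (σ i - x) x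
        (⟨2, a, b, j, lim⟩ :: st) p cnt
      have h2 := Leads.head (c := ⟨⟨2, a, b, j, lim⟩ :: st, 0, p, cnt, False⟩) (by
        simp only [step, hjR.ne, hji, hx, hσ i hi, hy, hz, hyz', hO, if_true, if_false]) h1
      by_cases hf : σ i - x ∈ free G σ i
      · rw [if_pos hf] at h2
        have hin : ¬ (greedy G σ R).Adj a b := fun h => hyz
          (greedy_adj_unique G (a := x) ⟨ha, i, hi, hfx, hf, by abel⟩ (hgadj.1 h))
        rw [hres, if_neg hin]
        refine (h2.trans (Leads.head (m := 0) (c' := ⟨⟨1, a, b, 0, lim⟩ :: st, 0, p, cnt, False⟩)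
          (by simp [step]) (Leads.refl _))).mono (by omega)
      · rw [if_neg hf] at h2
        exact ((h2.trans leads_next).trans (hm hfx fun _ => hf)).mono (by omega)
    · have hO := (pairOracle_eq_zero G).2 ha
      refine (Leads.head (c' := ⟨⟨2, a, b, j + 1, lim⟩ :: st, 0, p, cnt, False⟩) ?_
        (hm hfx fun h => absurd h ha)).mono (by omega)
      simp only [step, hjR.ne, hji, hx, hσ i hi, hy, hz, hyz', hO, if_true, if_false]
  have key : ∀ d i, i + d = R → a ∈ free G σ i → b ∈ free G σ i →
      Leads G R s flag ω (1 + ∑ l ∈ Ico i R, (if a ∈ free G σ l ∧ b ∈ free G σ l then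
        6 + callCost G σ (fun _ _ => 3) l a + callCost G σ (fun _ _ => 3) l b else 0))
        ⟨⟨2, a, b, 2 * i, lim⟩ :: st, 0, p, cnt, False⟩ res := by
    intro d
    induction d with
    | zero =>
      intro i hi hfa hfb
      obtain rfl : i = R := by omega
      have hin : ¬ (greedy G σ i).Adj a b := fun h => (notMem_free_iff G).2 ⟨b, h⟩ hfa
      rw [hres, if_neg hin]
      exact (Leads.head (m := 0) (by simp [step]) (Leads.refl _)).mono (by omega)
    | succ d ihd =>
      intro i hi hfa hfb
      have hlt : i < R := by omega
      rw [sum_eq_sum_Ico_succ_bot hlt, if_pos ⟨hfa, hfb⟩]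
      have h := hother i hlt hfa hfb a b (Or.inl ⟨rfl, rfl⟩) (2 * i) (by simp) (by omega)
        (by omega) _ fun _ ha => hother i hlt hfa hfb b a (Or.inr ⟨rfl, rfl⟩) (2 * i + 1)
        (by simp [Nat.add_mod]) (by omega) (by omega) _ fun _ hb =>
        ihd (i + 1) (by omega) ((mem_free_succ G).2 ⟨hfa, fun h => ha h.1 h.2⟩)
          ((mem_free_succ G).2 ⟨hfb, fun h => hb h.1 h.2⟩)
      exact h.mono (by omega)
  have := key R 0 (by omega) (by simp [free]) (by simp [free])
  rw [edgeCost, range_eq_Ico]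
  convert this

/-- The constant `4` in `secondWeight` pays for the push, one extra step each of the edge test and
of the call, and the handling of the answer. If the edge is in the first matching, the test answers
"matched", so the caller goes on as if it were no edge. -/
theorem leads_second (hσ : ∀ i < R, ω i = σ i) (hτ : ∀ i < R, ω (R + i) = τ i) (lim : ℕ)
    (hlim : lim ≤ R) (v : Fin n) (o : ℕ) (st : List Frame) (p cnt : ℕ) :
    Leads G R s flag ω (1 + cost (G \ greedy G σ R) τ (secondWeight G σ R) lim v)
      ⟨⟨1, v, o, 0, lim⟩ :: st, 0, p, cnt, False⟩
      ⟨st, if v ∈ free (G \ greedy G σ R) τ lim then 2 else 1, p, cnt, False⟩ := by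
  classical
  induction lim using Nat.strong_induction_on generalizing v o st with
  | _ lim ih =>
    refine leads_scan sdiff_le (by norm_num) (fun _ _ => by rw [secondWeight]; omega)
      (fun i hi => by simpa using hτ i (by omega)) v o st p cnt fun i hi hv ha st => ?_
    have h := ih i hi (by omega) (τ i - v) v st
    have h1 := leads_edge (s := s) (flag := flag) hσ ha.symm i st p cnt
    have h2 : edgeCost G σ R v (τ i - v) = edgeCost G σ R (τ i - v) v := by
      rw [edgeCost, edgeCost]
      refine sum_congr rfl fun l _ => ?_
      by_cases h3 : v ∈ free G σ l <;> by_cases h4 : τ i - v ∈ free G σ l <;> simp [h3, h4]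
      omega
    rw [secondWeight, if_pos ha, h2]
    by_cases hM : (greedy G σ R).Adj (τ i - v) v
    · rw [if_pos hM] at h1
      have hK : ¬ (G \ greedy G σ R).Adj v (τ i - v) := by
        rw [SimpleGraph.sdiff_adj]
        exact fun hc => hc.2 hM.symm
      rw [if_neg fun hc : _ ∧ _ => hK hc.1]
      exact h1.mono (by omega)
    · rw [if_neg hM] at h1
      have hK : (G \ greedy G σ R).Adj v (τ i - v) := by
        rw [SimpleGraph.sdiff_adj]
        exact ⟨ha, fun hc => hM hc.symm⟩
      have hcall : callCost (G \ greedy G σ R) τ (secondWeight G σ R) i v =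
          cost (G \ greedy G σ R) τ (secondWeight G σ R) i (τ i - v) := by
        rw [callCost, if_pos ⟨hv, hK⟩]
      rw [hcall]
      simp only [hK, true_and]
      refine Leads.mono (m := 1 + edgeCost G σ R (τ i - v) v +
        (1 + cost (G \ greedy G σ R) τ (secondWeight G σ R) i (τ i - v))) ?_ (by omega)
      convert h1.trans h

/-- The `6` in `vertexCost`: for each of the two matchings, one step to start, one extra step of the
scan and one to count the answer. -/
theorem leads_root (hσ : ∀ i < R, ω i = σ i) (hτ : ∀ i < R, ω (R + i) = τ i) {t : ℕ} (ht : t < s)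
    {v : Fin n} (hv : (if flag = 0 then ω (2 * R + t) else t) = v) (cnt : ℕ) :
    Leads G R s flag ω (vertexCost G σ τ R v) ⟨[], 0, 2 * t, cnt, False⟩
      ⟨[], 0, 2 * (t + 1), cnt + coverCount G σ τ R v, False⟩ := by
  have h1 := leads_first (s := s) (flag := flag) (G := G) hσ R le_rfl v 0 [] (2 * t) cnt
  have h2 := Leads.head (c := ⟨[], 0, 2 * t, cnt, False⟩) (by
    simp only [step, if_true, show 2 * t ≠ 2 * s by omega, if_false, show 2 * t % 2 = 0 by omega,
      show 2 * t / 2 = t by omega, hv]) h1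
  have h3 := h2.trans (Leads.head (c' := ⟨[], 0, 2 * t + 1,
    cnt + if v ∈ free G σ R then 0 else 1, False⟩) (by split_ifs <;> simp [step]) (Leads.refl _))
  have h4 := leads_second (s := s) (flag := flag) (G := G) hσ hτ R le_rfl v 0 [] (2 * t + 1)
    (cnt + if v ∈ free G σ R then 0 else 1)
  have h5 := Leads.head (c := ⟨[], 0, 2 * t + 1, cnt + if v ∈ free G σ R then 0 else 1, False⟩) (by
    simp only [step, if_true, show 2 * t + 1 ≠ 2 * s by omega, if_false,
      show (2 * t + 1) % 2 = 1 by omega, show (2 * t + 1) / 2 = t by omega, hv]) h4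
  have h6 := h5.trans (Leads.head (c' := ⟨[], 0, 2 * (t + 1),
    cnt + coverCount G σ τ R v, False⟩) (by
      rw [coverCount, ← add_assoc]
      split_ifs <;> simp [step] <;> ring) (Leads.refl _))
  exact (h3.trans h6).mono (by rw [vertexCost]; omega)

theorem leads_done (hσ : ∀ i < R, ω i = σ i) (hτ : ∀ i < R, ω (R + i) = τ i) (S : Fin s → Fin n)
    (hS : ∀ t : Fin s, (if flag = 0 then ω (2 * R + t) else t) = (S t : ℕ)) :
    Leads G R s flag ω (1 + ∑ t, vertexCost G σ τ R (S t)) ⟨[], 0, 0, 0, False⟩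
      ⟨[], 0, 2 * s, ∑ t, coverCount G σ τ R (S t), True⟩ := by
  have key : ∀ t (ht : t ≤ s), Leads G R s flag ω
      (∑ i : Fin t, vertexCost G σ τ R (S (i.castLE ht))) ⟨[], 0, 0, 0, False⟩
      ⟨[], 0, 2 * t, ∑ i : Fin t, coverCount G σ τ R (S (i.castLE ht)), False⟩ := by
    intro t
    induction t with
    | zero => intro _; simpa using Leads.refl _
    | succ t ih =>
      intro ht
      have h := (ih (by omega)).trans (leads_root (G := G) hσ hτ (show t < s by omega)
        (hS ⟨t, by omega⟩) _)
      rw [Fin.sum_univ_castSucc, Fin.sum_univ_castSucc]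
      exact h
  have h := (key s le_rfl).trans (Leads.head (m := 0) (by simp [step]; rfl) (Leads.refl _))
  rw [add_comm]
  exact h

end Run

/-! ### A calculus for values, running time and memory of programs -/

open PairRAM

/-- All registers and array cells hold numbers below `M`. -/
def Below (M : ℕ) (r : ℕ → ℕ) (a : ℕ → ℕ → ℕ) : Prop :=
  (∀ x, r x < M) ∧ ∀ b i, a b i < M

/-- The value of an expression in the memory with registers `r` and arrays `a`. -/
def val (r : ℕ → ℕ) (a : ℕ → ℕ → ℕ) : Expr → ℕ
  | .lit c => c
  | .reg x => r x
  | .get b i => a b (val r a i)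
  | .bin op e₁ e₂ => op.eval (val r a e₁) (val r a e₂)

theorem eval_eq_val (s : State) (e : Expr) : e.eval s = val s.reg s.arr e := by
  induction e with
  | lit c => rfl
  | reg x => rfl
  | get b i ih => simp only [Expr.eval, val, ih]
  | bin op e₁ e₂ ih₁ ih₂ => simp only [Expr.eval, val, ih₁, ih₂]

/-- The bit length of the value of an expression is at most this multiple of that of the memory. -/
def sizeFactor : Expr → ℕ
  | .lit c => c.size
  | .reg _ => 1
  | .get _ _ => 1
  | .bin _ e₁ e₂ => sizeFactor e₁ + sizeFactor e₂ + 1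

/-- The cost of an expression is at most this multiple of the square of the bit length of the
memory. -/
def evalFactor : Expr → ℕ
  | .lit c => 1 + c.size
  | .reg _ => 1
  | .get _ i => evalFactor i + (sizeFactor i + 1)
  | .bin _ e₁ e₂ => evalFactor e₁ + evalFactor e₂ + (1 + sizeFactor e₁) * (1 + sizeFactor e₂)

/-- The running time of a program without loops is at most this multiple of the square of the bit
length of the memory; for a loop, this refers to the time per round. -/
def timeFactor : Cmd → ℕ
  | .skip => 1
  | .assign _ e => evalFactor e + (1 + sizeFactor e)
  | .put _ i e => evalFactor i + evalFactor e + (1 + sizeFactor i + sizeFactor e)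
  | .query _ u v => evalFactor u + evalFactor v + (1 + sizeFactor u + sizeFactor v)
  | .rand _ e => evalFactor e + (1 + sizeFactor e)
  | .seq c₁ c₂ => timeFactor c₁ + timeFactor c₂
  | .ite e c₁ c₂ => 1 + evalFactor e + timeFactor c₁ + timeFactor c₂
  | .loop e c => 1 + evalFactor e + timeFactor c

theorem size_add_le (x y : ℕ) : (x + y).size ≤ x.size + y.size + 1 := by
  rw [Nat.size_le]
  have h1 := Nat.lt_size_self x
  have h2 := Nat.lt_size_self y
  have h3 : 2 ^ x.size ≤ 2 ^ (x.size + y.size) := Nat.pow_le_pow_right (by norm_num) (by omega)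
  have h4 : 2 ^ y.size ≤ 2 ^ (x.size + y.size) := Nat.pow_le_pow_right (by norm_num) (by omega)
  rw [pow_succ]
  omega

theorem size_mul_le (x y : ℕ) : (x * y).size ≤ x.size + y.size := by
  rw [Nat.size_le, pow_add]
  exact Nat.mul_lt_mul'' (Nat.lt_size_self x) (Nat.lt_size_self y)

theorem size_binOp_le (op : BinOp) (x y : ℕ) : (op.eval x y).size ≤ x.size + y.size + 1 := by
  have hx : ∀ z ≤ x, z.size ≤ x.size + y.size + 1 := fun z hz =>
    (Nat.size_le_size hz).trans (by omega)
  have h1 : ∀ z ≤ 1, z.size ≤ x.size + y.size + 1 := fun z hz =>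
    (Nat.size_le_size hz).trans (by simp)
  cases op with
  | add => exact size_add_le x y
  | sub => exact hx _ (Nat.sub_le _ _)
  | mul => exact (size_mul_le x y).trans (by omega)
  | div => exact hx _ (Nat.div_le_self _ _)
  | mod => exact hx _ (Nat.mod_le _ _)
  | lt => exact h1 _ (by simp only [BinOp.eval]; split_ifs <;> omega)
  | eq => exact h1 _ (by simp only [BinOp.eval]; split_ifs <;> omega)

theorem size_val_le {M : ℕ} {r : ℕ → ℕ} {a : ℕ → ℕ → ℕ} (h : Below M r a) (e : Expr) :
    (val r a e).size ≤ sizeFactor e * (M.size + 1) := by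
  induction e with
  | lit c => exact Nat.le_mul_of_pos_right _ (by omega)
  | reg x => simpa [val, sizeFactor] using (Nat.size_le_size (h.1 x).le).trans (by omega)
  | get b i ih => simpa [val, sizeFactor] using (Nat.size_le_size (h.2 b _).le).trans (by omega)
  | bin op e₁ e₂ ih₁ ih₂ =>
    refine (size_binOp_le op _ _).trans ?_
    rw [sizeFactor]
    nlinarith

theorem binOp_cost_le (op : BinOp) (x y : ℕ) : op.cost x y ≤ (1 + x.size) * (1 + y.size) := by
  cases op <;> simp only [BinOp.cost] <;> nlinarith [Nat.zero_le (x.size * y.size)]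

theorem cost_expr_le {M : ℕ} {s : State} (h : Below M s.reg s.arr) (e : Expr) :
    e.cost s ≤ evalFactor e * (M.size + 1) ^ 2 := by
  induction e with
  | lit c => exact Nat.le_mul_of_pos_right _ (by positivity)
  | reg x =>
    have := Nat.size_le_size (h.1 x).le
    rw [Expr.cost, evalFactor]
    nlinarith
  | get b i ih =>
    have h1 := size_val_le h i
    have h2 := Nat.size_le_size (h.2 b (i.eval s)).le
    rw [Expr.cost, evalFactor]
    rw [← eval_eq_val] at h1
    nlinarith [Nat.zero_le (sizeFactor i * (M.size + 1) * M.size)]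
  | bin op e₁ e₂ ih₁ ih₂ =>
    have h1 := size_val_le h e₁
    have h2 := size_val_le h e₂
    rw [← eval_eq_val] at h1 h2
    have h3 := (binOp_cost_le op (e₁.eval s) (e₂.eval s)).trans (Nat.mul_le_mul
      (show _ ≤ (1 + sizeFactor e₁) * (M.size + 1) by nlinarith)
      (show _ ≤ (1 + sizeFactor e₂) * (M.size + 1) by nlinarith))
    rw [Expr.cost, evalFactor]
    nlinarith

/-- The value of `e` is below `M` provided that the memory is. -/
def Fits (M : ℕ) (r : ℕ → ℕ) (a : ℕ → ℕ → ℕ) : Expr → Prop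
  | .reg _ => True
  | .get _ _ => True
  | e => val r a e < M

theorem Fits.lt {M : ℕ} {r : ℕ → ℕ} {a : ℕ → ℕ → ℕ} (h : Below M r a) {e : Expr}
    (he : Fits M r a e) : val r a e < M := by
  cases e with
  | lit c => exact he
  | reg x => exact h.1 x
  | get b i => exact h.2 b _
  | bin op e₁ e₂ => exact he

/-- The weakest precondition of a program without loops and random draws, for runs that only
write numbers below `M`. -/
def wp (O : ℕ → ℕ → ℕ) (M : ℕ) : Cmd → ((ℕ → ℕ) → (ℕ → ℕ → ℕ) → Prop) →
    (ℕ → ℕ) → (ℕ → ℕ → ℕ) → Prop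
  | .skip, Q, r, a => Q r a
  | .assign x e, Q, r, a => Fits M r a e ∧ Q (Function.update r x (val r a e)) a
  | .put b i e, Q, r, a => Fits M r a e ∧
      Q r (Function.update a b (Function.update (a b) (val r a i) (val r a e)))
  | .query x u v, Q, r, a => O (val r a u) (val r a v) < M ∧
      Q (Function.update r x (O (val r a u) (val r a v))) a
  | .rand _ _, _, _, _ => False
  | .seq c₁ c₂, Q, r, a => wp O M c₁ (wp O M c₂ Q) r a
  | .ite e c₁ c₂, Q, r, a => if val r a e = 0 then wp O M c₂ Q r a else wp O M c₁ Q r a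
  | .loop _ _, _, _, _ => False

theorem Below.setReg {M : ℕ} {r : ℕ → ℕ} {a : ℕ → ℕ → ℕ} (h : Below M r a) {v : ℕ} (hv : v < M)
    (x : ℕ) : Below M (Function.update r x v) a := by
  refine ⟨fun y => ?_, h.2⟩
  rw [Function.update_apply]
  split_ifs
  exacts [hv, h.1 y]

theorem Below.setArr {M : ℕ} {r : ℕ → ℕ} {a : ℕ → ℕ → ℕ} (h : Below M r a) {v : ℕ} (hv : v < M)
    (b i : ℕ) : Below M r (Function.update a b (Function.update (a b) i v)) := by
  refine ⟨h.1, fun c j => ?_⟩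
  rw [Function.update_apply]
  split_ifs
  · rw [Function.update_apply]
    split_ifs
    exacts [hv, h.2 b j]
  · exact h.2 c j

/-- From `s`, the program `c` runs deterministically, in time at most `T`, into a memory below `M`
that satisfies `Q`. -/
def Runs (O : ℕ → ℕ → ℕ) (N M : ℕ) (c : Cmd) (s : State) (T : ℕ)
    (Q : (ℕ → ℕ) → (ℕ → ℕ → ℕ) → Prop) : Prop :=
  ∃ s', exec O N c s = PMF.pure (some s') ∧ s'.time ≤ s.time + T ∧ Below M s'.reg s'.arr ∧
    Q s'.reg s'.arr

section Rules

variable {O : ℕ → ℕ → ℕ} {N M : ℕ}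

theorem andThen_pure (s : State) (f : State → PMF (Option State)) :
    andThen (PMF.pure (some s)) f = f s := by
  simp [andThen]

theorem Runs.mono {c : Cmd} {s : State} {T T' : ℕ} {Q Q' : (ℕ → ℕ) → (ℕ → ℕ → ℕ) → Prop}
    (h : Runs O N M c s T Q) (hT : T ≤ T') (hQ : ∀ r a, Below M r a → Q r a → Q' r a) :
    Runs O N M c s T' Q' := by
  obtain ⟨s', h1, h2, h3, h4⟩ := h
  exact ⟨s', h1, by omega, h3, hQ _ _ h3 h4⟩

theorem Runs.seq {c₁ c₂ : Cmd} {s : State} {T₁ T₂ : ℕ} {Q₁ Q₂ : (ℕ → ℕ) → (ℕ → ℕ → ℕ) → Prop}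
    (h₁ : Runs O N M c₁ s T₁ Q₁)
    (h₂ : ∀ s', Below M s'.reg s'.arr → Q₁ s'.reg s'.arr → Runs O N M c₂ s' T₂ Q₂) :
    Runs O N M (.seq c₁ c₂) s (T₁ + T₂) Q₂ := by
  obtain ⟨s₁, e1, t1, b1, q1⟩ := h₁
  obtain ⟨s₂, e2, t2, b2, q2⟩ := h₂ s₁ b1 q1
  exact ⟨s₂, by rw [exec, e1, andThen_pure, e2], by omega, b2, q2⟩

/-- Reduces loop-free deterministic code to a computation of `wp`, with the time included: the
numbers involved have bit length linear in that of `M`, and each operation costs at most the product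
of such lengths. -/
theorem runs_of_wp (c : Cmd) {Q : (ℕ → ℕ) → (ℕ → ℕ → ℕ) → Prop} {s : State}
    (hb : Below M s.reg s.arr) (h : wp O M c Q s.reg s.arr) :
    Runs O N M c s (timeFactor c * (M.size + 1) ^ 2) Q := by
  have hpos : 1 ≤ (M.size + 1) ^ 2 := Nat.one_le_pow _ _ (by omega)
  induction c generalizing Q s with
  | skip => exact ⟨_, rfl, by simpa [State.tick, timeFactor] using hpos, hb, h⟩
  | assign x e =>
    have h1 := cost_expr_le hb e
    have h2 := size_val_le hb e
    refine ⟨_, rfl, ?_, ?_, ?_⟩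
    · simp only [State.tick, State.setReg, timeFactor, eval_eq_val]
      nlinarith [Nat.zero_le (sizeFactor e * (M.size + 1) * M.size)]
    · simp only [State.tick, State.setReg, eval_eq_val]
      exact hb.setReg (h.1.lt hb) x
    · simp only [State.tick, State.setReg, eval_eq_val]
      exact h.2
  | put b i e =>
    have h1 := cost_expr_le hb e
    have h2 := size_val_le hb e
    have h3 := cost_expr_le hb i
    have h4 := size_val_le hb i
    refine ⟨_, rfl, ?_, ?_, ?_⟩
    · simp only [State.tick, State.setArr, timeFactor, eval_eq_val]
      nlinarith [Nat.zero_le (sizeFactor e * (M.size + 1) * M.size),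
        Nat.zero_le (sizeFactor i * (M.size + 1) * M.size)]
    · simp only [State.tick, State.setArr, eval_eq_val]
      exact hb.setArr (h.1.lt hb) b _
    · simp only [State.tick, State.setArr, eval_eq_val]
      exact h.2
  | query x u v =>
    have h1 := cost_expr_le hb u
    have h2 := size_val_le hb u
    have h3 := cost_expr_le hb v
    have h4 := size_val_le hb v
    refine ⟨_, rfl, ?_, ?_, ?_⟩
    · simp only [State.tick, State.setReg, timeFactor, eval_eq_val]
      nlinarith [Nat.zero_le (sizeFactor u * (M.size + 1) * M.size),
        Nat.zero_le (sizeFactor v * (M.size + 1) * M.size)]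
    · simp only [State.tick, State.setReg, eval_eq_val]
      exact hb.setReg h.1 x
    · simp only [State.tick, State.setReg, eval_eq_val]
      exact h.2
  | rand x e => exact h.elim
  | seq c₁ c₂ ih₁ ih₂ =>
    rw [timeFactor, add_mul]
    exact (ih₁ hb h).seq fun s' hb' h' => ih₂ hb' h'
  | ite e c₁ c₂ ih₁ ih₂ =>
    have h1 := cost_expr_le hb e
    rw [wp] at h
    by_cases he : val s.reg s.arr e = 0
    · rw [if_pos he] at h
      obtain ⟨s', e1, t1, b1, q1⟩ := ih₂ (s := s.tick (1 + e.cost s)) hb h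
      refine ⟨s', by rw [exec, eval_eq_val, if_pos he, e1], ?_, b1, q1⟩
      simp only [State.tick] at t1
      rw [timeFactor]
      nlinarith [Nat.zero_le (timeFactor c₁ * (M.size + 1) ^ 2)]
    · rw [if_neg he] at h
      obtain ⟨s', e1, t1, b1, q1⟩ := ih₁ (s := s.tick (1 + e.cost s)) hb h
      refine ⟨s', by rw [exec, eval_eq_val, if_neg he, e1], ?_, b1, q1⟩
      simp only [State.tick] at t1
      rw [timeFactor]
      nlinarith [Nat.zero_le (timeFactor c₂ * (M.size + 1) ^ 2)]
  | loop e c ih => exact h.elim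

/-- `I d` holds when at most `d` rounds of the loop are left. -/
theorem runs_loop {e : Expr} {c : Cmd} {T : ℕ} (I : ℕ → (ℕ → ℕ) → (ℕ → ℕ → ℕ) → Prop)
    (h0 : ∀ r a, I 0 r a → val r a e = 0)
    (hI : ∀ d s, Below M s.reg s.arr → I (d + 1) s.reg s.arr → val s.reg s.arr e ≠ 0 →
      Runs O N M c s T (I d))
    {d : ℕ} (hN : d < N) {s : State} (hb : Below M s.reg s.arr) (hs : I d s.reg s.arr) :
    Runs O N M (.loop e c) s
      ((d + 1) * (T + (1 + evalFactor e) * (M.size + 1) ^ 2))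
      (fun r a => val r a e = 0 ∧ ∃ d, I d r a) := by
  have hpos : 1 ≤ (M.size + 1) ^ 2 := Nat.one_le_pow _ _ (by omega)
  have key : ∀ K d, d < K → ∀ s : State, Below M s.reg s.arr → I d s.reg s.arr →
      ∃ s', iterate e (exec O N c) K s = PMF.pure (some s') ∧ s'.time ≤ s.time +
        ((d + 1) * (T + (1 + evalFactor e) * (M.size + 1) ^ 2)) ∧ Below M s'.reg s'.arr ∧
        val s'.reg s'.arr e = 0 ∧ ∃ d, I d s'.reg s'.arr := by
    intro K
    induction K with
    | zero => intro d hd; omega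
    | succ K ih =>
      intro d hd s hb hs
      have h1 := cost_expr_le hb e
      by_cases he : val s.reg s.arr e = 0
      · refine ⟨s.tick (1 + e.cost s), by rw [iterate, eval_eq_val, if_pos he], ?_, hb, he, d, hs⟩
        simp only [State.tick]
        nlinarith [Nat.zero_le (d * (T + (1 + evalFactor e) * (M.size + 1) ^ 2))]
      · obtain _ | d := d
        · exact absurd (h0 _ _ hs) he
        obtain ⟨s', e1, t1, b1, q1⟩ := hI d (s.tick (1 + e.cost s)) hb hs he
        obtain ⟨s'', e2, t2, b2, q2⟩ := ih d (by omega) s' b1 q1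
        refine ⟨s'', by rw [iterate, eval_eq_val, if_neg he, e1, andThen_pure, e2], ?_, b2, q2⟩
        simp only [State.tick] at t1
        nlinarith
  obtain ⟨s', e1, t1, b1, q1⟩ := key N d hN s hb hs
  exact ⟨s', by rw [exec, e1], t1, b1, q1⟩

end Rules

/-! ### The program for one step of the search -/

/-- Sequential composition of a list of programs. -/
def block : List Cmd → Cmd
  | [] => .skip
  | [c] => c
  | c :: cs => .seq c (block cs)

/-- Register `x` := register `y`. -/
def copy (x y : ℕ) : Cmd := .assign x (.reg y)

/-- Register `x` := `c`. -/
def const (x c : ℕ) : Cmd := .assign x (.lit c)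

/-- Increase register `x` by one. -/
def incr (x : ℕ) : Cmd := .assign x (.bin .add (.reg x) (.lit 1))

/-- Decrease register `x` by one. -/
def decr (x : ℕ) : Cmd := .assign x (.bin .sub (.reg x) (.lit 1))

/-- Register `17` := the vertex that the colour `c` pairs with the vertex `x`. -/
def partnerCmd (c x : Expr) : Cmd :=
  .assign 17 (.bin .mod (.bin .sub (.bin .add c (.reg 0)) x) (.reg 0))

/-! Registers: `0` number of vertices, `3` rounds, `4` samples, `5` flag, `6` fuel, `7` stack height,
`8` returned answer, `9` and `10` counters, `11` to `15` the current frame, `16` to `18` auxiliary,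
`19` height at which the current frame is stored. Arrays: `0` random vertices, `1` to `5` stack. -/

def loadFrame : Cmd :=
  block [.assign 11 (.get 1 (.reg 19)), .assign 12 (.get 2 (.reg 19)), .assign 13 (.get 3 (.reg 19)),
    .assign 14 (.get 4 (.reg 19)), .assign 15 (.get 5 (.reg 19))]

def storeFrame : Cmd :=
  block [.put 1 (.reg 19) (.reg 11), .put 2 (.reg 19) (.reg 12), .put 3 (.reg 19) (.reg 13),
    .put 4 (.reg 19) (.reg 14), .put 5 (.reg 19) (.reg 15)]

/-- Return the answer `c` from the current call. -/
def returnCmd (c : ℕ) : Cmd := block [decr 7, const 8 c]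

def rootCmd : Cmd :=
  .ite (.reg 8)
    (block [.assign 10 (.bin .add (.reg 10) (.bin .eq (.reg 8) (.lit 1))), incr 9, const 8 0])
    (.ite (.bin .eq (.reg 9) (.bin .mul (.lit 2) (.reg 4))) (const 6 0)
      (block [.assign 11 (.bin .mod (.reg 9) (.lit 2)),
        .ite (.reg 5) (.assign 12 (.bin .div (.reg 9) (.lit 2)))
          (.assign 12 (.get 0 (.bin .add (.bin .mul (.lit 2) (.reg 3))
            (.bin .div (.reg 9) (.lit 2))))),
        const 13 0, const 14 0, copy 15 3, const 7 1, const 19 1]))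

def resumeCmd : Cmd :=
  .ite (.bin .eq (.reg 8) (.lit 2))
    (.ite (.bin .eq (.reg 11) (.lit 2)) (block [const 11 1, const 14 0, const 8 0]) (returnCmd 1))
    (block [incr 14, const 8 0])

def edgeCmd : Cmd :=
  .ite (.bin .eq (.reg 14) (.bin .mul (.lit 2) (.reg 3))) (block [const 11 1, const 14 0])
    (block [.ite (.bin .mod (.reg 14) (.lit 2)) (copy 16 13) (copy 16 12),
      partnerCmd (.get 0 (.bin .div (.reg 14) (.lit 2))) (.reg 16),
      .ite (.bin .eq (.reg 17) (.bin .sub (.bin .add (.reg 12) (.reg 13)) (.reg 16))) (returnCmd 1)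
        (block [.query 18 (.reg 16) (.reg 17),
          .ite (.reg 18)
            (block [incr 7, copy 19 7, const 11 0, copy 12 17, copy 13 16,
              .assign 15 (.bin .div (.reg 14) (.lit 2)), const 14 0])
            (incr 14)])])

def scanCmd : Cmd :=
  .ite (.bin .eq (.reg 14) (.reg 15)) (returnCmd 2)
    (block [partnerCmd (.get 0 (.bin .add (.bin .mul (.reg 11) (.reg 3)) (.reg 14))) (.reg 12),
      .query 18 (.reg 12) (.reg 17),
      .ite (.reg 18)
        (block [incr 7, copy 19 7, .assign 11 (.bin .mul (.lit 2) (.reg 11)), copy 13 12,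
          copy 12 17, copy 15 14, const 14 0])
        (incr 14)])

/-- The frame is loaded, changed in registers and written back at the index in register `19`. A
return lowers register `7` only, so the write lands above the stack; a push raises both and leaves
the frame of the caller intact; with an empty stack, index `0` serves as a dummy. -/
def stepCmd : Cmd :=
  block [decr 6, copy 19 7, loadFrame,
    .ite (.reg 7) (.ite (.reg 8) resumeCmd
      (.ite (.bin .eq (.reg 11) (.lit 2)) edgeCmd scanCmd)) rootCmd,
    storeFrame]

/-- The arrays `1` to `5` hold the stack, with its bottom at index `1`. -/
def RepStack (a : ℕ → ℕ → ℕ) : List Frame → Prop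
  | [] => True
  | f :: st => (a 1 (st.length + 1) = f.kind ∧ a 2 (st.length + 1) = f.v ∧
      a 3 (st.length + 1) = f.o ∧ a 4 (st.length + 1) = f.i ∧ a 5 (st.length + 1) = f.lim) ∧
      RepStack a st

/-- The memory represents the state `c` of the search. -/
structure Rep (n R s flag B : ℕ) (ω : ℕ → ℕ) (r : ℕ → ℕ) (a : ℕ → ℕ → ℕ) (c : Config) :
    Prop where
  reg0 : r 0 = n
  reg3 : r 3 = R
  reg4 : r 4 = s
  reg5 : r 5 = flag
  height : r 7 = c.stk.length
  ret : r 8 = c.ret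
  p : r 9 = c.p
  cnt : r 10 = c.cnt
  colours : a 0 = ω
  stack : RepStack a c.stk
  -- A step raises each of these quantities by at most one and lowers the fuel `r 6` by at least
  -- one, so the bounds persist and keep the memory small.
  height_le : c.stk.length + r 6 ≤ B
  p_le : c.p + r 6 ≤ B
  cnt_le : c.cnt + r 6 ≤ B
  frames : ∀ f ∈ c.stk, f.kind ≤ 2 ∧ f.i + r 6 ≤ B

/-- The result of storing the frame held by the registers. -/
def stored (r : ℕ → ℕ) (a : ℕ → ℕ → ℕ) (b i : ℕ) : ℕ :=
  if 1 ≤ b ∧ b ≤ 5 ∧ i = r 19 then r (10 + b) else a b i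

theorem wp_storeFrame {O : ℕ → ℕ → ℕ} {M : ℕ} {Q : (ℕ → ℕ) → (ℕ → ℕ → ℕ) → Prop} :
    wp O M storeFrame Q = fun r a => Q r (stored r a) := by
  funext r a
  simp only [storeFrame, block, wp, val, Fits, true_and, eq_iff_iff]
  suffices h : ∀ a' : ℕ → ℕ → ℕ, (∀ b i, a' b i = stored r a b i) → (Q r a' ↔ Q r (stored r a)) by
    refine h _ fun b i => ?_
    rcases b with _ | _ | _ | _ | _ | _ | b <;>
      by_cases hi : i = r 19 <;> simp [stored, hi]
  intro a' h
  rw [show a' = stored r a by funext b i; exact h b i]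

theorem repStack_stored {r : ℕ → ℕ} {a : ℕ → ℕ → ℕ} {st : List Frame}
    (h : st.length < r 19 ∨ r 19 = 0) : RepStack (stored r a) st ↔ RepStack a st := by
  induction st with
  | nil => rfl
  | cons f st ih =>
    rw [List.length_cons] at h
    have h' : ∀ c, stored r a c (st.length + 1) = a c (st.length + 1) := fun c =>
      if_neg (by omega)
    simp only [RepStack, h', ih (by omega)]

theorem repStack_stored_cons {r : ℕ → ℕ} {a : ℕ → ℕ → ℕ} {f : Frame} {st : List Frame}
    (h : r 19 = st.length + 1) : RepStack (stored r a) (f :: st) ↔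
      (r 11 = f.kind ∧ r 12 = f.v ∧ r 13 = f.o ∧ r 14 = f.i ∧ r 15 = f.lim) ∧ RepStack a st := by
  rw [RepStack, repStack_stored (by omega)]
  simp [stored, h]

theorem rep_iff {n R s flag B : ℕ} {ω : ℕ → ℕ} {r : ℕ → ℕ} {a : ℕ → ℕ → ℕ} {c : Config} :
    Rep n R s flag B ω r a c ↔ (r 0 = n ∧ r 3 = R ∧ r 4 = s ∧ r 5 = flag ∧ r 7 = c.stk.length ∧
      r 8 = c.ret ∧ r 9 = c.p ∧ r 10 = c.cnt ∧ a 0 = ω) ∧ RepStack a c.stk ∧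
      c.stk.length + r 6 ≤ B ∧ c.p + r 6 ≤ B ∧ c.cnt + r 6 ≤ B ∧
      ∀ f ∈ c.stk, f.kind ≤ 2 ∧ f.i + r 6 ≤ B := by
  constructor
  · rintro ⟨⟩
    simp only [*, true_and]
    assumption
  · rintro ⟨⟨h0, h3, h4, h5, h7, h8, h9, h10, ha⟩, hst, l1, l2, l3, l4⟩
    exact ⟨h0, h3, h4, h5, h7, h8, h9, h10, ha, hst, l1, l2, l3, l4⟩

theorem repStack_nil {a : ℕ → ℕ → ℕ} : RepStack a [] := trivial

theorem stored_zero {r : ℕ → ℕ} {a : ℕ → ℕ → ℕ} : stored r a 0 = a 0 := by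
  funext i
  simp [stored]

/-! ### The program simulates the stack machine -/

section Step

set_option linter.unusedSimpArgs false

variable {n R s flag B M : ℕ} {ω : ℕ → ℕ} {O : ℕ → ℕ → ℕ}

/-- The cases of `step` are split and the program is executed by `simp`. The final alternative:
either one unit of fuel was used, or the search has ended and the fuel was emptied. -/
theorem wp_stepCmd_root (hB : B + 3 < M) {r : ℕ → ℕ} {a : ℕ → ℕ → ℕ} (hb : Below M r a)
    {c : Config} (hr : Rep n R s flag B ω r a c) (h6 : r 6 ≠ 0) (hstk : c.stk = []) :
    wp O M stepCmd (fun r' a' =>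
      Rep n R s flag B ω r' a' (step n R s flag ω O c) ∧
      (r' 6 + 1 = r 6 ∨ r' 6 = 0 ∧ (step n R s flag ω O c).done)) r a := by
  obtain ⟨stk, ret, p, cnt, done⟩ := c
  simp only at hstk
  subst hstk
  obtain ⟨h0, h3, h4, h5, h7, h8, h9, h10, ha, -, l1, l2, l3, -⟩ := hr
  simp only [List.length_nil] at h7 h8 h9 h10 l1 l2 l3
  have hb6 := hb.1 6
  have hb9 := hb.1 9
  have hdec : r 6 - 1 + 1 = r 6 := by omega
  rw [stepCmd, rootCmd]
  by_cases hret : ret = 0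
  · by_cases hp : p = 2 * s <;> by_cases hf : flag = 0 <;>
    simp [block, wp, val, Fits, wp_storeFrame, loadFrame, copy, const, incr, decr, BinOp.eval,
      rep_iff, stored_zero, repStack_stored_cons, repStack_nil, h0, h3, h4, h5, h7, h8, h9, h10,
      ha, hret, hp, hf, hdec, step] <;>
    omega
  · simp [block, wp, val, Fits, wp_storeFrame, loadFrame, copy, const, incr, decr, BinOp.eval,
      rep_iff, stored_zero, repStack_nil, h0, h3, h4, h5, h7, h8, h9, h10, ha, hret, hdec, step]
    split_ifs <;> omega

theorem wp_stepCmd_frame (hn : n ≠ 0) (hB : B + 3 < M) (hO : ∀ u v, O u v < M)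
    {r : ℕ → ℕ} {a : ℕ → ℕ → ℕ} (hb : Below M r a)
    {c : Config} (hr : Rep n R s flag B ω r a c) (h6 : r 6 ≠ 0) {f : Frame} {st : List Frame}
    (hstk : c.stk = f :: st) :
    wp O M stepCmd (fun r' a' =>
      Rep n R s flag B ω r' a' (step n R s flag ω O c) ∧
      (r' 6 + 1 = r 6 ∨ r' 6 = 0 ∧ (step n R s flag ω O c).done)) r a := by
  obtain ⟨stk, ret, p, cnt, done⟩ := c
  obtain ⟨k, v, o, i, lim⟩ := f
  simp only at hstk
  subst hstk
  obtain ⟨h0, h3, h4, h5, h7, h8, h9, h10, ha, hst', l1, l2, l3, l4⟩ := hr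
  simp only at hst'
  obtain ⟨⟨s1, s2, s3, s4, s5⟩, hst⟩ := id hst'
  simp only [List.length_cons] at h7 h8 h9 h10 l1 l2 l3 s1 s2 s3 s4 s5
  rw [List.forall_mem_cons] at l4
  obtain ⟨⟨lk, li⟩, l4⟩ := l4
  simp only at lk li
  have hb6 := hb.1 6
  have hb0 := hb.1 0
  have hvM := hb.2 2 (st.length + 1)
  have hoM := hb.2 3 (st.length + 1)
  have hdec : r 6 - 1 + 1 = r 6 := by omega
  have hfr : ∀ f ∈ st, f.kind ≤ 2 ∧ f.i + (r 6 - 1) ≤ B := fun f hf =>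
    ⟨(l4 f hf).1, by have := (l4 f hf).2; omega⟩
  have hmod : ∀ x, x % n < M := fun x => (Nat.mod_lt x (by omega)).trans (h0 ▸ hb0)
  rw [stepCmd]
  by_cases hret : ret = 0
  · by_cases hk : k = 2
    · subst hk
      rw [edgeCmd, partnerCmd, returnCmd]
      by_cases hi : i = 2 * R
      · simp [block, wp, val, Fits, wp_storeFrame, loadFrame, copy, const, incr, decr, BinOp.eval,
          rep_iff, stored_zero, repStack_stored_cons, h0, h3, h4, h5, h7, h8, h9, h10, ha, s1, s2,
          s3, s4, s5, hst, hret, hdec, step, hi]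
        and_intros <;> omega
      · by_cases hx : i % 2 = 0 <;>
        by_cases hy : (ω (i / 2) + n - (if i % 2 = 0 then v else o)) % n =
          v + o - (if i % 2 = 0 then v else o) <;>
        by_cases hq : O (if i % 2 = 0 then v else o)
          ((ω (i / 2) + n - (if i % 2 = 0 then v else o)) % n) = 0 <;>
        simp only [hx, if_true, if_false, add_tsub_cancel_left, add_tsub_cancel_right] at hy hq <;>
        simp [block, wp, val, Fits, wp_storeFrame, loadFrame, copy, const, incr, decr, BinOp.eval,
          rep_iff, stored_zero, repStack_stored_cons, repStack_stored, h0, h3, h4, h5, h7, h8, h9,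
          h10, ha, s1, s2, s3, s4, s5, hst, hst', hret, hdec, step, hi, hx, hy, hq, hmod, hO] <;>
        and_intros <;> omega
    · rw [scanCmd, partnerCmd, returnCmd]
      by_cases hi : i = lim <;> by_cases hq : O v ((ω (k * R + i) + n - v) % n) = 0 <;>
      simp [block, wp, val, Fits, wp_storeFrame, loadFrame, copy, const, incr, decr, BinOp.eval,
        rep_iff, stored_zero, repStack_stored_cons, repStack_stored, h0, h3, h4, h5, h7, h8, h9,
        h10, ha, s1, s2, s3, s4, s5, hst, hst', hret, hdec, step, hk, hi, hq, hmod, hO] <;>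
      and_intros <;> omega
  · rw [resumeCmd, returnCmd]
    by_cases hret2 : ret = 2 <;> by_cases hk : k = 2 <;>
    simp [block, wp, val, Fits, wp_storeFrame, loadFrame, copy, const, incr, decr, BinOp.eval,
      rep_iff, stored_zero, repStack_stored_cons, repStack_stored, h0, h3, h4, h5, h7, h8, h9, h10,
      ha, s1, s2, s3, s4, s5, hst, hret, hret2, hdec, step, hk] <;>
    and_intros <;> omega

end Step

/-! ### The search loop -/

section Programs

variable {O : ℕ → ℕ → ℕ} {N M : ℕ}

def searchCmd : Cmd := .loop (.reg 6) stepCmd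

/-- Only the finishing branch can set `done`, and it changes nothing else. -/
theorem step_of_done {n R s flag : ℕ} {ω : ℕ → ℕ} {c : Config} (hc : ¬ c.done)
    (h : (step n R s flag ω O c).done) :
    step n R s flag ω O (step n R s flag ω O c) = step n R s flag ω O c := by
  obtain ⟨stk, ret, p, cnt, done⟩ := c
  have key : stk = [] ∧ ret = 0 ∧ p = 2 * s := by
    by_contra hcon
    refine hc (cast ?_ h)
    rcases stk with _ | ⟨f, st⟩
    · by_cases hr : ret = 0
      · have hp : p ≠ 2 * s := fun hp => hcon ⟨rfl, hr, hp⟩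
        simp [step, hr, hp]
      · simp [step, hr]
    · simp only [step]
      split_ifs <;> rfl
  obtain ⟨rfl, rfl, rfl⟩ := key
  simp [step]

/-- The loop may stop early, but a finished search is fixed by `step`, so the count is the one after
exactly `B` steps. -/
theorem runs_searchCmd {n R s flag B : ℕ} {ω : ℕ → ℕ} (hn : n ≠ 0) (hB : B + 3 < M)
    (hO : ∀ u v, O u v < M) (hN : B < N) {σ : State} (hb : Below M σ.reg σ.arr)
    (h6 : σ.reg 6 = B) (hr : Rep n R s flag B ω σ.reg σ.arr ⟨[], 0, 0, 0, False⟩) :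
    Runs O N M searchCmd σ ((B + 1) * (timeFactor searchCmd * (M.size + 1) ^ 2))
      (fun r _ => r 0 = n ∧ r 4 = s ∧ r 10 ≤ B ∧
        r 10 = ((step n R s flag ω O)^[B] ⟨[], 0, 0, 0, False⟩).cnt) := by
  set F := step n R s flag ω O with hF
  set c₀ : Config := ⟨[], 0, 0, 0, False⟩ with hc₀
  have hstep : ∀ r a c, Below M r a → Rep n R s flag B ω r a c → r 6 ≠ 0 →
      wp O M stepCmd (fun r' a' => Rep n R s flag B ω r' a' (F c) ∧
        (r' 6 + 1 = r 6 ∨ r' 6 = 0 ∧ (F c).done)) r a := by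
    intro r a c hb hr h6
    rcases hstk : c.stk with _ | ⟨f, st⟩
    · exact wp_stepCmd_root hB hb hr h6 hstk
    · exact wp_stepCmd_frame hn hB hO hb hr h6 hstk
  have h := runs_loop (O := O) (N := N) (M := M) (e := .reg 6) (c := stepCmd)
    (T := timeFactor stepCmd * (M.size + 1) ^ 2)
    (fun d r a => r 6 ≤ d ∧ ∃ l, l + r 6 ≤ B ∧ Rep n R s flag B ω r a (F^[l] c₀) ∧
      (¬ (F^[l] c₀).done ∨ F (F^[l] c₀) = F^[l] c₀) ∧
      (l + r 6 = B ∨ (r 6 = 0 ∧ F (F^[l] c₀) = F^[l] c₀)))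
    (fun r a h => Nat.le_zero.1 h.1) ?_ hN hb
    ⟨h6.le, 0, by omega, hr, Or.inl (by simp [hc₀]), Or.inl (by omega)⟩
  · refine h.mono (le_of_eq (by simp only [searchCmd, timeFactor]; ring)) ?_
    rintro r a - ⟨h0, d, hd, l, hl, hrep, -, hor⟩
    simp only [val] at h0
    refine ⟨hrep.reg0, hrep.reg4, by rw [hrep.cnt]; exact le_of_add_le_left hrep.cnt_le, ?_⟩
    rw [hrep.cnt]
    rcases hor with h1 | ⟨-, h1⟩
    · rw [show l = B by omega]
    · have : F^[B] c₀ = F^[l] c₀ := by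
        rw [show B = (B - l) + l by omega, Function.iterate_add_apply]
        exact Function.iterate_fixed h1 _
      rw [this]
  · rintro d s' hb' ⟨hd, l, hl, hrep, hfix, hor⟩ he
    simp only [val] at he
    have h2 : l + s'.reg 6 = B := hor.resolve_right fun h => he h.1
    refine (runs_of_wp stepCmd hb' (hstep _ _ _ hb' hrep he)).mono le_rfl ?_
    rintro r a - ⟨hrep', h1⟩
    have hfix' : (F (F^[l] c₀)).done → F (F (F^[l] c₀)) = F (F^[l] c₀) := fun hd => by
      rcases hfix with h | h
      · exact step_of_done h hd
      · rw [h, h]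
    refine ⟨by omega, l + 1, by omega, ?_⟩
    rw [Function.iterate_succ_apply']
    refine ⟨hrep', (em _).symm.imp_right hfix', ?_⟩
    rcases h1 with h1 | ⟨h1, h4⟩
    · exact Or.inl (by omega)
    · exact Or.inr ⟨h1, hfix' h4⟩

end Programs

/-! ### Drawing the random vertices -/

theorem uniform_bind_map {α β : Type*} [Fintype α] [Nonempty α] (d : ℕ)
    (G : α → (Fin d → α) → β) :
    (PMF.uniformOfFintype α).bind (fun a => (PMF.uniformOfFintype (Fin d → α)).map (G a)) =
      (PMF.uniformOfFintype (Fin (d + 1) → α)).map fun f => G (f 0) (Fin.tail f) := by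
  classical
  ext x
  simp only [PMF.bind_apply, PMF.map_apply, PMF.uniformOfFintype_apply, tsum_fintype]
  rw [← (Fin.consEquiv fun _ : Fin (d + 1) => α).sum_comp, Fintype.sum_prod_type]
  refine sum_congr rfl fun a _ => ?_
  rw [mul_sum]
  refine sum_congr rfl fun f _ => ?_
  have h1 : (Fin.consEquiv fun _ : Fin (d + 1) => α) (a, f) 0 = a := rfl
  have h2 : Fin.tail ((Fin.consEquiv fun _ : Fin (d + 1) => α) (a, f)) = f := rfl
  rw [h1, h2]
  split_ifs
  · rw [← ENNReal.mul_inv (by simp) (by simp)]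
    simp [pow_succ']
  · simp

/-- From `s`, the program `c` runs in time at most `T` into a memory below `M`, which is determined
by a uniformly random element `x` of `A`, and `Q x` holds for that memory. -/
def Draws (O : ℕ → ℕ → ℕ) (N M : ℕ) (c : Cmd) (s : State) (T : ℕ) (A : Type) [Fintype A] [Nonempty A]
    (Q : A → (ℕ → ℕ) → (ℕ → ℕ → ℕ) → Prop) : Prop :=
  ∃ F : A → State, exec O N c s = (PMF.uniformOfFintype A).map (fun x => some (F x)) ∧
    ∀ x, (F x).time ≤ s.time + T ∧ Below M (F x).reg (F x).arr ∧ Q x (F x).reg (F x).arr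

section Programs

variable {O : ℕ → ℕ → ℕ} {N M : ℕ}

theorem andThen_uniform {A : Type} [Fintype A] [Nonempty A] (F : A → State)
    (f : State → PMF (Option State)) :
    andThen ((PMF.uniformOfFintype A).map fun x => some (F x)) f =
      (PMF.uniformOfFintype A).bind fun x => f (F x) := by
  rw [andThen, PMF.bind_map]
  rfl

theorem Draws.seq {c₁ c₂ : Cmd} {s : State} {T₁ T₂ : ℕ} {A : Type} [Fintype A] [Nonempty A]
    {Q₁ Q₂ : A → (ℕ → ℕ) → (ℕ → ℕ → ℕ) → Prop} (h₁ : Draws O N M c₁ s T₁ A Q₁)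
    (h₂ : ∀ x s', Below M s'.reg s'.arr → Q₁ x s'.reg s'.arr → Runs O N M c₂ s' T₂ (Q₂ x)) :
    Draws O N M (.seq c₁ c₂) s (T₁ + T₂) A Q₂ := by
  obtain ⟨F, e1, p1⟩ := h₁
  choose F' e2 t2 b2 q2 using fun x => h₂ x (F x) (p1 x).2.1 (p1 x).2.2
  refine ⟨F', ?_, fun x => ⟨?_, b2 x, q2 x⟩⟩
  · rw [exec, e1, andThen_uniform]
    simp only [e2]
    rfl
  · have := t2 x
    have := (p1 x).1
    omega

/-- The memory bound may change from `M` to `M'`: the input `k` can exceed the bound that holds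
after the set-up. -/
theorem Runs.seq_draws {M' : ℕ} {c₁ c₂ : Cmd} {s : State} {T₁ T₂ : ℕ} {A : Type} [Fintype A]
    [Nonempty A] {Q₁ : (ℕ → ℕ) → (ℕ → ℕ → ℕ) → Prop} {Q₂ : A → (ℕ → ℕ) → (ℕ → ℕ → ℕ) → Prop}
    (h₁ : Runs O N M c₁ s T₁ Q₁)
    (h₂ : ∀ s', Q₁ s'.reg s'.arr → Draws O N M' c₂ s' T₂ A Q₂) :
    Draws O N M' (.seq c₁ c₂) s (T₁ + T₂) A Q₂ := by
  obtain ⟨s', e1, t1, -, q1⟩ := h₁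
  obtain ⟨F, e2, p2⟩ := h₂ s' q1
  refine ⟨F, by rw [exec, e1, andThen_pure, e2], fun x => ⟨?_, (p2 x).2⟩⟩
  have := (p2 x).1
  omega

/-- Store a random vertex at index `20` of array `0`. -/
def drawCmd : Cmd :=
  .seq (.rand 22 (.bin .sub (.reg 0) (.lit 1))) (.seq (.put 0 (.reg 20) (.reg 22)) (incr 20))

/-- Fill array `0` with random vertices up to the index in register `21`. -/
def fillCmd : Cmd := .loop (.bin .lt (.reg 20) (.reg 21)) drawCmd

theorem exec_rand {x q : ℕ} {e : Expr} {s : State} (h : e.eval s = q) :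
    exec O N (.rand x e) s = (PMF.uniformOfFintype (Fin (q + 1))).map fun r : Fin (q + 1) =>
      some ((s.setReg x r).tick (e.cost s + (1 + q.size))) := by
  subst h
  exact PMF.map_comp (p := PMF.uniformOfFintype (Fin (e.eval s + 1))) Fin.val _

/-- The memory after drawing the random vertex `v`. -/
theorem draws_drawCmd {q : ℕ} {s : State} (hb : Below M s.reg s.arr) (h0 : s.reg 0 = q + 1)
    (h20 : s.reg 20 + 1 < M) :
    Draws O N M drawCmd s (timeFactor drawCmd * (M.size + 1) ^ 2) (Fin (q + 1)) (fun v r a =>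
      r = Function.update (Function.update s.reg 22 v) 20 (s.reg 20 + 1) ∧
      a = Function.update s.arr 0 (Function.update (s.arr 0) (s.reg 20) v)) := by
  have he : (Expr.bin .sub (.reg 0) (.lit 1)).eval s = q := by
    simp [Expr.eval, BinOp.eval, h0]
  have h1 : Draws O N M (.rand 22 (.bin .sub (.reg 0) (.lit 1))) s
      (timeFactor (.rand 22 (.bin .sub (.reg 0) (.lit 1))) * (M.size + 1) ^ 2) (Fin (q + 1))
      (fun v r a => r = Function.update s.reg 22 v ∧ a = s.arr) := by
    refine ⟨fun v => (s.setReg 22 v).tick _, exec_rand he, fun v => ⟨?_, ?_, rfl, rfl⟩⟩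
    · have h1 := cost_expr_le hb (.bin .sub (.reg 0) (.lit 1))
      have h2 := size_val_le hb (.bin .sub (.reg 0) (.lit 1))
      rw [← eval_eq_val, he] at h2
      simp only [State.tick, State.setReg, timeFactor]
      nlinarith [Nat.zero_le (sizeFactor (.bin .sub (.reg 0) (.lit 1)) * (M.size + 1) * M.size)]
    · have := hb.1 0
      exact hb.setReg (by omega) 22
  have h2 := h1.seq (A := Fin (q + 1)) (c₂ := .seq (.put 0 (.reg 20) (.reg 22)) (incr 20))
    (T₂ := timeFactor (.seq (.put 0 (.reg 20) (.reg 22)) (incr 20)) * (M.size + 1) ^ 2)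
    (Q₂ := fun (v : Fin (q + 1)) r a => r = Function.update (Function.update s.reg 22 v) 20 (s.reg 20 + 1) ∧
      a = Function.update s.arr 0 (Function.update (s.arr 0) (s.reg 20) v))
    (fun v s' hb' h => runs_of_wp _ hb' (by
      rw [h.1, h.2]
      simp [wp, incr, val, Fits, BinOp.eval, h20]))
  rw [drawCmd, timeFactor, add_mul]
  exact h2

theorem draws_fillCmd {q : ℕ} {d : ℕ} (hN : d < N) {s : State} (hb : Below M s.reg s.arr)
    (h0 : s.reg 0 = q + 1) (h20 : s.reg 20 + d = s.reg 21) :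
    Draws O N M fillCmd s ((d + 1) * (timeFactor fillCmd * (M.size + 1) ^ 2))
      (Fin d → Fin (q + 1)) (fun ω r a => (∀ x, x ≠ 20 → x ≠ 22 → r x = s.reg x) ∧
        (∀ i : Fin d, a 0 (s.reg 20 + i) = ω i) ∧ ∀ i < s.reg 20, a 0 i = s.arr 0 i) := by
  -- The rule `runs_loop` is for deterministic bodies; here the induction on the number of tests
  -- splits off the first random vertex.
  suffices key : ∀ K d, d < K → ∀ s : State, Below M s.reg s.arr → s.reg 0 = q + 1 →
      s.reg 20 + d = s.reg 21 → ∃ F : (Fin d → Fin (q + 1)) → State,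
        iterate (.bin .lt (.reg 20) (.reg 21)) (exec O N drawCmd) K s =
          (PMF.uniformOfFintype (Fin d → Fin (q + 1))).map (fun x => some (F x)) ∧
        ∀ ω, (F ω).time ≤ s.time + (d + 1) * (timeFactor fillCmd * (M.size + 1) ^ 2) ∧
          Below M (F ω).reg (F ω).arr ∧ (∀ x, x ≠ 20 → x ≠ 22 → (F ω).reg x = s.reg x) ∧
          (∀ i : Fin d, (F ω).arr 0 (s.reg 20 + i) = ω i) ∧
          ∀ i < s.reg 20, (F ω).arr 0 i = s.arr 0 i by
    obtain ⟨F, e1, p1⟩ := key N d hN s hb h0 h20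
    exact ⟨F, by rw [fillCmd, exec, e1], p1⟩
  intro K
  induction K with
  | zero => intro d hd; omega
  | succ K ih =>
    intro d hd s hb h0 h20
    have hcost := cost_expr_le hb (.bin .lt (.reg 20) (.reg 21))
    have hev : (Expr.bin .lt (.reg 20) (.reg 21)).eval s = if s.reg 20 < s.reg 21 then 1 else 0 := rfl
    set tc := (Expr.bin .lt (.reg 20) (.reg 21)).cost s with htc
    have hcf : timeFactor fillCmd =
      1 + evalFactor (.bin .lt (.reg 20) (.reg 21)) + timeFactor drawCmd := rfl
    have hpos : 1 ≤ (M.size + 1) ^ 2 := Nat.one_le_pow _ _ (by omega)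
    rw [hcf]
    obtain _ | d := d
    · refine ⟨fun _ => s.tick (1 + tc), ?_, fun ω => ⟨?_, hb, fun _ _ _ => rfl, fun i => i.elim0,
        fun _ _ => rfl⟩⟩
      · rw [iterate, if_pos (by rw [hev, if_neg (by omega)])]
        exact (PMF.map_const _ _).symm
      · simp only [State.tick]
        nlinarith [Nat.zero_le (timeFactor drawCmd * (M.size + 1) ^ 2)]
    · have h21 := hb.1 21
      obtain ⟨F, e1, p1⟩ := draws_drawCmd (O := O) (N := N) (q := q) (s := s.tick (1 + tc)) hb h0
        (by simp only [State.tick]; omega)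
      choose F' e2 p2 using fun v => ih d (by omega) (F v) (p1 v).2.1
        (by rw [(p1 v).2.2.1]; simpa [State.tick] using h0)
        (by rw [(p1 v).2.2.1]; simp [State.tick]; omega)
      refine ⟨fun ω => F' (ω 0) (Fin.tail ω), ?_, fun ω => ?_⟩
      · rw [iterate, if_neg (by rw [hev, if_pos (by omega)]; exact one_ne_zero), e1, andThen_uniform]
        simp only [e2]
        exact uniform_bind_map d fun v f => some (F' v f)
      · obtain ⟨t1, -, r1, a1⟩ := p1 (ω 0)
        obtain ⟨t2, b2, r2, i2, j2⟩ := p2 (ω 0) (Fin.tail ω)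
        have h20' : (F (ω 0)).reg 20 = s.reg 20 + 1 := by rw [r1]; simp [State.tick]
        rw [h20'] at i2 j2
        refine ⟨?_, b2, fun x hx hx' => ?_, fun i => ?_, fun i hi => ?_⟩
        · simp only [State.tick] at t1
          nlinarith
        · rw [r2 x hx hx', r1]
          simp [State.tick, hx, hx']
        · refine Fin.cases ?_ (fun i => ?_) i
          · rw [Fin.val_zero, add_zero, j2 _ (by omega), a1]
            simp [State.tick]
          · rw [Fin.val_succ, show s.reg 20 + (i + 1 : ℕ) = s.reg 20 + 1 + i by omega, i2]
            rfl
        · rw [j2 _ (by omega), a1]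
          simp [State.tick, Function.update_of_ne (show i ≠ s.reg 20 by omega)]

end Programs

/-! ### The whole program and its execution -/

/-- While register `20` is at most `n`, double it and increase register `2`. -/
def sizeCmd : Cmd :=
  .loop (.bin .lt (.reg 20) (.bin .add (.reg 0) (.lit 1)))
    (.seq (.assign 20 (.bin .add (.reg 20) (.reg 20))) (incr 2))

/-- Compute the parameters of the search. -/
def paramsCmd : Cmd :=
  block [.assign 3 (.bin .mul (.reg 0) (.bin .add (.reg 2) (.lit 8))),
    .ite (.bin .lt (.bin .mul (.lit 2) (.reg 1)) (.reg 0))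
      (.assign 4 (.bin .mul (.lit 64) (.bin .mul (.reg 1) (.reg 1))))
      -- Here `n ≤ 2 * k`. Erasing `k` from register `1` keeps the later memory, and so the bit
      -- costs, independent of the size of `k`.
      (block [const 5 1, copy 4 0, const 1 0]),
    .assign 6 (.bin .mul (.lit 16) (.bin .mul (.bin .mul (.reg 4) (.reg 3))
      (.bin .add (.lit 21) (.bin .mul (.lit 24) (.bin .mul
        (.bin .add (.bin .mul (.lit 3) (.reg 2)) (.lit 7))
        (.bin .add (.bin .mul (.lit 2) (.reg 2)) (.lit 4))))))),
    .assign 21 (.bin .add (.bin .mul (.lit 2) (.reg 3)) (.reg 4)), const 20 0]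

/-- The estimate. -/
def outputCmd : Cmd :=
  .assign 0 (.bin .div (.bin .mul (.reg 0) (.reg 10)) (.bin .mul (.lit 2) (.reg 4)))

def setupCmd : Cmd := .seq (const 20 1) (.seq sizeCmd paramsCmd)

def estimateCmd : Cmd := .seq setupCmd (.seq fillCmd (.seq searchCmd outputCmd))

/-- The whole algorithm. -/
def mainCmd : Cmd :=
  .ite (.reg 0) (.ite (.bin .lt (.reg 1) (.lit 2)) (const 0 0) estimateCmd) .skip

/-- The number of samples. -/
def samples (n k : ℕ) : ℕ := if 2 * k < n then 64 * (k * k) else n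

/-- Whether all vertices are examined instead of random ones. -/
def exactFlag (n k : ℕ) : ℕ := if 2 * k < n then 0 else 1

/-- The number of random draws. -/
def draws (n k : ℕ) : ℕ := 2 * rounds n + samples n k

/-- The numbers in memory stay below this, apart from the input `k`. -/
def memBound (n k : ℕ) : ℕ := (n + 1) * (budget n (samples n k) + 5)

theorem samples_pos {n k : ℕ} (hn : 0 < n) (hk : 0 < k) : 0 < samples n k := by
  rw [samples]
  split_ifs
  · positivity
  · exact hn

theorem rounds_pos {n : ℕ} (hn : 0 < n) : 0 < rounds n := by
  rw [rounds]
  positivity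

theorem mul_le_budget (n s : ℕ) : 16 * (s * rounds n * 21) ≤ budget n s := by
  rw [budget]
  gcongr
  omega

theorem draws_le_budget {n k : ℕ} (hn : 0 < n) (hk : 0 < k) :
    draws n k ≤ budget n (samples n k) := by
  have h1 := rounds_pos hn
  have h2 := samples_pos hn hk
  have h3 := mul_le_budget n (samples n k)
  rw [draws]
  nlinarith

attribute [local irreducible] timeFactor

section Programs

variable {O : ℕ → ℕ → ℕ} {N M : ℕ}

theorem Draws.mono {c : Cmd} {s : State} {T T' : ℕ} {A : Type} [Fintype A] [Nonempty A]
    {Q : A → (ℕ → ℕ) → (ℕ → ℕ → ℕ) → Prop} (h : Draws O N M c s T A Q) (hT : T ≤ T') :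
    Draws O N M c s T' A Q := by
  obtain ⟨F, h1, h2⟩ := h
  exact ⟨F, h1, fun x => ⟨(h2 x).1.trans (by omega), (h2 x).2⟩⟩

/-- The registers while the bit length of `n` is computed. -/
def sizeReg (n k j x : ℕ) : ℕ :=
  if x = 0 then n else if x = 1 then k else if x = 2 then j else if x = 20 then 2 ^ j else 0

theorem runs_sizeCmd {n k : ℕ} (hn : 2 * n + 2 ≤ M) (hN : n.size < N) {s : State}
    (hb : Below M s.reg s.arr) (hreg : s.reg = sizeReg n k 0) :
    Runs O N M sizeCmd s ((n.size + 1) * (timeFactor sizeCmd * (M.size + 1) ^ 2))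
      (fun r a => r = sizeReg n k n.size ∧ a = s.arr) := by
  have h := runs_loop (O := O) (N := N) (M := M)
    (e := .bin .lt (.reg 20) (.bin .add (.reg 0) (.lit 1)))
    (c := .seq (.assign 20 (.bin .add (.reg 20) (.reg 20))) (incr 2))
    (T := timeFactor (.seq (.assign 20 (.bin .add (.reg 20) (.reg 20))) (incr 2)) *
      (M.size + 1) ^ 2)
    (fun d r a => (∃ j, j + d = n.size ∧ r = sizeReg n k j) ∧ a = s.arr) ?_ ?_ hN hb
    ⟨⟨0, by omega, hreg⟩, rfl⟩
  · refine h.mono (le_of_eq (by simp only [sizeCmd, timeFactor]; ring)) ?_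
    · rintro r a - ⟨h0, d, ⟨j, hj, rfl⟩, rfl⟩
      refine ⟨?_, rfl⟩
      have hd : ¬ j < n.size := fun hlt => by
        have := Nat.lt_size.1 hlt
        simp [val, BinOp.eval, sizeReg] at h0
        omega
      rw [show j = n.size by omega]
  · rintro r a ⟨⟨j, hj, rfl⟩, rfl⟩
    have : n < 2 ^ j := by rw [← Nat.size_le]; omega
    simp [val, BinOp.eval, sizeReg]
    omega
  · rintro d s' hb' ⟨⟨j, hj, hr⟩, ha⟩ he
    refine runs_of_wp _ hb' ?_
    rw [hr, ha]
    have : 2 ^ j ≤ n := by rw [← Nat.lt_size]; omega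
    have hs : n.size ≤ n := Nat.size_le.2 Nat.lt_two_pow_self
    simp [wp, incr, val, Fits, BinOp.eval, sizeReg]
    refine ⟨by omega, by omega, j + 1, by omega, ?_⟩
    funext x
    simp only [Function.update_apply, sizeReg]
    split_ifs <;> omega

/-- Only during the set-up does `k` enter the bit costs; afterwards the memory is below `memBound n
k`. -/
theorem runs_setupCmd {n k : ℕ} (hn : 0 < n) (hk : 0 < k) (hN : n.size < N) (t : ℕ) :
    Runs O N (memBound n k + k) setupCmd ((State.init n k).tick t)
      ((n.size + 2) * (timeFactor setupCmd * ((memBound n k + k).size + 1) ^ 2))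
      (fun r a => (r 0 = n ∧ r 3 = rounds n ∧ r 4 = samples n k ∧ r 5 = exactFlag n k ∧
        r 6 = budget n (samples n k) ∧ r 7 = 0 ∧ r 8 = 0 ∧ r 9 = 0 ∧ r 10 = 0 ∧ r 20 = 0 ∧
        r 21 = draws n k) ∧ Below (memBound n k) r a) := by
  set M := memBound n k with hM
  set B := budget n (samples n k) with hB
  have hM' : M = (n + 1) * (B + 5) := rfl
  have hBM : B + 5 + n ≤ M := by rw [hM']; nlinarith
  have hnM : 2 * n + 2 ≤ M := by rw [hM']; nlinarith
  have hsize : n.size ≤ n := Nat.size_le.2 Nat.lt_two_pow_self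
  have hdr : draws n k ≤ B := draws_le_budget hn hk
  clear_value M B
  have hb : Below (M + k) ((State.init n k).tick t).reg ((State.init n k).tick t).arr := by
    refine ⟨fun x => ?_, fun _ _ => by simp only [State.tick, State.init]; omega⟩
    simp only [State.tick, State.init]
    split_ifs <;> omega
  have h1 := runs_of_wp (O := O) (N := N) (const 20 1) (Q := fun r a => r = sizeReg n k 0 ∧ a = fun _ _ => 0) hb (by
    simp only [const, wp, Fits, val, State.tick, State.init]
    refine ⟨by omega, ?_, trivial⟩
    funext x
    simp only [Function.update_apply, sizeReg]
    split_ifs <;> omega)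
  refine Runs.mono (h1.seq fun s' hb' h => (runs_sizeCmd (O := O) (N := N) (n := n) (k := k)
    (show 2 * n + 2 ≤ M + k by omega) hN hb' h.1).seq
    (T₂ := timeFactor paramsCmd * ((M + k).size + 1) ^ 2) fun s'' hb'' h' => runs_of_wp _ hb'' ?_)
    ?_ fun r a _ h => h
  · rw [h'.1, h'.2, h.2]
    have hR : n * (n.size + 8) = rounds n := rfl
    have hRM : rounds n ≤ B := by rw [draws] at hdr; omega
    have hsM : samples n k ≤ B := by rw [draws] at hdr; omega
    by_cases hc : 2 * k < n
    · have hsam : 64 * (k * k) = samples n k := by rw [samples, if_pos hc]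
      have hfl : exactFlag n k = 0 := by rw [exactFlag, if_pos hc]
      have hbud : 16 * (samples n k * rounds n *
        (21 + 24 * ((3 * n.size + 7) * (2 * n.size + 4)))) = B := hB.symm
      have hdr' : 2 * rounds n + samples n k = draws n k := rfl
      simp [paramsCmd, block, wp, const, copy, val, Fits, BinOp.eval, sizeReg, hc, hR, hsam, hbud, hdr', hfl]
      refine ⟨by omega, by omega, by omega, by omega, by omega, fun x => ?_,
        fun _ _ => show 0 < M by omega⟩
      simp only [Function.update_apply, sizeReg]
      split_ifs <;> omega
    · have hsam : n = samples n k := by rw [samples, if_neg hc]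
      have hfl : exactFlag n k = 1 := by rw [exactFlag, if_neg hc]
      have hbud : 16 * (n * rounds n *
        (21 + 24 * ((3 * n.size + 7) * (2 * n.size + 4)))) = B := by rw [hB, ← hsam]; rfl
      have hdr' : 2 * rounds n + n = draws n k := by rw [draws, ← hsam]
      simp [paramsCmd, block, wp, const, copy, val, Fits, BinOp.eval, sizeReg, hc, hR, hbud, hdr', hfl, ← hsam]
      refine ⟨by omega, by omega, by omega, by omega, by omega, by omega, fun x => ?_,
        fun _ _ => show 0 < M by omega⟩
      by_cases hx : x = 1 ∨ x = 20
      · rcases hx with rfl | rfl <;> simp <;> omega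
      · have hupd : ∀ (r : ℕ → ℕ) (y v : ℕ), v < M → r x < M → Function.update r y v x < M := by
          intro r y v hv hr
          rw [Function.update_apply]
          split_ifs
          exacts [hv, hr]
        refine hupd _ _ _ (by omega) (hupd _ _ _ (by omega) (hupd _ _ _ (by omega)
          (hupd _ _ _ (by omega) (hupd _ _ _ (by omega) (hupd _ _ _ (by omega)
          (hupd _ _ _ (by omega) ?_))))))
        rw [sizeReg]
        split_ifs <;> omega
  · simp only [setupCmd, timeFactor]
    nlinarith [Nat.zero_le (timeFactor (const 20 1) * ((M + k).size + 1) ^ 2),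
      Nat.zero_le (timeFactor paramsCmd * ((M + k).size + 1) ^ 2),
      Nat.zero_le (timeFactor sizeCmd * ((M + k).size + 1) ^ 2),
      Nat.zero_le (n.size * (timeFactor (const 20 1) * ((M + k).size + 1) ^ 2)),
      Nat.zero_le (n.size * (timeFactor paramsCmd * ((M + k).size + 1) ^ 2))]

/-- A bound on the running time, up to a constant factor. -/
def timeBound (n k : ℕ) : ℕ :=
  (n.size + 4) * ((memBound n k + k).size + 1) ^ 2 +
    (draws n k + budget n (samples n k) + 3) * ((memBound n k).size + 1) ^ 2

/-- The number of matched ends found in the search, as a function of the random vertices `ω`. -/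
noncomputable def searchCount (O : ℕ → ℕ → ℕ) (n k : ℕ) (ω : ℕ → ℕ) : ℕ :=
  ((step n (rounds n) (samples n k) (exactFlag n k) ω O)^[budget n (samples n k)]
    ⟨[], 0, 0, 0, False⟩).cnt

/-- The sequence `ω` is the content of array `0`; only its drawn cells are specified, and the later
analysis uses no others. -/
theorem draws_estimateCmd {q k : ℕ} (hk : 0 < k) (hO : ∀ u v, O u v ≤ 1)
    (hN : (q + 1).size + budget (q + 1) (samples (q + 1) k) < N) (t : ℕ) :
    Draws O N (memBound (q + 1) k) estimateCmd ((State.init (q + 1) k).tick t)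
      (timeFactor estimateCmd * ((timeBound (q + 1) k))) (Fin (draws (q + 1) k) → Fin (q + 1))
      (fun f r _ => ∃ ω : ℕ → ℕ, (∀ i : Fin (draws (q + 1) k), ω i = f i) ∧
        r 0 = (q + 1) * searchCount O (q + 1) k ω / (2 * samples (q + 1) k)) := by
  set n := q + 1 with hn
  set M := memBound n k with hM
  set B := budget n (samples n k) with hB
  have hM' : M = (n + 1) * (B + 5) := rfl
  have hBM : B + 5 + n ≤ M := by rw [hM']; nlinarith
  have hdr : draws n k ≤ B := draws_le_budget (by omega) hk
  clear_value M B
  have h := (runs_setupCmd (O := O) (N := N) (n := n) (by omega) hk (by omega) t).seq_draws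
    (M' := M) (c₂ := .seq fillCmd (.seq searchCmd outputCmd)) (A := Fin (draws n k) → Fin n)
    (T₂ := (draws n k + 1) * (timeFactor fillCmd * (M.size + 1) ^ 2) +
      ((B + 1) * (timeFactor searchCmd * (M.size + 1) ^ 2) +
        timeFactor outputCmd * (M.size + 1) ^ 2))
    (Q₂ := fun f r _ => ∃ ω : ℕ → ℕ, (∀ i : Fin (draws n k), ω i = f i) ∧
        r 0 = n * searchCount O n k ω / (2 * samples n k)) ?_
  · refine Draws.mono h ?_
    rw [← hn, timeBound, ← hM, ← hB]
    simp only [estimateCmd, timeFactor]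
    generalize timeFactor setupCmd = t₁, timeFactor fillCmd = t₂, timeFactor searchCmd = t₃,
      timeFactor outputCmd = t₄, (M.size + 1) ^ 2 = w, ((M + k).size + 1) ^ 2 = w', n.size = l,
      draws n k = m
    have h1 : (l + 2) * w' ≤ (l + 4) * w' + (m + B + 3) * w := by nlinarith [Nat.zero_le (m * w)]
    have h2 : (m + 1) * w ≤ (l + 4) * w' + (m + B + 3) * w := by nlinarith [Nat.zero_le (l * w')]
    have h3 : (B + 1) * w ≤ (l + 4) * w' + (m + B + 3) * w := by nlinarith [Nat.zero_le (l * w')]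
    have h4 : 1 * w ≤ (l + 4) * w' + (m + B + 3) * w := by nlinarith [Nat.zero_le (l * w')]
    have h1' := Nat.mul_le_mul_left t₁ h1
    have h2' := Nat.mul_le_mul_left t₂ h2
    have h3' := Nat.mul_le_mul_left t₃ h3
    have h4' := Nat.mul_le_mul_left t₄ h4
    linarith
  · rintro s' ⟨⟨h0, h3, h4, h5, h6, h7, h8, h9, h10, h20, h21⟩, hb⟩
    rw [← hM] at hb
    rw [← hB] at h6
    refine (draws_fillCmd (O := O) (N := N) (q := q) (d := draws n k) (by omega) hb h0
      (by omega)).seq ?_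
    rintro f s'' hb'' ⟨hreg, harr, -⟩
    have hreg' : ∀ x < 20, s''.reg x = s'.reg x := fun x hx => hreg x (by omega) (by omega)
    rw [h20] at harr
    simp only [zero_add] at harr
    refine (runs_searchCmd (O := O) (N := N) (n := n) (R := rounds n) (s := samples n k)
      (flag := exactFlag n k) (B := B) (ω := s''.arr 0) (by omega) (by omega)
      (fun u v => (hO u v).trans_lt (by omega)) (by omega) hb'' (by rw [hreg' _ (by omega), h6])
      ⟨by rw [hreg' _ (by omega), h0], by rw [hreg' _ (by omega), h3],
        by rw [hreg' _ (by omega), h4], by rw [hreg' _ (by omega), h5],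
        by rw [hreg' _ (by omega), h7]; rfl, by rw [hreg' _ (by omega), h8],
        by rw [hreg' _ (by omega), h9], by rw [hreg' _ (by omega), h10], rfl, trivial, ?_, ?_, ?_,
        by simp⟩).seq ?_
    · rw [hreg' _ (by omega), h6]; simp
    · rw [hreg' _ (by omega), h6]; simp
    · rw [hreg' _ (by omega), h6]; simp
    · rintro s₃ hb₃ ⟨i0, i4, i10, i10'⟩
      refine runs_of_wp _ hb₃ ?_
      have hlt : n * s₃.reg 10 / (2 * samples n k) < M := by
        refine (Nat.div_le_self _ _).trans_lt ?_
        rw [hM']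
        nlinarith [Nat.mul_le_mul_left n i10]
      simp only [outputCmd, wp, Fits, val, BinOp.eval, i0, i4]
      refine ⟨hlt, s''.arr 0, harr, ?_⟩
      rw [Function.update_self, i10', searchCount, hB]

theorem tick_tick (s : State) (t t' : ℕ) : (s.tick t).tick t' = s.tick (t + t') := by
  simp [State.tick, add_assoc]

theorem draws_mainCmd {q k : ℕ} (hk : 2 ≤ k) (hO : ∀ u v, O u v ≤ 1)
    (hN : (q + 1).size + budget (q + 1) (samples (q + 1) k) < N) :
    Draws O N (memBound (q + 1) k) mainCmd (State.init (q + 1) k)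
      (timeFactor mainCmd * timeBound (q + 1) k) (Fin (draws (q + 1) k) → Fin (q + 1))
      (fun f r _ => ∃ ω : ℕ → ℕ, (∀ i : Fin (draws (q + 1) k), ω i = f i) ∧
        r 0 = (q + 1) * searchCount O (q + 1) k ω / (2 * samples (q + 1) k)) := by
  set s := State.init (q + 1) k with hs
  have hb : ∀ t, Below (memBound (q + 1) k + k) (s.tick t).reg (s.tick t).arr := by
    have hM : q + 1 < memBound (q + 1) k := by rw [memBound]; nlinarith
    refine fun t => ⟨fun x => ?_, fun _ _ => show 0 < _ by omega⟩
    simp only [hs, State.tick, State.init]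
    split_ifs <;> omega
  have e1 : (Expr.reg 0).eval s ≠ 0 := by simp [hs, Expr.eval, State.init]
  set s₁ := s.tick (1 + (Expr.reg 0).cost s) with hs₁
  have e2 : (Expr.bin .lt (.reg 1) (.lit 2)).eval s₁ = 0 := by
    simp [hs₁, hs, Expr.eval, State.init, State.tick, BinOp.eval]
    omega
  have c1 := cost_expr_le (hb 0) (.reg 0)
  have c2 := cost_expr_le (hb (1 + (Expr.reg 0).cost s)) (.bin .lt (.reg 1) (.lit 2))
  obtain ⟨F, h1, h2⟩ := draws_estimateCmd (O := O) (N := N) (show 0 < k by omega) hO hN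
    (1 + (Expr.reg 0).cost s + (1 + (Expr.bin .lt (.reg 1) (.lit 2)).cost s₁))
  refine ⟨F, ?_, fun f => ⟨(h2 f).1.trans ?_, (h2 f).2⟩⟩
  · rw [mainCmd, exec, if_neg e1, exec, if_pos e2, ← h1, tick_tick]
  · have hT : ((memBound (q + 1) k + k).size + 1) ^ 2 ≤ timeBound (q + 1) k := by
      rw [timeBound]
      nlinarith [Nat.zero_le ((draws (q + 1) k + budget (q + 1) (samples (q + 1) k) + 3) *
        ((memBound (q + 1) k).size + 1) ^ 2), Nat.zero_le ((q + 1).size *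
        ((memBound (q + 1) k + k).size + 1) ^ 2)]
    have hpos : 1 ≤ ((memBound (q + 1) k + k).size + 1) ^ 2 := Nat.one_le_pow _ _ (by omega)
    have c1' := c1.trans (Nat.mul_le_mul_left _ hT)
    have c2' := c2.trans (Nat.mul_le_mul_left _ hT)
    change Expr.cost s (.reg 0) ≤ _ at c1'
    change Expr.cost s₁ _ ≤ _ at c2'
    have hT1 := hpos.trans hT
    change 0 + (1 + (Expr.reg 0).cost s + (1 + (Expr.bin .lt (.reg 1) (.lit 2)).cost s₁)) + _ ≤ 0 + _
    simp only [mainCmd, timeFactor]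
    nlinarith [Nat.zero_le (timeFactor (const 0 0) * timeBound (q + 1) k)]

/-- No loop is reached, so `N` is arbitrary. This is the case in which the output `0` is accurate
enough. -/
theorem exec_mainCmd_of_lt {n k : ℕ} (hk : n = 0 ∨ k < 2) :
    ∃ s', exec O N mainCmd (State.init n k) = PMF.pure (some s') ∧ s'.time ≤ 20 + n.size ∧
      s'.reg 0 = 0 := by
  by_cases hn : n = 0
  · subst hn
    refine ⟨_, by rw [mainCmd, exec, if_pos (show Expr.eval (State.init 0 k) (.reg 0) = 0 from rfl), exec], ?_, rfl⟩
    simp [State.tick, State.init, Expr.cost]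
  · have hk' : k < 2 := by tauto
    have e1 : (Expr.reg 0).eval (State.init n k) ≠ 0 := by simpa [Expr.eval, State.init] using hn
    refine ⟨_, by
      rw [mainCmd, exec, if_neg e1, exec, if_neg (by
        simp [Expr.eval, State.init, State.tick, BinOp.eval, hk']), const, exec], ?_, rfl⟩
    have h2 : Nat.size 2 = 2 := rfl
    have hs : k.size ≤ 1 := Nat.size_le.2 (by omega)
    simp [State.tick, State.setReg, State.init, Expr.cost, Expr.eval, BinOp.cost, h2]
    omega

end Programs

/-! ### Bounds for the running time -/

theorem samples_le {n k : ℕ} (hk : 0 < k) : samples n k ≤ 64 * (k * k) := by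
  rw [samples]
  split_ifs with h
  · exact le_rfl
  · nlinarith

/-- A bound in `n` alone, so that the memory has `O(log n)` bits whatever the accuracy. -/
theorem samples_le_sq {n k : ℕ} : samples n k ≤ 64 * (n * n) := by
  rw [samples]
  split_ifs with h
  · have : k ≤ n := by omega
    gcongr
  · nlinarith [Nat.zero_le (n * n), Nat.le_mul_self n]

theorem budget_le (n s : ℕ) : budget n s ≤ 2 ^ 17 * (s * n * (n.size + 1) ^ 3) := by
  rw [budget, rounds]
  calc 16 * (s * (n * (n.size + 8)) * (21 + 24 * ((3 * n.size + 7) * (2 * n.size + 4))))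
      = 16 * (s * n) * ((n.size + 8) * (21 + 24 * ((3 * n.size + 7) * (2 * n.size + 4)))) := by ring
    _ ≤ 16 * (s * n) * (2 ^ 13 * (n.size + 1) ^ 3) := by
        refine Nat.mul_le_mul_left _ ?_
        generalize n.size = l
        ring_nf
        nlinarith [Nat.zero_le l, Nat.zero_le (l ^ 2), Nat.zero_le (l ^ 3)]
    _ = _ := by ring

theorem size_memBound_le {n k : ℕ} (hn : 0 < n) : (memBound n k).size ≤ 35 * (n.size + 1) := by
  have hl : n < 2 ^ n.size := Nat.lt_size_self n
  have hs : n.size ≤ n := Nat.size_le.2 Nat.lt_two_pow_self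
  have h1 := budget_le n (samples n k)
  have h2 := samples_le_sq (n := n) (k := k)
  have h3 : (n.size + 1) ^ 3 ≤ (2 * n) ^ 3 := Nat.pow_le_pow_left (by omega) 3
  have h4 : budget n (samples n k) ≤ 2 ^ 26 * n ^ 6 := by
    calc _ ≤ 2 ^ 17 * (samples n k * n * (n.size + 1) ^ 3) := h1
      _ ≤ 2 ^ 17 * (64 * (n * n) * n * (2 * n) ^ 3) := by gcongr
      _ = _ := by ring
  have h5 : memBound n k ≤ 2 ^ 35 * n ^ 7 := by
    have h6 : 1 ≤ n ^ 6 := Nat.one_le_pow _ _ hn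
    calc memBound n k ≤ (2 * n) * (2 ^ 26 * n ^ 6 + 5 * n ^ 6) := by
          rw [memBound]
          exact Nat.mul_le_mul (by omega) (by omega)
      _ = (2 * (2 ^ 26 + 5)) * n ^ 7 := by ring
      _ ≤ _ := Nat.mul_le_mul_right _ (by norm_num)
  rw [Nat.size_le]
  calc memBound n k ≤ 2 ^ 35 * n ^ 7 := h5
    _ < 2 ^ 35 * (2 ^ n.size) ^ 7 := by gcongr
    _ = 2 ^ (35 + 7 * n.size) := by rw [pow_add, mul_comm 7, pow_mul]
    _ ≤ _ := Nat.pow_le_pow_right (by norm_num) (by omega)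

/-- In the set-up term, the square of the bit length of `k` is crudely absorbed into `k ^ 2`. -/
theorem timeBound_le {n k : ℕ} (hn : 0 < n) (hk : 0 < k) :
    timeBound n k ≤ 2 ^ 40 * (n * k ^ 2 * (n.size + 1) ^ 5) := by
  have h1 := size_memBound_le (k := k) hn
  have hks : k.size ≤ k := Nat.size_le.2 Nat.lt_two_pow_self
  have h2 : (memBound n k + k).size + 1 ≤ 38 * ((n.size + 1) * k) := by
    have := size_add_le (memBound n k) k
    nlinarith [Nat.zero_le (n.size * (k - 1))]
  have h3 : (memBound n k).size + 1 ≤ 36 * (n.size + 1) := by omega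
  have h4 : budget n (samples n k) ≤ 2 ^ 23 * (n * k ^ 2 * (n.size + 1) ^ 3) := by
    calc _ ≤ 2 ^ 17 * (samples n k * n * (n.size + 1) ^ 3) := budget_le n _
      _ ≤ 2 ^ 17 * (64 * (k * k) * n * (n.size + 1) ^ 3) := by
          gcongr
          exact samples_le hk
      _ = _ := by ring
  have h5 := draws_le_budget hn hk
  have hl : 1 ≤ n.size + 1 := by omega
  set l := n.size + 1 with hl'
  have hX : 1 ≤ n * k ^ 2 * l ^ 3 := Nat.mul_pos (Nat.mul_pos hn (by positivity)) (by positivity)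
  calc timeBound n k ≤ (4 * l) * (38 * (l * k)) ^ 2 +
        (2 ^ 25 * (n * k ^ 2 * l ^ 3)) * (36 * l) ^ 2 := by
        rw [timeBound]
        gcongr <;> omega
    _ = 5776 * (1 * k ^ 2 * l ^ 3 * 1) + 2 ^ 25 * 1296 * (n * k ^ 2 * l ^ 5) := by ring
    _ ≤ 5776 * (n * k ^ 2 * l ^ 3 * l ^ 2) + 2 ^ 25 * 1296 * (n * k ^ 2 * l ^ 5) := by
        gcongr
        · exact hn
        · exact Nat.one_le_pow _ _ hl
    _ = (5776 + 2 ^ 25 * 1296) * (n * k ^ 2 * l ^ 5) := by ring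
    _ ≤ _ := Nat.mul_le_mul_right _ (by norm_num)

theorem size_le_log {n : ℕ} (hn : 0 < n) : (n.size + 1 : ℝ) ≤ 2 * (1 + Real.log n) := by
  have h0 : 0 < n.size := Nat.size_pos.2 hn
  obtain ⟨m, hm⟩ : ∃ m, n.size = m + 1 := ⟨n.size - 1, by omega⟩
  have h1 : 2 ^ m ≤ n := Nat.lt_size.1 (by omega)
  have h2 : (m : ℝ) * Real.log 2 ≤ Real.log n := by
    rw [← Real.log_pow]
    exact Real.log_le_log (by positivity) (by exact_mod_cast h1)
  have h3 := Real.log_two_gt_d9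
  rw [hm]
  push_cast
  nlinarith [Nat.cast_nonneg (α := ℝ) m]

/-- The running time in terms of the accuracy `ε`. -/
theorem timeBound_le_real {n k : ℕ} {ε : ℝ} (hn : 0 < n) (hε : 0 < ε) (hk : 2 ≤ k)
    (hkε : k = ⌈1 / ε⌉₊) : (timeBound n k : ℝ) ≤
      2 ^ 47 * (1 + (n : ℝ) ^ (3 / 2 : ℝ) / ε ^ 2) * (1 + Real.log n) ^ 5 := by
  have h1 : (timeBound n k : ℝ) ≤ 2 ^ 40 * (n * k ^ 2 * (n.size + 1) ^ 5) := by
    exact_mod_cast timeBound_le hn (by omega)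
  have hn1 : (1 : ℝ) ≤ n := by exact_mod_cast hn
  -- The time is linear in `n` up to logarithms; the exponent `3 / 2` enters only by this weakening.
  have h2 : (n : ℝ) ≤ (n : ℝ) ^ (3 / 2 : ℝ) := by
    conv_lhs => rw [← Real.rpow_one (n : ℝ)]
    exact Real.rpow_le_rpow_of_exponent_le hn1 (by norm_num)
  have h3 : (k : ℝ) < 1 / ε + 1 := by rw [hkε]; exact Nat.ceil_lt_add_one (by positivity)
  have hk2 : (2 : ℝ) ≤ k := by exact_mod_cast hk
  -- From `k ≥ 2` it follows that `1 / ε > 1`, so rounding up at most doubles.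
  have h4 : (k : ℝ) ≤ 2 * (1 / ε) := by linarith
  have hlog : 0 ≤ Real.log n := Real.log_nonneg hn1
  have h5 := size_le_log hn
  calc (timeBound n k : ℝ) ≤ 2 ^ 40 * (n * k ^ 2 * (n.size + 1) ^ 5) := h1
    _ ≤ 2 ^ 40 * ((n : ℝ) ^ (3 / 2 : ℝ) * (2 * (1 / ε)) ^ 2 * (2 * (1 + Real.log n)) ^ 5) := by
        gcongr
    _ = 2 ^ 47 * ((n : ℝ) ^ (3 / 2 : ℝ) / ε ^ 2) * (1 + Real.log n) ^ 5 := by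
        field_simp
    _ ≤ _ := by
        gcongr
        exact le_add_of_nonneg_left zero_le_one

/-! ### Probability of success and accuracy of the output -/

/-- Splitting a sequence into three parts. -/
def splitEquiv (V : Type*) (R s : ℕ) :
    (Fin (2 * R + s) → V) ≃ (Fin R → V) × (Fin R → V) × (Fin s → V) where
  toFun ω := (fun i => ω ⟨i, by omega⟩, fun i => ω ⟨R + i, by omega⟩, fun i => ω ⟨2 * R + i, by omega⟩)
  invFun p i := if h : i < R then p.1 ⟨i, h⟩ else if h' : i < 2 * R then p.2.1 ⟨i - R, by omega⟩
    else p.2.2 ⟨i - 2 * R, by omega⟩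
  left_inv ω := by
    funext i
    dsimp only
    split_ifs with h h'
    · rfl
    · congr 1
      exact Fin.ext (by simp; omega)
    · congr 1
      exact Fin.ext (by simp; omega)
  right_inv p := by
    obtain ⟨f, g, S⟩ := p
    refine Prod.ext (funext fun i => ?_) (Prod.ext (funext fun i => ?_) (funext fun i => ?_))
    · simp
    · have := i.2
      simp [show R + (i : ℕ) < 2 * R by omega]
    · simp [show ¬ 2 * R + (i : ℕ) < R by omega]

variable {n k : ℕ}

/-- The vertices that are examined, as a function of the random ones. -/
def examined (n k : ℕ) (S : Fin (samples n k) → Fin n) (t : Fin (samples n k)) : Fin n :=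
  if h : 2 * k < n then S t else ⟨t, by have := t.2; simp only [samples, if_neg h] at this; exact this⟩

theorem sum_examined (h : ¬ 2 * k < n) (g : Fin n → ℕ) (S : Fin (samples n k) → Fin n) :
    ∑ t, g (examined n k S t) = ∑ v, g v := by
  refine Fintype.sum_equiv (finCongr (by rw [samples, if_neg h])) _ _ fun t => ?_
  rw [examined, dif_neg h]
  rfl

/-- The event that the random vertices `ω` lead to a good estimate in time. -/
def GoodDraw (G : SimpleGraph (Fin n)) [NeZero n] (k : ℕ) (ω : Fin (draws n k) → Fin n) : Prop :=
  let p := splitEquiv (Fin n) (rounds n) (samples n k) ω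
  Good G k (samples n k) (extend p.1) (extend p.2.1) (examined n k p.2.2)

open Classical in
-- Splitting the draws into colours and samples gives the triple sum of `sum_not_good_le`. If all
-- vertices are examined, the deviation is zero.
theorem card_not_goodDraw_le [NeZero n] (hk : 0 < k) (G : SimpleGraph (Fin n)) :
    3 * (univ.filter fun ω => ¬ GoodDraw G k ω).card ≤ n ^ draws n k := by
  have hn : 0 < n := Nat.pos_of_neZero n
  have hs := samples_pos hn hk
  have key : ∀ N, Fintype.card (Fin n) = N →
      3 * ∑ f : Fin (rounds N) → Fin n, ∑ g : Fin (rounds N) → Fin n,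
        ∑ S : Fin (samples n k) → Fin n,
          (if Good G k (samples n k) (extend f) (extend g) (examined n k S) then (0 : ℝ) else 1) ≤
      (N : ℝ) ^ rounds N * ((N : ℝ) ^ rounds N * (N : ℝ) ^ samples n k) := by
    rintro _ rfl
    refine sum_not_good_le G (by simpa using hn) k _ hs (examined n k) (fun g => ?_) fun q hq => ?_
    · by_cases h : 2 * k < n
      · have := sum_samples g (samples n k)
        simpa only [examined, dif_pos h] using this
      · simp only [sum_examined h, sum_const, card_univ, Fintype.card_fun, Fintype.card_fin,
          smul_eq_mul]
        rw [show samples n k = n by rw [samples, if_neg h]]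
        ring
    · by_cases h : 2 * k < n
      · have := card_deviation_le q hq (samples n k) k hk
          (by rw [samples, if_pos h, pow_two]) (by simpa using hn)
        simpa only [examined, dif_pos h] using this
      · simp only [sum_examined h, Fintype.card_fin]
        rw [show samples n k = n by rw [samples, if_neg h]]
        simp only [sub_self, abs_zero, mul_zero]
        rw [filter_false_of_mem fun _ _ => not_lt.2 (by positivity)]
        simp
  have h := key n (Fintype.card_fin n)
  have h2 : ((univ.filter fun ω => ¬ GoodDraw G k ω).card : ℝ) =
      ∑ f : Fin (rounds n) → Fin n, ∑ g : Fin (rounds n) → Fin n,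
        ∑ S : Fin (samples n k) → Fin n,
          (if Good G k (samples n k) (extend f) (extend g) (examined n k S) then (0 : ℝ) else 1) := by
    rw [card_filter, Nat.cast_sum]
    refine (Fintype.sum_equiv (splitEquiv (Fin n) (rounds n) (samples n k)) _ (fun p =>
      if Good G k (samples n k) (extend p.1) (extend p.2.1) (examined n k p.2.2) then (0 : ℝ) else 1)
      fun ω => ?_).trans ?_
    · by_cases hg : GoodDraw G k ω
      · rw [if_neg (not_not.2 hg), Nat.cast_zero]
        exact (if_pos hg).symm
      · rw [if_pos hg, Nat.cast_one]
        exact (if_neg hg).symm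
    · simp only [Fintype.sum_prod_type]
  rw [← h2] at h
  have h3 : ((3 * (univ.filter fun ω => ¬ GoodDraw G k ω).card : ℕ) : ℝ) ≤ (n ^ draws n k : ℕ) := by
    push_cast
    refine h.trans (le_of_eq ?_)
    rw [draws]
    ring
  exact_mod_cast h3

theorem toOuterMeasure_map_ge {A : Type} [Fintype A] [Nonempty A] (F : A → State) (P : A → Prop)
    [DecidablePred P] (good : State → Prop) (hF : ∀ x, P x → good (F x))
    (hP : 3 * (univ.filter fun x => ¬ P x).card ≤ Fintype.card A) :
    2 / 3 ≤ ((PMF.uniformOfFintype A).map fun x => some (F x)).toOuterMeasure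
      {o | ∃ s : State, o = some s ∧ good s} := by
  classical
  rw [PMF.toOuterMeasure_map_apply]
  have h1 : (2 / 3 : ENNReal) ≤ (PMF.uniformOfFintype A).toOuterMeasure {x | P x} := by
    rw [PMF.toOuterMeasure_uniformOfFintype_apply]
    have h2 : Fintype.card {x | P x} + (univ.filter fun x => ¬ P x).card = Fintype.card A := by
      rw [← Set.toFinset_card, Set.toFinset_ofPred, card_filter_add_card_filter_not, card_univ]
    rw [ENNReal.le_div_iff_mul_le (Or.inl (by simp)) (Or.inl (by simp)), mul_comm, ← mul_div_assoc,
      ENNReal.div_le_iff_le_mul (Or.inl (by norm_num)) (Or.inl (by norm_num))]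
    have h3 : Fintype.card A * 2 ≤ Fintype.card {x | P x} * 3 := by omega
    exact_mod_cast h3
  refine h1.trans ((PMF.uniformOfFintype A).toOuterMeasure.mono ?_)
  exact fun x hx => ⟨F x, rfl, hF x hx⟩

/-- The sampling error in the size is at most `n / (2 * k)`, and rounding down loses at most `1 ≤ n
/ (2 * k)`. -/
theorem abs_sub_div_le {s X Y : ℕ} (hs : 0 < s) (hk : 0 < k) (h : 2 * k ≤ n)
    (hdev : k * |(n : ℝ) * (Y : ℕ) - s * (2 * X : ℕ)| ≤ n * s) :
    k * |(X : ℝ) - (n * Y / (2 * s) : ℕ)| ≤ n := by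
  set out := n * Y / (2 * s) with hout
  have h1 : out * (2 * s) ≤ n * Y := Nat.div_mul_le_self _ _
  have h2 : n * Y < (out + 1) * (2 * s) := by
    rw [mul_comm (out + 1)]
    exact Nat.lt_mul_div_succ _ (by omega)
  have h1' : (out : ℝ) * (2 * s) ≤ n * Y := by exact_mod_cast h1
  have h2' : (n : ℝ) * Y < (out + 1) * (2 * s) := by exact_mod_cast h2
  have hsr : (0 : ℝ) < s := by exact_mod_cast hs
  have hkr : (0 : ℝ) < k := by exact_mod_cast hk
  have hkn : 2 * (k : ℝ) ≤ n := by exact_mod_cast h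
  push_cast at hdev
  have h3 := mul_le_mul_of_nonneg_left h1' hkr.le
  have h4 := mul_le_mul_of_nonneg_left h2'.le hkr.le
  have h5 := mul_le_mul_of_nonneg_right hkn hsr.le
  have h6 := mul_le_mul_of_nonneg_left (le_abs_self ((n : ℝ) * Y - s * (2 * X))) hkr.le
  have h7 := mul_le_mul_of_nonneg_left (neg_abs_le ((n : ℝ) * Y - s * (2 * X))) hkr.le
  refine le_of_mul_le_mul_right (a := 2 * (s : ℝ)) ?_ (by positivity)
  rcases abs_cases ((X : ℝ) - out) with ⟨e, -⟩ | ⟨e, -⟩ <;> rw [e] <;> linarith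

/-- If the draws are good, then the number computed from them is a good estimate. -/
theorem exists_pair_of_goodDraw [NeZero n] (hk : 0 < k) (G : SimpleGraph (Fin n))
    {w : Fin (draws n k) → Fin n} (hw : GoodDraw G k w) {ω : ℕ → ℕ}
    (hω : ∀ i : Fin (draws n k), ω i = w i) :
    ∃ M₁ M₂ : G.Subgraph, IsMaximalMatchingPair G M₁ M₂ ∧
      k * |(matchingPairSize M₁ M₂ : ℝ) -
        (n * searchCount (pairOracle G) n k ω / (2 * samples n k) : ℕ)| ≤ n := by
  classical
  have hn : 0 < n := Nat.pos_of_neZero n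
  have hs := samples_pos hn hk
  set p := splitEquiv (Fin n) (rounds n) (samples n k) w with hp
  obtain ⟨c1, c2, hB, hdev⟩ : Good G k (samples n k) (extend p.1) (extend p.2.1)
    (examined n k p.2.2) := hw
  simp only [Fintype.card_fin] at c1 c2 hB hdev
  set σ : ℕ → Fin n := extend p.1 with hσ
  set τ : ℕ → Fin n := extend p.2.1 with hτ
  have hm : draws n k = 2 * rounds n + samples n k := rfl
  obtain ⟨M₁, M₂, hM, hsize⟩ := exists_maximal_pair G c1 c2
  have hX : 2 * matchingPairSize M₁ M₂ = ∑ v, coverCount G σ τ (rounds n) v := by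
    rw [hsize (univ.filter fun v => v ∉ free G σ (rounds n))
      (univ.filter fun v => v ∉ free (G \ greedy G σ (rounds n)) τ (rounds n)) (by simp) (by simp),
      card_filter, card_filter, ← sum_add_distrib]
    refine sum_congr rfl fun v _ => ?_
    rw [coverCount]
    split_ifs <;> simp_all
  have hY : searchCount (pairOracle G) n k ω =
      ∑ t, coverCount G σ τ (rounds n) (examined n k p.2.2 t) := by
    obtain ⟨l, hl, hrun⟩ := leads_done (G := G) (R := rounds n) (s := samples n k) (flag := exactFlag n k) (ω := ω)
      (σ := σ) (τ := τ)
      (fun i hi => by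
        rw [hσ, extend, dif_pos hi]
        exact hω ⟨i, by omega⟩)
      (fun i hi => by
        rw [hτ, extend, dif_pos hi]
        exact hω ⟨rounds n + i, by omega⟩)
      (examined n k p.2.2) (fun t => by
        have ht := t.2
        rw [examined, exactFlag]
        by_cases h : 2 * k < n
        · rw [if_pos (if_pos h), dif_pos h]
          exact hω ⟨2 * rounds n + t, by omega⟩
        · rw [if_neg (by rw [if_neg h]; exact one_ne_zero), dif_neg h])
    -- The steps left in the budget do not change the finished configuration.
    rw [searchCount, show budget n (samples n k) = (budget n (samples n k) - l) + l by omega,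
      Function.iterate_add_apply, hrun, Function.iterate_fixed]
    simp [step]
  refine ⟨M₁, M₂, hM, ?_⟩
  rw [hY]
  set Y := ∑ t, coverCount G σ τ (rounds n) (examined n k p.2.2 t) with hY'
  set X := matchingPairSize M₁ M₂ with hX'
  rw [← hX] at hdev
  by_cases h : 2 * k < n
  · exact abs_sub_div_le hs hk h.le hdev
  · rw [hY', sum_examined h, ← hX, show samples n k = n by rw [samples, if_neg h],
      show n * (2 * X) = X * (2 * n) by ring, Nat.mul_div_cancel _ (by omega)]
    simp

/-- Listing the colours in order already gives a maximal pair, and each matching covers at most `n`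
vertices. -/
theorem exists_maximal_pair_le (G : SimpleGraph (Fin n)) :
    ∃ M₁ M₂ : G.Subgraph, IsMaximalMatchingPair G M₁ M₂ ∧ matchingPairSize M₁ M₂ ≤ n := by
  classical
  obtain _ | q := n
  · refine ⟨⊥, ⊥, ⟨⟨fun v => v.elim0, fun v => v.elim0, ?_⟩, fun v => v.elim0⟩, ?_⟩
    · simp
    · simp [matchingPairSize]
  · have hσ : ∀ c : Fin (q + 1), ∃ j < q + 1, Fin.ofNat (q + 1) j = c := fun c =>
      ⟨c, c.2, by simp⟩
    obtain ⟨M₁, M₂, hM, h⟩ := exists_maximal_pair G hσ hσ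
    refine ⟨M₁, M₂, hM, ?_⟩
    have h1 := h (univ.filter fun v => v ∉ free G (Fin.ofNat (q + 1)) (q + 1))
      (univ.filter fun v => v ∉ free (G \ greedy G (Fin.ofNat (q + 1)) (q + 1))
        (Fin.ofNat (q + 1)) (q + 1)) (by simp) (by simp)
    have h2 : ∀ s : Finset (Fin (q + 1)), s.card ≤ q + 1 := fun s => by
      simpa using card_le_univ s
    have := h2 (univ.filter fun v => v ∉ free G (Fin.ofNat (q + 1)) (q + 1))
    have := h2 (univ.filter fun v => v ∉ free (G \ greedy G (Fin.ofNat (q + 1)) (q + 1))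
        (Fin.ofNat (q + 1)) (q + 1))
    omega

theorem pairOracle_le_one (G : SimpleGraph (Fin n)) (u v : ℕ) : pairOracle G u v ≤ 1 := by
  rw [pairOracle]
  split_ifs <;> omega

end PairGreedy

/-- There is one randomized pair-query algorithm that, given `n` and the accuracy parameter `ε`
(through the integer `⌈1/ε⌉`), runs in time `Õ(1 + n^{1.5}/ε²)`, and with probability at
least `2/3` outputs a number within `ε n` of the size of some maximal matching pair of `G`. -/
theorem mainTheorem9 :
    ∃ (P : PairRAM.Cmd) (C : ℝ) (d : ℕ), 0 < C ∧
      ∀ (n : ℕ) (ε : ℝ), 0 < ε → ∀ G : SimpleGraph (Fin n),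
        PairRAM.Computes P G ⌈1 / ε⌉₊
          (C * (1 + (n : ℝ) ^ (3 / 2 : ℝ) / ε ^ 2) * (1 + Real.log n) ^ d)
          (2 / 3)
          (fun out => ∃ M₁ M₂ : G.Subgraph, IsMaximalMatchingPair G M₁ M₂ ∧
            |(matchingPairSize M₁ M₂ : ℝ) - (out : ℝ)| ≤ ε * n) := by
  -- The `100` covers the runs without a search. The exponent `5` comes from the cube in the budget
  -- and the square in the bit costs.
  refine ⟨PairGreedy.mainCmd, PairGreedy.timeFactor PairGreedy.mainCmd * 2 ^ 47 + 100, 5,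
    by positivity, fun n ε hε G => ?_⟩
  have hlog : 0 ≤ Real.log n := Real.log_natCast_nonneg n
  have hA : 1 ≤ 1 + (n : ℝ) ^ (3 / 2 : ℝ) / ε ^ 2 := le_add_of_nonneg_right (by positivity)
  have hkε : 1 / ε ≤ ⌈1 / ε⌉₊ := Nat.le_ceil _
  rw [div_le_iff₀ hε] at hkε
  set k := ⌈1 / ε⌉₊ with hk
  by_cases hs : n = 0 ∨ k < 2
  · obtain ⟨s, he, ht, h0⟩ := PairGreedy.exec_mainCmd_of_lt (O := PairRAM.pairOracle G) (N := 0) hs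
    refine ⟨0, fun o ho => ⟨s, ?_, ?_⟩, ?_⟩
    · rw [he] at ho
      simpa using ho
    · have h1 : (n.size : ℝ) ≤ 2 * (1 + Real.log n) := by
        rcases Nat.eq_zero_or_pos n with rfl | hn
        · simp
        · linarith [PairGreedy.size_le_log hn]
      have h2 : 1 + Real.log n ≤ (1 + Real.log n) ^ 5 := le_self_pow₀ (by linarith) (by norm_num)
      have h3 : (s.time : ℝ) ≤ 20 + n.size := by exact_mod_cast ht
      calc (s.time : ℝ) ≤ 100 * 1 * (1 + Real.log n) ^ 5 := by linarith
        _ ≤ _ := by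
          gcongr
          exact le_add_of_nonneg_left (by positivity)
    · rw [he, PMF.toOuterMeasure_pure_apply, if_pos]
      · exact ENNReal.div_le_of_le_mul (by norm_num)
      · obtain ⟨M₁, M₂, hM, hsize⟩ := PairGreedy.exists_maximal_pair_le G
        refine ⟨s, rfl, M₁, M₂, hM, ?_⟩
        have h1 : (matchingPairSize M₁ M₂ : ℝ) ≤ n := by exact_mod_cast hsize
        rw [h0, Nat.cast_zero, sub_zero, Nat.abs_cast]
        rcases hs with rfl | hs
        · simpa using h1
        · have h2 : (k : ℝ) ≤ 1 := by exact_mod_cast Nat.lt_succ_iff.1 hs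
          have h3 : 1 ≤ ε := hkε.trans (mul_le_of_le_one_left hε.le h2)
          exact h1.trans (le_mul_of_one_le_left (Nat.cast_nonneg n) h3)
  · obtain ⟨hn, hk2⟩ := not_or.1 hs
    rw [not_lt] at hk2
    obtain ⟨q, rfl⟩ : ∃ q, n = q + 1 := ⟨n - 1, by omega⟩
    obtain ⟨F, hF, hprop⟩ := PairGreedy.draws_mainCmd (O := PairRAM.pairOracle G) (q := q) hk2
      (PairGreedy.pairOracle_le_one G) (Nat.lt_succ_self _)
    -- Each of the three loops tests its condition at most this often, since `draws ≤ budget`.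
    refine ⟨(q + 1).size + PairGreedy.budget (q + 1) (PairGreedy.samples (q + 1) k) + 1,
      fun o ho => ?_, ?_⟩
    · rw [hF, PMF.mem_support_map_iff] at ho
      obtain ⟨w, -, rfl⟩ := ho
      refine ⟨F w, rfl, ?_⟩
      have h1 : ((F w).time : ℝ) ≤ PairGreedy.timeFactor PairGreedy.mainCmd *
          PairGreedy.timeBound (q + 1) k := by
        have := (hprop w).1
        simp only [PairRAM.State.init, zero_add] at this
        exact_mod_cast this
      have h2 := PairGreedy.timeBound_le_real (Nat.succ_pos q) hε hk2 hk
      calc _ ≤ _ := h1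
        _ ≤ _ := mul_le_mul_of_nonneg_left h2 (Nat.cast_nonneg _)
        _ = (PairGreedy.timeFactor PairGreedy.mainCmd * 2 ^ 47) *
            (1 + ((q + 1 : ℕ) : ℝ) ^ (3 / 2 : ℝ) / ε ^ 2) * (1 + Real.log (q + 1 : ℕ)) ^ 5 := by ring
        _ ≤ _ := by
          gcongr
          exact le_add_of_nonneg_right (by norm_num)
    · classical
      rw [hF]
      refine PairGreedy.toOuterMeasure_map_ge F (PairGreedy.GoodDraw G k) _ (fun w hw => ?_) ?_
      · obtain ⟨ω, hω, hr⟩ := (hprop w).2.2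
        obtain ⟨M₁, M₂, hM, h⟩ := PairGreedy.exists_pair_of_goodDraw (by omega) G hw hω
        refine ⟨M₁, M₂, hM, ?_⟩
        rw [hr]
        have hk0 : (0 : ℝ) < k := by exact_mod_cast (show 0 < k by omega)
        refine le_of_mul_le_mul_left (h.trans ?_) hk0
        rw [← mul_assoc]
        exact le_mul_of_one_le_left (Nat.cast_nonneg _) hkε
      · simpa using PairGreedy.card_not_goodDraw_le (by omega) G
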